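/- Setting. Let $\mathcal S\subset\mathbb C\setminus\{0\}$ be a finite constellation and let $\mathbf s=(s_1,\dots,s_N)^T$ have independent entries, uniformly distributed on $\mathcal S$. Assume that a generic symbol $s$ satisfies $\mathbb E|s|^2=1$, $\mathbb E s=0$, $\mathbb E s^2=0$, that $\mathcal S$ is centrally symmetric ($z\in\mathcal S$ implies $-z\in\mathcal S$, on every ring $|z|^2=r$), and that the constellation is sub-Gaussian, i.e. its kurtosis $\kappa=\mathbb E|s-\mathbb Es|^4/(\mathbb E|s-\mathbb Es|^2)^2=\mathbb E|s|^4$ satisfies $\kappa<2$. Fix $L\ge 1$, distinct real delays $\tau_1,\dots,\tau_L$, nonzero complex amplitudes $\beta_1,\dots,\beta_L$, a noise level $\sigma>0$ and $\rho\in(0,1)$, all independent of $N$. Let $[\mathbf F_N]_{m,n}=N^{-1/2}e^{-2\pi i(m-1)(n-1)/N}$ be the normalized DFT matrix, and for real $\tau$ let $\mathbf P_\tau=\mathbf F_N^H\operatorname{Diag}\{e^{-2\pi i(n-1)\tau/N}\}_{n=1}^N\mathbf F_N$. For a unitary $\mathbf U\in\mathbb C^{N\times N}$ put $\mathbf x=\mathbf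 U\mathbf s$, $\boldsymbol\theta=(\tau_\ell,\operatorname{Re}\beta_\ell,\operatorname{Im}\beta_\ell)_{\ell=1}^L\in\mathbb R^{3L}$ and $\boldsymbol\mu_{\boldsymbol\theta}=\sum_{\ell}\beta_\ell\mathbf P_{\tau_\ell}\mathbf x$. Let $\mathbf J(\mathbf U,\mathbf s)\in\mathbb R^{3L\times 3L}$ be the Fisher information matrix of the model $\mathbf y\sim\mathcal{CN}(\boldsymbol\mu_{\boldsymbol\theta},\sigma^2\mathbf I)$ given $\mathbf x$, that is $$J_{k,l}=\frac{2}{\sigma^2}\operatorname{Re}\Big\{\Big(\frac{\partial\boldsymbol\mu}{\partial\theta_k}\Big)^H\frac{\partial\boldsymbol\mu}{\partial\theta_l}\Big\},$$ and let the ranging CRB $f(\mathbf U,\mathbf s)$ be the sum of the $L$ diagonal entries of $\mathbf J(\mathbf U,\mathbf s)^{-1}$ that belong to the delays. Put $\bar{\mathbf J}=\mathbb E\,\mathbf J(\mathbf U,\mathbf s)$, $\mathbf Z=\bar{\mathbf J}^{-1}(\mathbf J-\bar{\mathbf J})$ and $\Omega_N=\Omega_N(\mathbf U)=\{\mathbf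 s:\|\mathbf Z\|_2<\rho\}$, where $\|\cdot\|_2$ is the spectral norm. For a unit vector $\mathbf u\in\mathbb C^N$ let $p_k=|[\mathbf F_N\mathbf u]_k|^2$ and $f_k=(k-1)/N$, and let $B_{\rm rms}(\mathbf u)=\big(\sum_k (f_k-\bar f)^2p_k\big)^{1/2}$ with $\bar f=\sum_k f_kp_k$. A unitary matrix is called $\alpha$-frequency-spread if each of its columns $\mathbf u_n$ has $B_{\rm rms}(\mathbf u_n)\ge\alpha$. Theorem (Large-$N$ superiority of OFDM). Fix $\alpha>0$, a set $\mathcal N\subseteq\mathbb N$ of block lengths (for instance all sufficiently large ones) and a waveform $\mathbf U=(\mathbf U_N)_{N\in\mathcal N}$ such that every $\mathbf U_N$, $N\in\mathcal N$, is an $N\times N$ unitary $\alpha$-frequency-spread matrix. Then there are constants $c_\alpha(\mathbf U)>0$ and $N_0(\mathbf U)$, independent of $N$, such that for all $N\in\mathcal N$ with $N\ge N_0(\mathbf U)$ the conditional expectations below are well defined (the conditioning events have positive probability, and the Fisher information matrices are invertible almost surely on them) and $$\mathbb E[f(\mathbf U_N,\mathbf s)\mid\Omega_N]-\mathbb E[f(\mathbf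 F_N^H,\mathbf s)\mid\Omega_N]\ \ge\ \frac{c_\alpha(\mathbf U)}{N^2}.$$ In particular OFDM has a strictly smaller conditional expected ranging CRB: $\mathbb E[f(\mathbf F_N^H,\mathbf s)\mid\Omega_N]<\mathbb E[f(\mathbf U_N,\mathbf s)\mid\Omega_N]$. All this holds, with the same constants, for each of the following meanings of the pair of conditioning events: each waveform is conditioned on its own event $\Omega_N(\mathbf U_N)$, respectively $\Omega_N(\mathbf F_N^H)$; both are conditioned on $\Omega_N(\mathbf U_N)$; both are conditioned on $\Omega_N(\mathbf U_N)\cap\Omega_N(\mathbf F_N^H)$. -/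

import Mathlib

open scoped Matrix

noncomputable section

namespace RangingCRB

open MeasureTheory ProbabilityTheory

/-! ### Constellations -/

/-- The law of one data symbol: the uniform distribution on the finite alphabet `S`. -/
def symbolLaw (S : Finset ℂ) : Measure ℂ :=
  uniformOn (S : Set ℂ)

/-- The law of the symbol vector `s = (s₁, …, s_N)`: independent uniform symbols. -/
def vectorLaw (S : Finset ℂ) (N : ℕ) : Measure (Fin N → ℂ) :=
  Measure.pi fun _ => symbolLaw S

/-- Unit average power, `E |s|² = 1`. -/
def UnitPower (S : Finset ℂ) : Prop :=
  ∫ z, ‖z‖ ^ 2 ∂symbolLaw S = 1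

/-- Zero mean and zero pseudo-variance, `E s = 0` and `E s² = 0`. -/
def SecondOrderSymmetric (S : Finset ℂ) : Prop :=
  ∫ z, z ∂symbolLaw S = 0 ∧ ∫ z, z ^ 2 ∂symbolLaw S = 0

/-- Every ring `{s ∈ S : |s|² = r}` of the alphabet is symmetric about the origin. -/
def CentrallySymmetric (S : Finset ℂ) : Prop :=
  ∀ r : ℝ, ∀ z ∈ S, ‖z‖ ^ 2 = r → -z ∈ S ∧ ‖-z‖ ^ 2 = r

/-- Kurtosis `E |s - E s|⁴ / (E |s - E s|²)²`. -/
def kurtosis (S : Finset ℂ) : ℝ :=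
  (∫ z, ‖z - ∫ w, w ∂symbolLaw S‖ ^ 4 ∂symbolLaw S) /
    (∫ z, ‖z - ∫ w, w ∂symbolLaw S‖ ^ 2 ∂symbolLaw S) ^ 2

/-! ### Modulation waveforms -/

/-- The normalized `N`-point DFT matrix `F_N` (indices start at `0`). -/
def dft (N : ℕ) : Matrix (Fin N) (Fin N) ℂ :=
  Matrix.of fun m n =>
    (1 / (Real.sqrt N : ℂ)) *
      Complex.exp (-(2 * Real.pi * Complex.I * (m : ℕ) * (n : ℕ) / N))

/-- The OFDM waveform `F_Nᴴ`. -/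
def ofdm (N : ℕ) : Matrix (Fin N) (Fin N) ℂ :=
  (dft N)ᴴ

/-- Discrete power spectrum `p_k = |(F_N u)_k|²`. -/
def powerSpectrum {N : ℕ} (u : Fin N → ℂ) (k : Fin N) : ℝ :=
  ‖(dft N *ᵥ u) k‖ ^ 2

/-- Normalized frequency grid `f_k = k / N`, `0 ≤ k < N`. -/
def freq {N : ℕ} (k : Fin N) : ℝ :=
  ((k : ℕ) : ℝ) / N

/-- Discrete spectral centroid. -/
def centroid {N : ℕ} (u : Fin N → ℂ) : ℝ :=
  ∑ k, freq k * powerSpectrum u k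

/-- Discrete root-mean-square bandwidth. -/
def rmsBandwidth {N : ℕ} (u : Fin N → ℂ) : ℝ :=
  Real.sqrt (∑ k, (freq k - centroid u) ^ 2 * powerSpectrum u k)

/-- Every column of `U` has discrete RMS bandwidth at least `α`. -/
def IsFrequencySpread {N : ℕ} (α : ℝ) (U : Matrix (Fin N) (Fin N) ℂ) : Prop :=
  ∀ n, α ≤ rmsBandwidth fun k => U k n

/-! ### Observation model and Fisher information -/

/-- Periodic delay operator `P_t = F_Nᴴ Diag(exp(-2πi n t / N)) F_N` for a real delay `t`. -/
def delayOp (N : ℕ) (t : ℝ) : Matrix (Fin N) (Fin N) ℂ :=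
  (dft N)ᴴ *
    Matrix.diagonal (fun n : Fin N =>
      Complex.exp (-(2 * Real.pi * Complex.I * (n : ℕ) * t / N))) *
    dft N

/-- Indices of the `3L` real parameters: delays, then real parts, then imaginary parts of
the amplitudes. -/
abbrev ParamIdx (L : ℕ) : Type :=
  Fin L ⊕ Fin L ⊕ Fin L

/-- The parameter vector `θ = (τ, Re β, Im β)`. -/
def params {L : ℕ} (τ : Fin L → ℝ) (β : Fin L → ℂ) : ParamIdx L → ℝ :=
  Sum.elim τ (Sum.elim (fun l => (β l).re) fun l => (β l).im)

/-- Noise-free echo `μ_θ = ∑_l β_l P_{τ_l} x` of the transmitted block `x`. -/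
def echo {N L : ℕ} (x : Fin N → ℂ) (θ : ParamIdx L → ℝ) : Fin N → ℂ :=
  ∑ l, ((θ (.inr (.inl l)) : ℂ) + (θ (.inr (.inr l)) : ℂ) * Complex.I) •
    (delayOp N (θ (.inl l)) *ᵥ x)

/-- Partial derivative `∂μ_θ / ∂θ_k`. -/
def echoDeriv {N L : ℕ} (x : Fin N → ℂ) (θ : ParamIdx L → ℝ) (k : ParamIdx L) :
    Fin N → ℂ :=
  fun n => deriv (fun t : ℝ => echo x (Function.update θ k t) n) (θ k)

/-- Fisher information matrix of `y ~ CN(μ_θ, σ² I)` given the transmitted block `x`: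
`J_{kl} = (2 / σ²) Re ((∂μ/∂θ_k)ᴴ (∂μ/∂θ_l))`. -/
def fisher {N L : ℕ} (σ : ℝ) (x : Fin N → ℂ) (θ : ParamIdx L → ℝ) :
    Matrix (ParamIdx L) (ParamIdx L) ℝ :=
  Matrix.of fun k l => 2 / σ ^ 2 * (star (echoDeriv x θ k) ⬝ᵥ echoDeriv x θ l).re

/-- Fisher information matrix `J(U, s)` for the transmitted block `x = U s`. -/
def fim {N L : ℕ} (σ : ℝ) (θ : ParamIdx L → ℝ) (U : Matrix (Fin N) (Fin N) ℂ)
    (s : Fin N → ℂ) : Matrix (ParamIdx L) (ParamIdx L) ℝ :=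
  fisher σ (U *ᵥ s) θ

/-- Ranging CRB `f(U, s) = Tr (T J(U, s)⁻¹)`, where `T` selects the delay block. -/
def rangingCRB {N L : ℕ} (σ : ℝ) (θ : ParamIdx L → ℝ) (U : Matrix (Fin N) (Fin N) ℂ)
    (s : Fin N → ℂ) : ℝ :=
  ∑ l : Fin L, (fim σ θ U s)⁻¹ (.inl l) (.inl l)

/-! ### The event on which the Neumann series converges, and conditional expectations -/

/-- The expected Fisher information matrix `J̄ = E J(U, s)`. -/
def meanFim {N L : ℕ} (S : Finset ℂ) (σ : ℝ) (θ : ParamIdx L → ℝ)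
    (U : Matrix (Fin N) (Fin N) ℂ) : Matrix (ParamIdx L) (ParamIdx L) ℝ :=
  Matrix.of fun k l => ∫ s, fim σ θ U s k l ∂vectorLaw S N

/-- The relative fluctuation `Z = J̄⁻¹ (J - J̄)`. -/
def fluctuation {N L : ℕ} (S : Finset ℂ) (σ : ℝ) (θ : ParamIdx L → ℝ)
    (U : Matrix (Fin N) (Fin N) ℂ) (s : Fin N → ℂ) : Matrix (ParamIdx L) (ParamIdx L) ℝ :=
  (meanFim S σ θ U)⁻¹ * (fim σ θ U s - meanFim S σ θ U)

/-- Spectral norm of a real square matrix. -/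
def spectralNorm {ι : Type} [Fintype ι] [DecidableEq ι] (A : Matrix ι ι ℝ) : ℝ :=
  ‖Matrix.toEuclideanCLM (n := ι) (𝕜 := ℝ) A‖

/-- The event `Ω_N = {s : ‖Z‖₂ < ρ}` of the waveform `U`. -/
def goodEvent {N L : ℕ} (S : Finset ℂ) (σ : ℝ) (θ : ParamIdx L → ℝ) (ρ : ℝ)
    (U : Matrix (Fin N) (Fin N) ℂ) : Set (Fin N → ℂ) :=
  {s | spectralNorm (fluctuation S σ θ U s) < ρ}

/-- The expected ranging CRB `E[f(U, s) | A]` given an event `A`. -/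
def condCRB {N L : ℕ} (S : Finset ℂ) (σ : ℝ) (θ : ParamIdx L → ℝ)
    (U : Matrix (Fin N) (Fin N) ℂ) (A : Set (Fin N → ℂ)) : ℝ :=
  ∫ s, rangingCRB σ θ U s ∂ProbabilityTheory.cond (vectorLaw S N) A

/-- The event `A` has positive probability, and `J(U, s)` is invertible for almost every
`s` in `A`, so that `E[f(U, s) | A]` is meaningful. -/
def CondCRBWellDefined {N L : ℕ} (S : Finset ℂ) (σ : ℝ) (θ : ParamIdx L → ℝ)
    (U : Matrix (Fin N) (Fin N) ℂ) (A : Set (Fin N → ℂ)) : Prop :=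
  0 < vectorLaw S N A ∧
    ∀ᵐ s ∂ProbabilityTheory.cond (vectorLaw S N) A, IsUnit (fim σ θ U s)

end RangingCRB

end

open RangingCRB

/-! In the frequency domain the information matrix is linear in the spectral energies: with `V = dft
N * U` and a matrix kernel `gram` that depends on the channel alone, J = (2/σ²) ∑ₙ gram(fₙ) |(V
s)ₙ|² (`fim_apply`). Every unitary waveform has mean energy one at each frequency, so J̄ = N •
`meanGram` is the same for all waveforms, and only fluctuations can separate them.

Put P = J̄⁻¹, X = J - J̄, Z = P X. In J⁻¹ = P - Z P + Z² P - Z³ J⁻¹ (`inv_eq_neumann`) the first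
term is common to all waveforms and the second has mean zero. The third decides. With P = Rᵀ R, its
delay trace is a sum of squares of forms ∑ₙ gₙ (|(V s)ₙ|² - 1), whose variance is ∑ gₙ² - (2 - κ) ∑ₖ
(∑ₙ |Vₙₖ|² gₙ)² (`IsNormalized.vecAvg_specForm_sq`). For OFDM `V = 1`, so the subtracted sum is ∑
gₖ², its maximum because |Vₙₖ|² is doubly stochastic. The gap is (2 - κ) times the total variance of
g under the column spectra.

This gap is at least of order N⁻². For x proportional to the j-th delay column of P, the rows of
gram(f) x belonging to path j determine q(f) and f q(f), with q the `quadrature`. Two frequencies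
therefore give different values wherever q is not small (`quadrature_separation`). In the limit q is
analytic and not identically zero, so it is small only on a small proportion of the frequencies;
double stochasticity then stops the spread columns from hiding their variance there
(`weighted_variance_lower_bound`). There are N columns, and the three factors P contribute N⁻³.

What remains must be o(N⁻²) (`cond_expansion`). A martingale argument gives E‖Z‖⁴ = O(N⁻²), hence by
Markov the excluded event has probability O(N⁻²); since ‖P‖ and ‖J⁻¹‖ are O(N⁻¹), the cubic
remainder and the effect of conditioning are negligible. On an event not its own, OFDM still has
‖J⁻¹‖ = O(N⁻¹), because its spectral energies are the symbol powers, bounded away from zero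
(`fim_ofdm_lower_bound`). -/

noncomputable section

namespace RangingCRB

open MeasureTheory ProbabilityTheory

/-! ### Expectations as finite averages -/

section Expectation

variable {E : Type*} [AddCommGroup E] [Module ℝ E]

/-- Average of a function over a finite alphabet. -/
def symAvg (S : Finset ℂ) (g : ℂ → E) : E :=
  ((S.card : ℝ)⁻¹) • ∑ z ∈ S, g z

/-- Average of a function over all words of length `N` with letters in `S`. -/
def vecAvg (S : Finset ℂ) (N : ℕ) (g : (Fin N → ℂ) → E) : E :=
  (((S.card : ℝ)⁻¹) ^ N) • ∑ s ∈ Fintype.piFinset (fun _ : Fin N => S), g s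

variable (S : Finset ℂ) {N : ℕ}

lemma symAvg_add (f g : ℂ → E) :
    symAvg S (fun z => f z + g z) = symAvg S f + symAvg S g := by
  simp [symAvg, Finset.sum_add_distrib]

lemma symAvg_sub (f g : ℂ → E) :
    symAvg S (fun z => f z - g z) = symAvg S f - symAvg S g := by
  simp [symAvg, Finset.sum_sub_distrib, smul_sub]

lemma symAvg_linear {F : Type*} [AddCommGroup F] [Module ℝ F] (T : E →ₗ[ℝ] F) (f : ℂ → E) :
    symAvg S (fun z => T (f z)) = T (symAvg S f) := by
  simp [symAvg]

lemma symAvg_mul_left (c : ℝ) (f : ℂ → ℝ) :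
    symAvg S (fun z => c * f z) = c * symAvg S f := by
  simp only [symAvg, ← Finset.mul_sum, smul_eq_mul]; ring

lemma symAvg_mul_right (c : ℝ) (f : ℂ → ℝ) :
    symAvg S (fun z => f z * c) = symAvg S f * c := by
  simp only [symAvg, ← Finset.sum_mul, smul_eq_mul]; ring

lemma symAvg_const (hS : S.Nonempty) (c : E) : symAvg S (fun _ => c) = c := by
  have : (S.card : ℝ) ≠ 0 := by exact_mod_cast hS.card_ne_zero
  rw [symAvg, Finset.sum_const, ← Nat.cast_smul_eq_nsmul ℝ, smul_smul, inv_mul_cancel₀ this,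
    one_smul]

lemma symAvg_mono {f g : ℂ → ℝ} (h : ∀ z ∈ S, f z ≤ g z) : symAvg S f ≤ symAvg S g := by
  simp only [symAvg, smul_eq_mul]
  gcongr with z hz
  exact h z hz

lemma symAvg_nonneg {f : ℂ → ℝ} (h : ∀ z, 0 ≤ f z) : 0 ≤ symAvg S f := by
  simp only [symAvg, smul_eq_mul]
  exact mul_nonneg (by positivity) (Finset.sum_nonneg fun s _ => h s)

lemma vecAvg_add (f g : (Fin N → ℂ) → E) :
    vecAvg S N (fun z => f z + g z) = vecAvg S N f + vecAvg S N g := by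
  simp [vecAvg, Finset.sum_add_distrib]

lemma vecAvg_sub (f g : (Fin N → ℂ) → E) :
    vecAvg S N (fun z => f z - g z) = vecAvg S N f - vecAvg S N g := by
  simp [vecAvg, Finset.sum_sub_distrib, smul_sub]

lemma vecAvg_linear {F : Type*} [AddCommGroup F] [Module ℝ F] (T : E →ₗ[ℝ] F)
    (f : (Fin N → ℂ) → E) :
    vecAvg S N (fun z => T (f z)) = T (vecAvg S N f) := by
  simp [vecAvg]

lemma vecAvg_sum {ι : Type*} (t : Finset ι) (f : ι → (Fin N → ℂ) → E) :
    vecAvg S N (fun z => ∑ i ∈ t, f i z) = ∑ i ∈ t, vecAvg S N (f i) := by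
  simp only [vecAvg]; rw [Finset.sum_comm, Finset.smul_sum]

lemma vecAvg_mul_left (c : ℝ) (f : (Fin N → ℂ) → ℝ) :
    vecAvg S N (fun z => c * f z) = c * vecAvg S N f := by
  simp only [vecAvg, ← Finset.mul_sum, smul_eq_mul]; ring

lemma vecAvg_const (hS : S.Nonempty) (c : E) : vecAvg S N (fun _ => c) = c := by
  have : (S.card : ℝ) ≠ 0 := by exact_mod_cast hS.card_ne_zero
  rw [vecAvg, Finset.sum_const, ← Nat.cast_smul_eq_nsmul ℝ, smul_smul]
  simp [this]

lemma vecAvg_mono {f g : (Fin N → ℂ) → ℝ} (h : ∀ s, (∀ i, s i ∈ S) → f s ≤ g s) :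
    vecAvg S N f ≤ vecAvg S N g := by
  simp only [vecAvg, smul_eq_mul]
  gcongr with s hs
  exact h s (by simpa using hs)

lemma vecAvg_congr {f g : (Fin N → ℂ) → E} (h : ∀ s, (∀ i, s i ∈ S) → f s = g s) :
    vecAvg S N f = vecAvg S N g := by
  simp only [vecAvg]
  rw [Finset.sum_congr rfl fun s hs => h s (by simpa using hs)]

lemma vecAvg_nonneg {f : (Fin N → ℂ) → ℝ} (h : ∀ s, 0 ≤ f s) : 0 ≤ vecAvg S N f := by
  simp only [vecAvg, smul_eq_mul]
  exact mul_nonneg (by positivity) (Finset.sum_nonneg fun s _ => h s)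

lemma abs_vecAvg_le (f : (Fin N → ℂ) → ℝ) : |vecAvg S N f| ≤ vecAvg S N (fun s => |f s|) := by
  simp only [vecAvg, smul_eq_mul, abs_mul]
  rw [abs_of_nonneg (by positivity : (0 : ℝ) ≤ ((S.card : ℝ)⁻¹) ^ N)]
  gcongr
  exact Finset.abs_sum_le_sum_abs _ _

lemma vecAvg_mul_sq_le (f g : (Fin N → ℂ) → ℝ) :
    vecAvg S N (fun s => f s * g s) ^ 2 ≤
      vecAvg S N (fun s => f s ^ 2) * vecAvg S N (fun s => g s ^ 2) := by
  simp only [vecAvg, smul_eq_mul]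
  have := Finset.sum_mul_sq_le_sq_mul_sq (Fintype.piFinset fun _ : Fin N => S) f g
  calc _ = (((S.card : ℝ)⁻¹) ^ N) ^ 2 *
        (∑ s ∈ Fintype.piFinset (fun _ : Fin N => S), f s * g s) ^ 2 := by ring
    _ ≤ (((S.card : ℝ)⁻¹) ^ N) ^ 2 *
        ((∑ s ∈ Fintype.piFinset (fun _ : Fin N => S), f s ^ 2) *
          ∑ s ∈ Fintype.piFinset (fun _ : Fin N => S), g s ^ 2) := by gcongr
    _ = _ := by ring

lemma vecAvg_zero (g : (Fin 0 → ℂ) → E) : vecAvg S 0 g = g ![] := by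
  simp only [vecAvg, pow_zero, one_smul]
  rw [Fintype.piFinset_of_isEmpty, Finset.univ_unique, Finset.sum_singleton]
  congr 1

/-- Independence in the form used below: every moment computation is an induction that splits off
the first symbol. -/
lemma vecAvg_succ (g : (Fin (N + 1) → ℂ) → E) :
    vecAvg S (N + 1) g =
      symAvg S fun z => vecAvg S N fun t => g (Fin.cons z t) := by
  simp only [vecAvg, symAvg]
  rw [← Finset.smul_sum, smul_smul, pow_succ', ← Finset.sum_product']
  congr 1
  refine Finset.sum_nbij' (fun s => (s 0, Fin.tail s)) (fun p => Fin.cons p.1 p.2) ?_ ?_ ?_ ?_ ?_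
  · intro s hs
    simp only [Fintype.mem_piFinset] at hs
    simp [Fintype.mem_piFinset, Fin.tail, hs]
  · rintro ⟨z, t⟩ h
    simp only [Finset.mem_product, Fintype.mem_piFinset] at h
    simp only [Fintype.mem_piFinset]
    intro i
    refine Fin.cases ?_ ?_ i
    · simpa using h.1
    · intro j; simpa using h.2 j
  · intro s _; simp
  · rintro ⟨z, t⟩ _; simp
  · intro s _; simp

lemma symAvg_vecAvg_comm (g : ℂ → (Fin N → ℂ) → E) :
    symAvg S (fun z => vecAvg S N (g z)) = vecAvg S N fun t => symAvg S fun z => g z t := by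
  simp only [vecAvg, symAvg]
  rw [← Finset.smul_sum, ← Finset.smul_sum, smul_comm, Finset.sum_comm]

end Expectation

/-! ### Transfer from the probability measures to finite averages -/

section Link

variable {E : Type*} [NormedAddCommGroup E] [NormedSpace ℝ E] [CompleteSpace E]

lemma isProbabilityMeasure_symbolLaw {S : Finset ℂ} (hS : S.Nonempty) :
    IsProbabilityMeasure (symbolLaw S) :=
  isProbabilityMeasure_uniformOn S.finite_toSet (by simpa using hS)

lemma symbolLaw_singleton {S : Finset ℂ} {z : ℂ} (hz : z ∈ S) :
    symbolLaw S {z} = (S.card : ENNReal)⁻¹ := by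
  classical
  rw [symbolLaw, ← Finset.coe_singleton, uniformOn_apply_finset, Finset.inter_singleton_of_mem hz]
  simp

lemma integral_symbolLaw {S : Finset ℂ} (hS : S.Nonempty) (g : ℂ → E) :
    ∫ z, g z ∂symbolLaw S = symAvg S g := by
  have := isProbabilityMeasure_symbolLaw hS
  have hae : (S : Set ℂ) =ᵐ[symbolLaw S] Set.univ := by
    rw [ae_eq_univ, prob_compl_eq_zero_iff S.finite_toSet.measurableSet]
    exact uniformOn_self S.finite_toSet (by simpa using hS)
  rw [← setIntegral_univ, ← setIntegral_congr_set hae,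
    setIntegral_finset _ (by exact IntegrableOn.finset), symAvg, Finset.smul_sum]
  refine Finset.sum_congr rfl fun z hz => ?_
  rw [measureReal_def, symbolLaw_singleton hz]
  simp

variable {S : Finset ℂ} {N : ℕ}

lemma isProbabilityMeasure_vectorLaw (hS : S.Nonempty) (N : ℕ) :
    IsProbabilityMeasure (vectorLaw S N) := by
  have := isProbabilityMeasure_symbolLaw hS
  unfold vectorLaw; infer_instance

lemma vectorLaw_singleton (hS : S.Nonempty) {s : Fin N → ℂ} (hs : ∀ i, s i ∈ S) :
    (vectorLaw S N).real {s} = ((S.card : ℝ)⁻¹) ^ N := by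
  have := isProbabilityMeasure_symbolLaw hS
  rw [measureReal_def, vectorLaw, Measure.pi_singleton,
    Finset.prod_congr rfl fun i _ => symbolLaw_singleton (hs i)]
  simp

lemma ae_vectorLaw (hS : S.Nonempty) : ∀ᵐ s ∂vectorLaw S N, ∀ i, s i ∈ S := by
  have := isProbabilityMeasure_symbolLaw hS
  have := isProbabilityMeasure_vectorLaw hS N
  have h : vectorLaw S N (Fintype.piFinset fun _ : Fin N => S : Finset (Fin N → ℂ)) = 1 := by
    rw [Fintype.coe_piFinset, vectorLaw, Measure.pi_pi]
    refine Finset.prod_eq_one fun i _ => ?_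
    exact uniformOn_self S.finite_toSet (by simpa using hS)
  rw [← prob_compl_eq_zero_iff (Finset.finite_toSet _).measurableSet] at h
  refine measure_mono_null ?_ h
  intro s hs
  simpa using hs

/-- Replaces an arbitrary event by a finite set, so that no measurability of the conditioning events
is ever needed. -/
lemma ae_eq_inter_piFinset (hS : S.Nonempty) (A : Set (Fin N → ℂ)) :
    A =ᵐ[vectorLaw S N]
      (A ∩ ((Fintype.piFinset fun _ : Fin N => S : Finset (Fin N → ℂ)) : Set (Fin N → ℂ)) :
        Set (Fin N → ℂ)) := by
  filter_upwards [ae_vectorLaw (N := N) hS] with s hs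
  refine propext ⟨fun h => ⟨h, by simpa using hs⟩, fun h => h.1⟩

open Classical in
lemma setIntegral_vectorLaw (hS : S.Nonempty) (A : Set (Fin N → ℂ)) (g : (Fin N → ℂ) → E) :
    ∫ s in A, g s ∂vectorLaw S N = vecAvg S N (A.indicator g) := by
  have := isProbabilityMeasure_vectorLaw hS N
  set T := Fintype.piFinset fun _ : Fin N => S with hT
  have hae : A =ᵐ[vectorLaw S N] ((T.filter (· ∈ A) : Finset (Fin N → ℂ)) : Set (Fin N → ℂ)) := by
    refine (ae_eq_inter_piFinset hS A).trans (Filter.EventuallyEq.of_eq ?_)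
    rw [← hT]
    exact Set.ext fun s => by
      simp only [Set.mem_inter_iff, Finset.mem_coe, Finset.mem_filter, and_comm]
  rw [Measure.restrict_congr_set hae, setIntegral_finset _ IntegrableOn.finset, vecAvg,
    Finset.smul_sum, Finset.sum_filter]
  refine Finset.sum_congr rfl fun s hs => ?_
  by_cases hA : s ∈ A
  · rw [if_pos hA, vectorLaw_singleton hS (by simpa [hT] using hs), Set.indicator_of_mem hA]
  · simp [hA]

lemma integral_vectorLaw (hS : S.Nonempty) (g : (Fin N → ℂ) → E) :
    ∫ s, g s ∂vectorLaw S N = vecAvg S N g := by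
  rw [← setIntegral_univ, setIntegral_vectorLaw hS, Set.indicator_univ]

lemma vectorLaw_real (hS : S.Nonempty) (A : Set (Fin N → ℂ)) :
    (vectorLaw S N).real A = vecAvg S N (A.indicator fun _ => (1 : ℝ)) := by
  rw [← setIntegral_vectorLaw hS]
  simp

lemma integral_cond_vectorLaw (hS : S.Nonempty) (A : Set (Fin N → ℂ)) (g : (Fin N → ℂ) → ℝ) :
    ∫ s, g s ∂ProbabilityTheory.cond (vectorLaw S N) A =
      (vecAvg S N (A.indicator fun _ => (1 : ℝ)))⁻¹ * vecAvg S N (A.indicator g) := by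
  rw [ProbabilityTheory.cond, integral_smul_measure, setIntegral_vectorLaw hS,
    ← vectorLaw_real hS]
  simp [measureReal_def]

lemma ae_cond_vectorLaw (hS : S.Nonempty) (A : Set (Fin N → ℂ)) {p : (Fin N → ℂ) → Prop}
    (h : ∀ s, (∀ i, s i ∈ S) → s ∈ A → p s) :
    ∀ᵐ s ∂ProbabilityTheory.cond (vectorLaw S N) A, p s := by
  have hsub : ∀ᵐ s ∂((vectorLaw S N).restrict A), p s := by
    rw [Measure.restrict_congr_set (ae_eq_inter_piFinset hS A)]
    refine (ae_restrict_iff' ?_).2 (Filter.Eventually.of_forall fun s hs => ?_)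
    · exact ((Finset.finite_toSet _).subset Set.inter_subset_right).measurableSet
    · exact h s (by simpa using hs.2) hs.1
  rw [ProbabilityTheory.cond]
  exact Measure.ae_smul_measure hsub _

end Link

/-! ### Moments of linear and quadratic forms in the symbols -/

/-- The moment conditions on the alphabet, written with finite averages. -/
structure IsNormalized (S : Finset ℂ) (κ K : ℝ) : Prop where
  nonempty : S.Nonempty
  power : symAvg S (fun z => ‖z‖ ^ 2) = 1
  mean : symAvg S (fun z => z) = 0
  pseudo : symAvg S (fun z => z ^ 2) = 0
  third : symAvg S (fun z => ((‖z‖ ^ 2 : ℝ) : ℂ) * z) = 0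
  fourth : symAvg S (fun z => ‖z‖ ^ 4) = κ
  bound : ∀ z ∈ S, ‖z‖ ≤ K
  one_le : 1 ≤ K

section Moments

variable {S : Finset ℂ} {κ K : ℝ} {N : ℕ}

lemma symAvg_re_mul (f : ℂ → ℂ) (w : ℂ) :
    symAvg S (fun z => (f z * w).re) = (symAvg S f * w).re := by
  have := symAvg_linear S (Complex.reLm ∘ₗ LinearMap.mulRight ℝ w) f
  simpa using this

/-- Isolates the pseudo-power `a ^ 2`, which averages to zero over the alphabet. -/
lemma re_sq_eq (a : ℂ) : a.re ^ 2 = (‖a‖ ^ 2 + (a ^ 2).re) / 2 := by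
  rw [Complex.sq_norm, Complex.normSq_apply, sq a, Complex.mul_re]; ring

lemma IsNormalized.symAvg_re_mul (h : IsNormalized S κ K) (w : ℂ) :
    symAvg S (fun z => (z * w).re) = 0 := by
  rw [RangingCRB.symAvg_re_mul (fun z => z) w, h.mean]; simp

lemma IsNormalized.symAvg_norm_sq_mul_re (h : IsNormalized S κ K) (w : ℂ) :
    symAvg S (fun z => ‖z‖ ^ 2 * (z * w).re) = 0 := by
  have := RangingCRB.symAvg_re_mul (S := S) (fun z => ((‖z‖ ^ 2 : ℝ) : ℂ) * z) w
  rw [h.third] at this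
  simp only [mul_assoc, Complex.re_ofReal_mul, zero_mul, Complex.zero_re] at this
  exact this

lemma IsNormalized.symAvg_re_mul_sq (h : IsNormalized S κ K) (w : ℂ) :
    symAvg S (fun z => (z * w).re ^ 2) = ‖w‖ ^ 2 / 2 := by
  have e : (fun z : ℂ => (z * w).re ^ 2) =
      fun z => (‖w‖ ^ 2 / 2) * ‖z‖ ^ 2 + (1 / 2) * (z ^ 2 * w ^ 2).re := by
    funext z
    rw [re_sq_eq, norm_mul, mul_pow, mul_pow]; ring
  rw [e, symAvg_add, symAvg_mul_left, symAvg_mul_left, h.power,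
    RangingCRB.symAvg_re_mul (fun z => z ^ 2), h.pseudo]
  simp

/-- The linear form `∑ q_j t_j`. -/
def linForm (q t : Fin N → ℂ) : ℂ := ∑ j, q j * t j

lemma linForm_cons (q : Fin (N + 1) → ℂ) (z : ℂ) (t : Fin N → ℂ) :
    linForm q (Fin.cons z t : Fin (N + 1) → ℂ) = z * q 0 + linForm (fun j => q j.succ) t := by
  simp [linForm, Fin.sum_univ_succ, mul_comm]

lemma norm_add_sq_eq (a b : ℂ) :
    ‖a + b‖ ^ 2 = ‖a‖ ^ 2 + 2 * (a * star b).re + ‖b‖ ^ 2 := by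
  simp only [Complex.sq_norm, Complex.normSq_apply, Complex.add_re, Complex.add_im,
    Complex.mul_re, Complex.star_def, Complex.conj_re, Complex.conj_im]
  ring

lemma IsNormalized.vecAvg_linForm_sq (h : IsNormalized S κ K) (q : Fin N → ℂ) :
    vecAvg S N (fun t => ‖linForm q t‖ ^ 2) = ∑ j, ‖q j‖ ^ 2 := by
  induction N with
  | zero => simp [vecAvg_zero, linForm]
  | succ n ih =>
    rw [vecAvg_succ, symAvg_vecAvg_comm, Fin.sum_univ_succ, ← ih fun j => q j.succ]
    have e : ∀ t : Fin n → ℂ, symAvg S (fun z =>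
        ‖linForm q (Fin.cons z t : Fin (n + 1) → ℂ)‖ ^ 2) =
        ‖q 0‖ ^ 2 + ‖linForm (fun j => q j.succ) t‖ ^ 2 := by
      intro t
      simp only [linForm_cons, norm_add_sq_eq, norm_mul, mul_pow, mul_assoc]
      rw [symAvg_add, symAvg_add, symAvg_mul_right, symAvg_mul_left, h.power, h.symAvg_re_mul,
        symAvg_const _ h.nonempty]
      ring
    simp only [e]
    rw [vecAvg_add, vecAvg_const _ h.nonempty]

/-- Induction on the number of symbols. The term linear in the new symbol averages out, and the
constant `3 * K ^ 4` is large enough for the mixed term `6 * ‖q 0‖ ^ 2 * σ` to fit into the cross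
term of the square. -/
lemma IsNormalized.vecAvg_linForm_four (h : IsNormalized S κ K) (q : Fin N → ℂ) :
    vecAvg S N (fun t => ‖linForm q t‖ ^ 4) ≤ 3 * K ^ 4 * (∑ j, ‖q j‖ ^ 2) ^ 2 := by
  have hK : 1 ≤ K ^ 4 := one_le_pow₀ h.one_le
  induction N with
  | zero => simp [vecAvg_zero, linForm]
  | succ n ih =>
    rw [vecAvg_succ, symAvg_vecAvg_comm, Fin.sum_univ_succ]
    set σ := ∑ j : Fin n, ‖q j.succ‖ ^ 2 with hσ
    have hσ0 : 0 ≤ σ := by positivity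
    have e : ∀ t : Fin n → ℂ, symAvg S (fun z =>
        ‖linForm q (Fin.cons z t : Fin (n + 1) → ℂ)‖ ^ 4) ≤
        2 * K ^ 4 * ‖q 0‖ ^ 4 + 6 * ‖q 0‖ ^ 2 * ‖linForm (fun j => q j.succ) t‖ ^ 2 +
          ‖linForm (fun j => q j.succ) t‖ ^ 4 := by
      intro t
      set L := linForm (fun j => q j.succ) t with hL
      -- Expand (a + b + c)² with a = ‖z‖²‖q₀‖², b twice the real part, c = ‖L‖², and estimate only
      -- 2ab ≤ a² + b².
      have hp : ∀ z ∈ S, ‖linForm q (Fin.cons z t : Fin (n + 1) → ℂ)‖ ^ 4 ≤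
          2 * K ^ 4 * ‖q 0‖ ^ 4 + 8 * (z * (q 0 * star L)).re ^ 2 + ‖L‖ ^ 4 +
            (2 * ‖q 0‖ ^ 2 * ‖L‖ ^ 2) * ‖z‖ ^ 2 + (4 * ‖L‖ ^ 2) * (z * (q 0 * star L)).re := by
        intro z hz
        have h4 : ‖linForm q (Fin.cons z t : Fin (n + 1) → ℂ)‖ ^ 4 =
            (‖z‖ ^ 2 * ‖q 0‖ ^ 2 + 2 * (z * (q 0 * star L)).re + ‖L‖ ^ 2) ^ 2 := by
          rw [linForm_cons, show (4 : ℕ) = 2 * 2 from rfl, pow_mul, norm_add_sq_eq, norm_mul,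
            mul_pow, mul_assoc]
        have h5 : (‖z‖ ^ 2 * ‖q 0‖ ^ 2) ^ 2 ≤ K ^ 4 * ‖q 0‖ ^ 4 := by
          have : ‖z‖ ^ 4 ≤ K ^ 4 := pow_le_pow_left₀ (norm_nonneg _) (h.bound z hz) 4
          calc _ = ‖z‖ ^ 4 * ‖q 0‖ ^ 4 := by ring
            _ ≤ _ := by gcongr
        rw [h4]
        nlinarith [sq_nonneg (‖z‖ ^ 2 * ‖q 0‖ ^ 2 - 2 * (z * (q 0 * star L)).re)]
      refine (symAvg_mono S hp).trans (le_of_eq ?_)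
      rw [symAvg_add, symAvg_add, symAvg_add, symAvg_add, symAvg_const _ h.nonempty,
        symAvg_const _ h.nonempty, symAvg_mul_left, symAvg_mul_left, symAvg_mul_left,
        h.symAvg_re_mul, h.symAvg_re_mul_sq, h.power]
      simp only [norm_mul, norm_star]
      ring
    refine (vecAvg_mono S fun t _ => e t).trans ?_
    rw [vecAvg_add, vecAvg_add, vecAvg_const _ h.nonempty, vecAvg_mul_left, h.vecAvg_linForm_sq]
    have := ih fun j => q j.succ
    rw [← hσ] at this ⊢
    have h6 : 6 * ‖q 0‖ ^ 2 * σ ≤ K ^ 4 * (6 * ‖q 0‖ ^ 2 * σ) :=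
      le_mul_of_one_le_left (by positivity) hK
    have h7 : 0 ≤ K ^ 4 * ‖q 0‖ ^ 4 := by positivity
    nlinarith

/-- The centred quadratic form `Re (sᴴ Q s) - Re (tr Q)`. -/
def quadForm (Q : Matrix (Fin N) (Fin N) ℂ) (s : Fin N → ℂ) : ℝ :=
  (star s ⬝ᵥ (Q *ᵥ s)).re - Q.trace.re

/-- Deletion of the first row and column. -/
def tailMatrix (Q : Matrix (Fin (N + 1)) (Fin (N + 1)) ℂ) : Matrix (Fin N) (Fin N) ℂ :=
  Q.submatrix Fin.succ Fin.succ

/-- Squared Frobenius norm. -/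
def frobSq (Q : Matrix (Fin N) (Fin N) ℂ) : ℝ := ∑ i, ∑ j, ‖Q i j‖ ^ 2

/-- The part of a quadratic form that involves the first variable. -/
def headForm (Q : Matrix (Fin (N + 1)) (Fin (N + 1)) ℂ) (z : ℂ) (t : Fin N → ℂ) : ℝ :=
  (Q 0 0).re * (‖z‖ ^ 2 - 1) + 2 * (z * star (linForm (fun j => Q 0 j.succ) t)).re

/-- A martingale decomposition: for fixed `t` the increment `headForm Q z t` has mean zero in `z`.
-/
lemma quadForm_cons {Q : Matrix (Fin (N + 1)) (Fin (N + 1)) ℂ} (hQ : Q.IsHermitian) (z : ℂ)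
    (t : Fin N → ℂ) :
    quadForm Q (Fin.cons z t : Fin (N + 1) → ℂ) = quadForm (tailMatrix Q) t + headForm Q z t := by
  have h1 : star (Fin.cons z t : Fin (N + 1) → ℂ) ⬝ᵥ (Q *ᵥ (Fin.cons z t : Fin (N + 1) → ℂ)) =
      star z * (Q 0 0 * z) + star z * linForm (fun j => Q 0 j.succ) t +
        z * star (linForm (fun j => Q 0 j.succ) t) + star t ⬝ᵥ (tailMatrix Q *ᵥ t) := by
    simp only [dotProduct, Matrix.mulVec, Fin.sum_univ_succ, Pi.star_apply, Fin.cons_zero,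
      Fin.cons_succ, linForm, tailMatrix, Matrix.submatrix_apply, star_sum, star_mul',
      Finset.mul_sum, mul_add, Finset.sum_add_distrib]
    have : ∀ j : Fin N, Q j.succ 0 = star (Q 0 j.succ) := fun j => (hQ.apply _ _).symm
    simp only [this]
    have e : ∀ j : Fin N, star (t j) * (star (Q 0 j.succ) * z) =
        z * (star (Q 0 j.succ) * star (t j)) := fun j => by ring
    simp only [e]
    ring
  have him : (Q 0 0).im = 0 := by
    have := hQ.apply 0 0
    exact Complex.conj_eq_iff_im.1 this
  rw [quadForm, h1, quadForm, headForm, Matrix.trace, Matrix.trace, Fin.sum_univ_succ]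
  simp only [Matrix.diag_apply, Complex.add_re, tailMatrix, Matrix.submatrix_apply,
    Complex.sq_norm, Complex.normSq_apply, Complex.mul_re, Complex.mul_im, Complex.star_def,
    Complex.conj_re, Complex.conj_im, him]
  ring

lemma isHermitian_tailMatrix {Q : Matrix (Fin (N + 1)) (Fin (N + 1)) ℂ} (hQ : Q.IsHermitian) :
    (tailMatrix Q).IsHermitian := hQ.submatrix _

lemma frobSq_succ {Q : Matrix (Fin (N + 1)) (Fin (N + 1)) ℂ} (hQ : Q.IsHermitian) :
    frobSq Q = frobSq (tailMatrix Q) + ((Q 0 0).re ^ 2 + 2 * ∑ j : Fin N, ‖Q 0 j.succ‖ ^ 2) := by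
  have him : (Q 0 0).im = 0 := Complex.conj_eq_iff_im.1 (hQ.apply 0 0)
  have : ∀ j : Fin N, ‖Q j.succ 0‖ = ‖Q 0 j.succ‖ := fun j => by
    rw [← hQ.apply, norm_star]
  have h0 : ‖Q 0 0‖ ^ 2 = (Q 0 0).re ^ 2 := by
    rw [Complex.sq_norm, Complex.normSq_apply, him]; ring
  simp only [frobSq, Fin.sum_univ_succ, Finset.sum_add_distrib, this, h0, tailMatrix,
    Matrix.submatrix_apply]
  ring

lemma IsNormalized.symAvg_headForm (h : IsNormalized S κ K)
    (Q : Matrix (Fin (N + 1)) (Fin (N + 1)) ℂ) (t : Fin N → ℂ) :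
    symAvg S (fun z => headForm Q z t) = 0 := by
  simp only [headForm]
  rw [symAvg_add, symAvg_mul_left, symAvg_mul_left, symAvg_sub, h.power, h.symAvg_re_mul,
    symAvg_const _ h.nonempty]
  ring

/-- Martingale increments are orthogonal, so their variances add. The increment has variance (κ - 1)
Q₀₀² + 2 ∑ ‖Q₀ⱼ‖², the diagonal and off-diagonal parts being uncorrelated by the vanishing third
moment. The Frobenius norm grows by Q₀₀² + 2 ∑ ‖Q₀ⱼ‖², whence the defect 2 - κ on the diagonal. -/
lemma IsNormalized.vecAvg_quadForm_sq (h : IsNormalized S κ K)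
    {Q : Matrix (Fin N) (Fin N) ℂ} (hQ : Q.IsHermitian) :
    vecAvg S N (fun s => quadForm Q s ^ 2) = frobSq Q - (2 - κ) * ∑ i, (Q i i).re ^ 2 := by
  induction N with
  | zero => simp [vecAvg_zero, quadForm, frobSq, Matrix.trace]
  | succ n ih =>
    rw [vecAvg_succ, symAvg_vecAvg_comm]
    have e : ∀ t : Fin n → ℂ, symAvg S (fun z =>
        quadForm Q (Fin.cons z t : Fin (n + 1) → ℂ) ^ 2) =
        quadForm (tailMatrix Q) t ^ 2 + ((κ - 1) * (Q 0 0).re ^ 2 +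
          2 * ‖linForm (fun j => Q 0 j.succ) t‖ ^ 2) := by
      intro t
      set L := linForm (fun j => Q 0 j.succ) t with hL
      have e1 : ∀ z : ℂ, quadForm Q (Fin.cons z t : Fin (n + 1) → ℂ) ^ 2 =
          quadForm (tailMatrix Q) t ^ 2 + 2 * quadForm (tailMatrix Q) t * headForm Q z t +
          ((Q 0 0).re ^ 2 * (‖z‖ ^ 4 - 2 * ‖z‖ ^ 2 + 1) +
            (4 * (Q 0 0).re) * (‖z‖ ^ 2 * (z * star L).re) - (4 * (Q 0 0).re) * (z * star L).re +
            4 * (z * star L).re ^ 2) := by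
        intro z
        rw [quadForm_cons hQ, headForm]; ring
      simp only [e1]
      rw [symAvg_add, symAvg_add, symAvg_add, symAvg_sub, symAvg_add,
        symAvg_const _ h.nonempty, symAvg_mul_left, symAvg_mul_left, symAvg_mul_left,
        symAvg_mul_left, symAvg_mul_left, symAvg_add, symAvg_sub, symAvg_mul_left,
        symAvg_const _ h.nonempty, h.symAvg_headForm, h.power, h.fourth, h.symAvg_re_mul,
        h.symAvg_re_mul_sq, h.symAvg_norm_sq_mul_re, norm_star]
      ring
    simp only [e]
    rw [vecAvg_add, vecAvg_add, vecAvg_const _ h.nonempty, vecAvg_mul_left,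
      h.vecAvg_linForm_sq, ih (isHermitian_tailMatrix hQ), frobSq_succ hQ, Fin.sum_univ_succ]
    simp only [tailMatrix, Matrix.submatrix_apply]
    ring

lemma IsNormalized.headForm_four (h : IsNormalized S κ K)
    (Q : Matrix (Fin (N + 1)) (Fin (N + 1)) ℂ) :
    symAvg S (fun z => vecAvg S N fun t => headForm Q z t ^ 4) ≤
      (10 * K ^ 4) ^ 2 * ((Q 0 0).re ^ 2 + 2 * ∑ j : Fin N, ‖Q 0 j.succ‖ ^ 2) ^ 2 := by
  have hK := h.one_le
  set a := (Q 0 0).re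
  set q : Fin N → ℂ := fun j => Q 0 j.succ with hq
  have hp : ∀ z ∈ S, ∀ t : Fin N → ℂ, headForm Q z t ^ 4 ≤
      8 * a ^ 4 * K ^ 8 + 128 * K ^ 4 * ‖linForm q t‖ ^ 4 := by
    intro z hz t
    have hz' := h.bound z hz
    have h1 : |‖z‖ ^ 2 - 1| ≤ K ^ 2 := by
      have : ‖z‖ ^ 2 ≤ K ^ 2 := pow_le_pow_left₀ (norm_nonneg _) hz' 2
      rw [abs_le]; constructor <;> nlinarith [sq_nonneg ‖z‖]
    have h2 : |(z * star (linForm q t)).re| ≤ K * ‖linForm q t‖ := by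
      refine (Complex.abs_re_le_norm _).trans ?_
      rw [norm_mul, norm_star]; gcongr
    have h3 : (‖z‖ ^ 2 - 1) ^ 4 ≤ (K ^ 2) ^ 4 := by
      rw [← (by decide : Even 4).pow_abs]; gcongr
    have h4 : (z * star (linForm q t)).re ^ 4 ≤ (K * ‖linForm q t‖) ^ 4 := by
      rw [← (by decide : Even 4).pow_abs]; gcongr
    have h5 : headForm Q z t ^ 4 ≤
        8 * ((a * (‖z‖ ^ 2 - 1)) ^ 4 + (2 * (z * star (linForm q t)).re) ^ 4) := by
      rw [headForm, ← (by decide : Even 4).pow_abs,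
        ← (by decide : Even 4).pow_abs (a * (‖z‖ ^ 2 - 1)),
        ← (by decide : Even 4).pow_abs (2 * (z * star (linForm q t)).re)]
      refine (pow_le_pow_left₀ (abs_nonneg _) (abs_add_le _ _) 4).trans ?_
      exact (add_pow_le (abs_nonneg _) (abs_nonneg _) 4).trans_eq (by rw [show (2 : ℝ) ^ (4 - 1) = 8 by norm_num])
    refine h5.trans ?_
    rw [mul_pow a, mul_pow 2]
    calc _ ≤ 8 * (a ^ 4 * (K ^ 2) ^ 4 + 2 ^ 4 * (K * ‖linForm q t‖) ^ 4) := by gcongr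
      _ = _ := by ring
  have h1 : symAvg S (fun z => vecAvg S N fun t => headForm Q z t ^ 4) ≤
      symAvg S (fun _ => 8 * a ^ 4 * K ^ 8 + 128 * K ^ 4 * (3 * K ^ 4 * (∑ j, ‖q j‖ ^ 2) ^ 2)) := by
    refine symAvg_mono S fun z hz => ?_
    refine (vecAvg_mono S fun t _ => hp z hz t).trans ?_
    rw [vecAvg_add, vecAvg_const _ h.nonempty, vecAvg_mul_left]
    gcongr
    exact h.vecAvg_linForm_four q
  rw [symAvg_const _ h.nonempty] at h1
  refine h1.trans ?_
  have h0 : 0 ≤ ∑ j, ‖q j‖ ^ 2 := by positivity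
  have hk8 : 0 ≤ K ^ 8 := by positivity
  -- 384 = 128 · 3 comes from the fourth moment of the linear form; 100 makes the final constant a
  -- perfect square, convenient for Cauchy–Schwarz.
  have h2 : 8 * a ^ 4 + 384 * (∑ j, ‖q j‖ ^ 2) ^ 2 ≤ 100 * (a ^ 2 + 2 * ∑ j, ‖q j‖ ^ 2) ^ 2 := by
    nlinarith [mul_nonneg (sq_nonneg a) h0, sq_nonneg (a ^ 2), sq_nonneg (∑ j, ‖q j‖ ^ 2)]
  calc _ = K ^ 8 * (8 * a ^ 4 + 384 * (∑ j, ‖q j‖ ^ 2) ^ 2) := by ring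
    _ ≤ K ^ 8 * (100 * (a ^ 2 + 2 * ∑ j, ‖q j‖ ^ 2) ^ 2) := by gcongr
    _ = _ := by ring

/-- A Burkholder-type bound, by induction along the martingale. In the fourth power of tail plus
increment, the term linear in the increment averages to zero, and the mixed square term is
controlled by Cauchy–Schwarz from the two fourth moments. -/
lemma IsNormalized.vecAvg_quadForm_four (h : IsNormalized S κ K)
    {Q : Matrix (Fin N) (Fin N) ℂ} (hQ : Q.IsHermitian) :
    vecAvg S N (fun s => quadForm Q s ^ 4) ≤ (40 * K ^ 4) ^ 2 * frobSq Q ^ 2 := by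
  have hK : 0 < K := zero_lt_one.trans_le h.one_le
  induction N with
  | zero => simp [vecAvg_zero, quadForm, frobSq, Matrix.trace]
  | succ n ih =>
    have hih := ih (isHermitian_tailMatrix hQ)
    have hhd := h.headForm_four Q
    rw [frobSq_succ hQ]
    set σ := frobSq (tailMatrix Q) with hσ
    set δ := (Q 0 0).re ^ 2 + 2 * ∑ j : Fin n, ‖Q 0 j.succ‖ ^ 2 with hδ
    have hσ0 : 0 ≤ σ := by rw [hσ, frobSq]; positivity
    have hδ0 : 0 ≤ δ := by positivity
    set M : (Fin n → ℂ) → ℝ := quadForm (tailMatrix Q) with hM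
    have hcs := vecAvg_mul_sq_le S (N := n + 1) (fun s => M (Fin.tail s) ^ 2)
      (fun s => headForm Q (s 0) (Fin.tail s) ^ 2)
    simp only [vecAvg_succ, Fin.cons_zero, Fin.tail_cons, ← pow_mul, Nat.reduceMul] at hcs
    rw [symAvg_const _ h.nonempty] at hcs
    have hcs' : symAvg S (fun z => vecAvg S n fun t => M t ^ 2 * headForm Q z t ^ 2) ≤
        (40 * K ^ 4 * σ) * (10 * K ^ 4 * δ) := by
      refine le_of_sq_le_sq ?_ (by positivity)
      refine hcs.trans ?_
      have h0 : 0 ≤ vecAvg S n fun t => M t ^ 4 := vecAvg_nonneg S fun t => by positivity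
      calc _ ≤ ((40 * K ^ 4) ^ 2 * σ ^ 2) * ((10 * K ^ 4) ^ 2 * δ ^ 2) :=
            mul_le_mul hih hhd (symAvg_nonneg S fun z => vecAvg_nonneg S fun t => by positivity)
              (by positivity)
        _ = _ := by ring
    -- Binomial expansion with 4 M h³ ≤ 2 M² h² + 2 h⁴; the term 4 M³ h is kept because its average
    -- vanishes.
    have hp : vecAvg S (n + 1) (fun s => quadForm Q s ^ 4) ≤
        symAvg S (fun z => vecAvg S n fun t => (M t ^ 4 + 8 * (M t ^ 2 * headForm Q z t ^ 2) +
          3 * headForm Q z t ^ 4) + (4 * M t ^ 3) * headForm Q z t) := by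
      rw [vecAvg_succ]
      refine symAvg_mono S fun z _ => vecAvg_mono S fun t _ => ?_
      rw [quadForm_cons hQ, ← hM]
      nlinarith [sq_nonneg (headForm Q z t * (M t - headForm Q z t))]
    refine hp.trans ?_
    have e0 : symAvg S (fun z => vecAvg S n fun t => (4 * M t ^ 3) * headForm Q z t) = 0 := by
      rw [symAvg_vecAvg_comm]
      simp only [symAvg_mul_left, h.symAvg_headForm, mul_zero]
      exact vecAvg_const _ h.nonempty _
    simp only [vecAvg_add, symAvg_add, vecAvg_mul_left, symAvg_mul_left] at e0 ⊢
    rw [e0, symAvg_const _ h.nonempty]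
    -- The constant 40 is chosen so that 8 · 40 · 10 = 2 · 40²: the mixed term matches the cross
    -- term of (σ + δ)², and 3 · 10² ≤ 40² covers the rest.
    have : 0 ≤ K ^ 8 * δ ^ 2 := by positivity
    nlinarith

end Moments

/-! ### Spectral energies of a unitary precoder -/

section Spectral

variable {S : Finset ℂ} {κ K : ℝ} {N : ℕ}

/-- Weighted sum of the centred spectral energies `|(V s)_n|² - 1`. -/
def specForm (V : Matrix (Fin N) (Fin N) ℂ) (g : Fin N → ℝ) (s : Fin N → ℂ) : ℝ :=
  ∑ n, g n * (‖(V *ᵥ s) n‖ ^ 2 - 1)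

/-- The Hermitian matrix of `specForm`. -/
def specMatrix (V : Matrix (Fin N) (Fin N) ℂ) (g : Fin N → ℝ) : Matrix (Fin N) (Fin N) ℂ :=
  Vᴴ * Matrix.diagonal (fun n => (g n : ℂ)) * V

lemma isHermitian_specMatrix (V : Matrix (Fin N) (Fin N) ℂ) (g : Fin N → ℝ) :
    (specMatrix V g).IsHermitian := by
  refine Matrix.isHermitian_conjTranspose_mul_mul V ?_
  rw [Matrix.IsHermitian, Matrix.diagonal_conjTranspose]
  congr 1
  funext n
  simp

lemma quadForm_specMatrix {V : Matrix (Fin N) (Fin N) ℂ} (hV : V ∈ Matrix.unitaryGroup (Fin N) ℂ)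
    (g : Fin N → ℝ) (s : Fin N → ℂ) : quadForm (specMatrix V g) s = specForm V g s := by
  have h1 : star s ⬝ᵥ (specMatrix V g *ᵥ s) =
      ∑ n, ((g n * ‖(V *ᵥ s) n‖ ^ 2 : ℝ) : ℂ) := by
    rw [specMatrix, ← Matrix.mulVec_mulVec, ← Matrix.mulVec_mulVec, Matrix.dotProduct_mulVec,
      ← Matrix.star_mulVec]
    simp only [dotProduct, Pi.star_apply, Matrix.mulVec_diagonal]
    refine Finset.sum_congr rfl fun n _ => ?_
    push_cast
    rw [← Complex.conj_mul', Complex.star_def]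
    ring
  have h2 : (specMatrix V g).trace = ∑ n, (g n : ℂ) := by
    rw [specMatrix, Matrix.mul_assoc, Matrix.trace_mul_comm, Matrix.mul_assoc,
      ← Matrix.star_eq_conjTranspose, Matrix.mem_unitaryGroup_iff.1 hV, Matrix.mul_one,
      Matrix.trace_diagonal]
  rw [quadForm, h1, h2, specForm]
  rw [← Complex.ofReal_sum, ← Complex.ofReal_sum, Complex.ofReal_re, Complex.ofReal_re,
    ← Finset.sum_sub_distrib]
  exact Finset.sum_congr rfl fun n _ => by ring

lemma frobSq_eq_trace (Q : Matrix (Fin N) (Fin N) ℂ) : (frobSq Q : ℂ) = (Qᴴ * Q).trace := by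
  rw [frobSq, Finset.sum_comm]
  push_cast
  simp only [Matrix.trace, Matrix.diag_apply, Matrix.mul_apply, Matrix.conjTranspose_apply]
  refine Finset.sum_congr rfl fun i _ => Finset.sum_congr rfl fun j _ => ?_
  rw [← Complex.conj_mul', Complex.star_def]

/-- Unitary conjugation preserves the Frobenius norm, so this part of the variance does not see the
waveform. -/
lemma frobSq_specMatrix {V : Matrix (Fin N) (Fin N) ℂ} (hV : V ∈ Matrix.unitaryGroup (Fin N) ℂ)
    (g : Fin N → ℝ) : frobSq (specMatrix V g) = ∑ n, g n ^ 2 := by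
  have hVV : V * Vᴴ = 1 := Matrix.mem_unitaryGroup_iff.1 hV
  have h : (frobSq (specMatrix V g) : ℂ) = ∑ n, ((g n ^ 2 : ℝ) : ℂ) := by
    rw [frobSq_eq_trace, (isHermitian_specMatrix V g).eq, specMatrix]
    set D := Matrix.diagonal (fun n => (g n : ℂ)) with hD
    have : Vᴴ * D * V * (Vᴴ * D * V) = Vᴴ * (D * D * V) := by
      calc _ = Vᴴ * (D * (V * Vᴴ) * D * V) := by simp only [Matrix.mul_assoc]
        _ = _ := by rw [hVV, Matrix.mul_one]
    rw [this, Matrix.trace_mul_comm, Matrix.mul_assoc, hVV, Matrix.mul_one, hD,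
      Matrix.diagonal_mul_diagonal, Matrix.trace_diagonal]
    refine Finset.sum_congr rfl fun n _ => by push_cast; ring
  exact_mod_cast h

lemma specMatrix_diag_re (V : Matrix (Fin N) (Fin N) ℂ) (g : Fin N → ℝ) (k : Fin N) :
    (specMatrix V g k k).re = ∑ n, ‖V n k‖ ^ 2 * g n := by
  rw [specMatrix, Matrix.mul_apply, Complex.re_sum]
  refine Finset.sum_congr rfl fun n _ => ?_
  rw [Matrix.mul_diagonal, Matrix.conjTranspose_apply]
  have : star (V n k) * (g n : ℂ) * V n k = ((‖V n k‖ ^ 2 * g n : ℝ) : ℂ) := by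
    push_cast
    rw [← Complex.conj_mul', Complex.star_def]
    ring
  rw [this, Complex.ofReal_re]

/-- The waveform enters only through the diagonal of the Hermitian form, that is, through the means
of `g` over the column spectra of `V`. -/
lemma IsNormalized.vecAvg_specForm_sq (h : IsNormalized S κ K)
    {V : Matrix (Fin N) (Fin N) ℂ} (hV : V ∈ Matrix.unitaryGroup (Fin N) ℂ) (g : Fin N → ℝ) :
    vecAvg S N (fun s => specForm V g s ^ 2) =
      ∑ n, g n ^ 2 - (2 - κ) * ∑ k, (∑ n, ‖V n k‖ ^ 2 * g n) ^ 2 := by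
  have := h.vecAvg_quadForm_sq (isHermitian_specMatrix V g)
  simpa only [quadForm_specMatrix hV, frobSq_specMatrix hV, specMatrix_diag_re] using this

lemma IsNormalized.vecAvg_specForm_four (h : IsNormalized S κ K)
    {V : Matrix (Fin N) (Fin N) ℂ} (hV : V ∈ Matrix.unitaryGroup (Fin N) ℂ) (g : Fin N → ℝ) :
    vecAvg S N (fun s => specForm V g s ^ 4) ≤ (40 * K ^ 4) ^ 2 * (∑ n, g n ^ 2) ^ 2 := by
  have := h.vecAvg_quadForm_four (isHermitian_specMatrix V g)
  simpa only [quadForm_specMatrix hV, frobSq_specMatrix hV] using this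

/-- Together with `sum_norm_sq_row` this makes the matrix of squared moduli doubly stochastic. -/
lemma sum_norm_sq_col {V : Matrix (Fin N) (Fin N) ℂ} (hV : V ∈ Matrix.unitaryGroup (Fin N) ℂ)
    (k : Fin N) : ∑ n, ‖V n k‖ ^ 2 = 1 := by
  have h := congrFun (congrFun (Matrix.mem_unitaryGroup_iff'.1 hV) k) k
  rw [Matrix.mul_apply, Matrix.one_apply_eq] at h
  have : (∑ n, ((‖V n k‖ ^ 2 : ℝ) : ℂ)) = 1 := by
    rw [← h]
    refine Finset.sum_congr rfl fun n _ => ?_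
    push_cast
    rw [← Complex.conj_mul', Matrix.star_apply, Complex.star_def]
  exact_mod_cast this

lemma sum_norm_sq_row {V : Matrix (Fin N) (Fin N) ℂ} (hV : V ∈ Matrix.unitaryGroup (Fin N) ℂ)
    (n : Fin N) : ∑ k, ‖V n k‖ ^ 2 = 1 := by
  have := sum_norm_sq_col (V := star V) (Unitary.star_mem hV) n
  simpa [Matrix.star_apply, norm_star] using this

lemma IsNormalized.vecAvg_energy (h : IsNormalized S κ K)
    {V : Matrix (Fin N) (Fin N) ℂ} (hV : V ∈ Matrix.unitaryGroup (Fin N) ℂ) (n : Fin N) :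
    vecAvg S N (fun s => ‖(V *ᵥ s) n‖ ^ 2) = 1 := by
  rw [← sum_norm_sq_row hV n, ← h.vecAvg_linForm_sq]
  rfl

lemma IsNormalized.vecAvg_specForm (h : IsNormalized S κ K)
    {V : Matrix (Fin N) (Fin N) ℂ} (hV : V ∈ Matrix.unitaryGroup (Fin N) ℂ) (g : Fin N → ℝ) :
    vecAvg S N (specForm V g) = 0 := by
  have : vecAvg S N (fun s => ∑ n, g n * (‖(V *ᵥ s) n‖ ^ 2 - 1)) = 0 := by
    rw [vecAvg_sum]
    refine Finset.sum_eq_zero fun n _ => ?_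
    rw [vecAvg_mul_left, vecAvg_sub, h.vecAvg_energy hV, vecAvg_const _ h.nonempty]
    ring
  exact this

end Spectral

/-! ### The discrete Fourier transform and the Fisher information matrix -/

section Fourier

variable {N : ℕ}

lemma dft_apply_eq_pow (m n : Fin N) :
    dft N m n = (1 / (Real.sqrt N : ℂ)) *
      ((Complex.exp (2 * Real.pi * Complex.I / N))⁻¹ ^ (m : ℕ)) ^ (n : ℕ) := by
  rw [dft, Matrix.of_apply, ← Complex.exp_neg, ← Complex.exp_nat_mul, ← Complex.exp_nat_mul]
  congr 2
  ring

lemma dft_mem_unitaryGroup (hN : N ≠ 0) : dft N ∈ Matrix.unitaryGroup (Fin N) ℂ := by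
  obtain ⟨w, hw⟩ : ∃ w, w = (Complex.exp (2 * Real.pi * Complex.I / N))⁻¹ := ⟨_, rfl⟩
  have hprim : IsPrimitiveRoot w N := hw ▸ (Complex.isPrimitiveRoot_exp N hN).inv
  have hw0 : w ≠ 0 := hprim.ne_zero hN
  have hstar : star w = w⁻¹ := by
    rw [Complex.star_def, Complex.inv_def, Complex.normSq_eq_norm_sq,
      hprim.norm'_eq_one hN]
    simp
  have hNc : (N : ℂ) ≠ 0 := by exact_mod_cast hN
  rw [Matrix.mem_unitaryGroup_iff]
  ext m k
  have hterm : ∀ n : Fin N, dft N m n * (star (dft N)) n k =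
      (1 / N : ℂ) * (w ^ (m : ℕ) * (w⁻¹) ^ (k : ℕ)) ^ (n : ℕ) := by
    intro n
    rw [Matrix.star_apply, dft_apply_eq_pow, dft_apply_eq_pow, ← hw, star_mul', star_pow, star_pow,
      hstar, mul_pow]
    have : (1 / (Real.sqrt N : ℂ)) * star (1 / (Real.sqrt N : ℂ)) = 1 / N := by
      have h1 : star (1 / (Real.sqrt N : ℂ)) = 1 / (Real.sqrt N : ℂ) := by simp
      rw [h1, div_mul_div_comm, ← Complex.ofReal_mul, Real.mul_self_sqrt (Nat.cast_nonneg N)]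
      simp
    rw [← this]; ring
  rw [Matrix.mul_apply, Finset.sum_congr rfl fun n _ => hterm n, ← Finset.mul_sum,
    Fin.sum_univ_eq_sum_range (fun n => (w ^ (m : ℕ) * (w⁻¹) ^ (k : ℕ)) ^ n) N]
  by_cases hmk : m = k
  · subst hmk
    rw [← mul_pow, mul_inv_cancel₀ hw0]
    simp [hNc]
  · rw [Matrix.one_apply_ne hmk]
    have hr : w ^ (m : ℕ) * (w⁻¹) ^ (k : ℕ) ≠ 1 := by
      intro h
      rw [inv_pow, mul_inv_eq_one₀ (pow_ne_zero _ hw0)] at h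
      exact hmk (Fin.ext (hprim.pow_inj m.2 k.2 h))
    have hrN : (w ^ (m : ℕ) * (w⁻¹) ^ (k : ℕ)) ^ N = 1 := by
      rw [mul_pow, ← pow_mul, ← pow_mul, mul_comm (m : ℕ), mul_comm (k : ℕ), pow_mul, pow_mul,
        inv_pow, hprim.pow_eq_one]
      simp
    rw [geom_sum_eq hr, hrN]
    simp

/-- The steering phase `exp(-2πi f t)`. -/
def phase (t f : ℝ) : ℂ := Complex.exp (-(2 * Real.pi * Complex.I * f * t))

variable {L : ℕ}

/-- Frequency response of the derivative of the echo with respect to a parameter. -/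
def steer (τ : Fin L → ℝ) (β : Fin L → ℂ) : ParamIdx L → ℝ → ℂ
  | .inl l, f => β l * (-(2 * Real.pi * Complex.I * f)) * phase (τ l) f
  | .inr (.inl l), f => phase (τ l) f
  | .inr (.inr l), f => Complex.I * phase (τ l) f

/-- Real Gram kernel of the frequency responses. -/
def gram (τ : Fin L → ℝ) (β : Fin L → ℂ) (f : ℝ) : Matrix (ParamIdx L) (ParamIdx L) ℝ :=
  Matrix.of fun k l => (star (steer τ β k f) * steer τ β l f).re

lemma phase_freq (t : ℝ) (n : Fin N) :
    Complex.exp (-(2 * Real.pi * Complex.I * (n : ℕ) * t / N)) = phase t (freq n) := by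
  rw [phase, freq]
  congr 1
  push_cast
  ring

lemma delayOp_mulVec_apply (t : ℝ) (x : Fin N → ℂ) (n : Fin N) :
    (delayOp N t *ᵥ x) n =
      ∑ m, (dft N)ᴴ n m * (phase t (freq m) * (dft N *ᵥ x) m) := by
  rw [delayOp, ← Matrix.mulVec_mulVec, ← Matrix.mulVec_mulVec]
  simp only [Matrix.mulVec, dotProduct, Matrix.diagonal_apply, phase_freq, ite_mul, zero_mul,
    Finset.sum_ite_eq, Finset.mem_univ, if_true]

lemma hasDerivAt_phase (f t : ℝ) :
    HasDerivAt (fun t : ℝ => phase t f) (-(2 * Real.pi * Complex.I * f) * phase t f) t := by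
  have h1 : HasDerivAt (fun t : ℝ => -(2 * Real.pi * Complex.I * f * (t : ℂ)))
      (-(2 * Real.pi * Complex.I * f)) t := by
    have := ((hasDerivAt_id t).ofReal_comp.const_mul (2 * Real.pi * Complex.I * f : ℂ)).neg
    refine this.congr_deriv ?_
    simp
  refine h1.cexp.congr_deriv ?_
  rw [mul_comm, phase]

lemma echoDeriv_eq (x : Fin N → ℂ) (τ : Fin L → ℝ) (β : Fin L → ℂ) (k : ParamIdx L) :
    echoDeriv x (params τ β) k =
      (dft N)ᴴ *ᵥ fun m => steer τ β k (freq m) * (dft N *ᵥ x) m := by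
  funext n
  rw [echoDeriv]
  -- All coordinates are differentiated at once, with velocity `Pi.single k 1`; the three kinds of
  -- parameter are told apart only after the derivative is known.
  have hupd : ∀ i, HasDerivAt (fun t : ℝ => Function.update (params τ β) k t i)
      ((Pi.single k (1 : ℝ) : ParamIdx L → ℝ) i) (params τ β k) := fun i =>
    hasDerivAt_pi.1 (hasDerivAt_update (params τ β) k (params τ β k)) i
  have hval : ∀ i, Function.update (params τ β) k (params τ β k) i = params τ β i := by
    intro i; rw [Function.update_eq_self]
  have hβ : ∀ l, ((params τ β (.inr (.inl l)) : ℂ) +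
      (params τ β (.inr (.inr l)) : ℂ) * Complex.I) = β l := by
    intro l; simp [params, Complex.re_add_im]
  have hmain : HasDerivAt (fun t : ℝ => echo x (Function.update (params τ β) k t) n)
      (∑ l, ((((Pi.single k (1 : ℝ) : ParamIdx L → ℝ) (.inr (.inl l)) : ℂ) +
          ((Pi.single k (1 : ℝ) : ParamIdx L → ℝ) (.inr (.inr l)) : ℂ) * Complex.I) *
            (∑ m, (dft N)ᴴ n m * (phase (τ l) (freq m) * (dft N *ᵥ x) m)) +
        β l * ∑ m, (dft N)ᴴ n m * (((-(2 * Real.pi * Complex.I * (freq m : ℝ)) *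
          phase (τ l) (freq m)) * ((Pi.single k (1 : ℝ) : ParamIdx L → ℝ) (.inl l) : ℂ)) *
            (dft N *ᵥ x) m)))
      (params τ β k) := by
    simp only [echo, Finset.sum_apply, Pi.smul_apply, smul_eq_mul, delayOp_mulVec_apply]
    refine HasDerivAt.fun_sum fun l _ => ?_
    have h1 := ((hupd (.inr (.inl l))).ofReal_comp).add
      ((hupd (.inr (.inr l))).ofReal_comp.mul_const Complex.I)
    have h2 : HasDerivAt (fun t : ℝ => ∑ m, (dft N)ᴴ n m *
        (phase (Function.update (params τ β) k t (.inl l)) (freq m) * (dft N *ᵥ x) m))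
        (∑ m, (dft N)ᴴ n m * (((-(2 * Real.pi * Complex.I * (freq m : ℝ)) *
          phase (τ l) (freq m)) * ((Pi.single k (1 : ℝ) : ParamIdx L → ℝ) (.inl l) : ℂ)) *
            (dft N *ᵥ x) m)) (params τ β k) := by
      refine HasDerivAt.fun_sum fun m _ => ?_
      refine HasDerivAt.const_mul _ (HasDerivAt.mul_const ?_ _)
      have h3 : HasDerivAt (fun t : ℝ => phase t (freq m))
          (-(2 * Real.pi * Complex.I * (freq m : ℝ)) * phase (τ l) (freq m))
          (Function.update (params τ β) k (params τ β k) (.inl l)) := by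
        rw [hval]; exact hasDerivAt_phase _ _
      have := h3.scomp (params τ β k) (hupd (.inl l))
      simpa [Function.comp_def, mul_comm] using this
    have := h1.mul h2
    simp only [hval, Pi.add_apply] at this
    rw [hβ] at this
    exact this
  rw [hmain.deriv]
  change _ = ∑ m, (dft N)ᴴ n m * (steer τ β k (freq m) * (dft N *ᵥ x) m)
  rcases k with l | l | l
  · rw [Finset.sum_eq_single l]
    · simp only [Pi.single_apply, steer]
      simp only [reduceCtorEq, if_false, if_true, Complex.ofReal_zero, zero_mul, add_zero,
        Complex.ofReal_one, mul_one, Finset.mul_sum, Finset.sum_const_zero, zero_add]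
      refine Finset.sum_congr rfl fun m _ => ?_
      ring
    · intro b _ hb
      simp [hb]
    · simp
  · rw [Finset.sum_eq_single l]
    · simp [steer]
    · intro b _ hb
      simp [hb]
    · simp
  · rw [Finset.sum_eq_single l]
    · simp only [Pi.single_apply, steer]
      simp only [reduceCtorEq, if_false, if_true, Complex.ofReal_zero, zero_mul, mul_zero, add_zero,
        zero_add, Complex.ofReal_one, one_mul, Finset.mul_sum, Finset.sum_const_zero,
        Sum.inr.injEq]
      refine Finset.sum_congr rfl fun m _ => ?_
      ring
    · intro b _ hb
      simp [hb]
    · simp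

/-- Delays act diagonally in frequency, and the outer DFT drops out by Parseval; only the energies
of the spectrum of `U s` remain. -/
lemma fim_apply (hN : N ≠ 0) (σ : ℝ) (τ : Fin L → ℝ) (β : Fin L → ℂ)
    (U : Matrix (Fin N) (Fin N) ℂ) (s : Fin N → ℂ) (k l : ParamIdx L) :
    fim σ (params τ β) U s k l =
      2 / σ ^ 2 * ∑ n, gram τ β (freq n) k l * ‖((dft N * U) *ᵥ s) n‖ ^ 2 := by
  rw [fim, fisher, Matrix.of_apply, echoDeriv_eq, echoDeriv_eq, Matrix.star_mulVec,
    Matrix.dotProduct_mulVec, Matrix.vecMul_vecMul, Matrix.conjTranspose_conjTranspose,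
    ← Matrix.star_eq_conjTranspose, Matrix.mem_unitaryGroup_iff.1 (dft_mem_unitaryGroup hN),
    Matrix.vecMul_one, dotProduct, Complex.re_sum]
  congr 1
  refine Finset.sum_congr rfl fun n _ => ?_
  rw [Matrix.mulVec_mulVec, Pi.star_apply, gram, Matrix.of_apply, star_mul',
    ← Complex.re_mul_ofReal]
  congr 1
  push_cast
  rw [← Complex.conj_mul', Complex.star_def]
  ring

end Fourier

/-! ### Quasi-polynomials -/

section QuasiPolynomial

variable {L : ℕ}

lemma phase_comm (t f : ℝ) : phase t f = phase f t := by
  rw [phase, phase]; congr 1; ring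

lemma phase_add (t f g : ℝ) : phase t (f + g) = phase t f * phase t g := by
  rw [phase, phase, phase, ← Complex.exp_add]; congr 1; push_cast; ring

@[simp] lemma phase_zero (t : ℝ) : phase t 0 = 1 := by simp [phase]

lemma norm_phase (t f : ℝ) : ‖phase t f‖ = 1 := by
  rw [phase, show (-(2 * Real.pi * Complex.I * f * t) : ℂ) = ((-(2 * Real.pi * f * t) : ℝ) : ℂ) *
    Complex.I by push_cast; ring, Complex.norm_exp_ofReal_mul_I]

lemma phase_ne_zero (t f : ℝ) : phase t f ≠ 0 := Complex.exp_ne_zero _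

lemma phase_injective {t t' : ℝ} (h : ∀ f, phase t f = phase t' f) : t = t' := by
  have h1 : ∀ t : ℝ, HasDerivAt (fun f : ℝ => phase t f) (-(2 * Real.pi * Complex.I * t)) 0 := by
    intro t
    have := hasDerivAt_phase t 0
    simp only [phase_comm _ t] at this
    simpa using this
  have h2 := (h1 t).unique ((funext h : (fun f => phase t f) = fun f => phase t' f) ▸ h1 t')
  have h3 : (2 * Real.pi * Complex.I : ℂ) ≠ 0 := by simp [Real.pi_ne_zero]
  have h4 : (2 * Real.pi * Complex.I : ℂ) * t = (2 * Real.pi * Complex.I : ℂ) * t' := by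
    linear_combination -h2
  exact_mod_cast mul_left_cancel₀ h3 h4

/-- The character `f ↦ phase t f` of the additive group of the reals. -/
def phaseHom (t : ℝ) : Multiplicative ℝ →* ℂ where
  toFun f := phase t f.toAdd
  map_one' := by simp
  map_mul' f g := by simp [phase_add]

/-- Dedekind's independence of distinct characters of the additive group of the reals. -/
lemma linearIndependent_phase {τ : Fin L → ℝ} (hτ : Function.Injective τ) {b : Fin L → ℂ}
    (h : ∀ f : ℝ, ∑ l, b l * phase (τ l) f = 0) : ∀ l, b l = 0 := by
  have hinj : Function.Injective fun l => phaseHom (τ l) := by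
    intro l l' hl
    refine hτ (phase_injective fun f => ?_)
    exact DFunLike.congr_fun hl (Multiplicative.ofAdd f)
  have := (linearIndependent_monoidHom (Multiplicative ℝ) ℂ).comp _ hinj
  rw [Fintype.linearIndependent_iff] at this
  refine this b ?_
  funext f
  simpa [phaseHom] using h f.toAdd

/-- Strong induction on the number of nonzero slopes `a l`; with none left, it is independence of
characters. -/
lemma quasiPolynomial_eq_zero {τ : Fin L → ℝ} (hτ : Function.Injective τ) (a b : Fin L → ℂ)
    (h : ∀ f : ℝ, ∑ l, (a l * f + b l) * phase (τ l) f = 0) :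
    (∀ l, a l = 0) ∧ ∀ l, b l = 0 := by
  classical
  induction hn : (Finset.univ.filter fun l => a l ≠ 0).card using Nat.strong_induction_on
    generalizing a b with
  | _ n ih =>
    by_cases ha : ∀ l, a l = 0
    · refine ⟨ha, linearIndependent_phase hτ fun f => ?_⟩
      simpa [ha] using h f
    · exfalso
      push Not at ha
      obtain ⟨m, hm⟩ := ha
      -- Shift f by one and subtract `phase (τ m) 1` times the original relation. The slope at `m`
      -- disappears, no new slope appears, and the constant at `m` becomes `a m * phase (τ m) 1`,
      -- which cannot vanish. Delays congruent to `τ m` modulo one merely lose their slope as well.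
      have key := ih (Finset.univ.filter fun l => a l * (phase (τ l) 1 - phase (τ m) 1) ≠ 0).card ?_
        (fun l => a l * (phase (τ l) 1 - phase (τ m) 1))
        (fun l => (a l + b l) * phase (τ l) 1 - b l * phase (τ m) 1) ?_ rfl
      · have := key.2 m
        have h0 : a m * phase (τ m) 1 = 0 := by linear_combination this
        exact hm ((mul_eq_zero.1 h0).resolve_right (phase_ne_zero _ _))
      · rw [← hn]
        refine Finset.card_lt_card (Finset.ssubset_iff_of_subset ?_ |>.2 ⟨m, by simp [hm], by simp⟩)
        intro l
        simp only [Finset.mem_filter, Finset.mem_univ, true_and, ne_eq, mul_eq_zero, not_or]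
        exact fun h => h.1
      · intro f
        have h1 := h (f + 1)
        have h2 := h f
        calc _ = ∑ l, (a l * (f + 1 : ℝ) + b l) * phase (τ l) (f + 1) -
              phase (τ m) 1 * ∑ l, (a l * f + b l) * phase (τ l) f := by
              rw [Finset.mul_sum, ← Finset.sum_sub_distrib]
              refine Finset.sum_congr rfl fun l _ => ?_
              rw [phase_add]
              push_cast
              ring
          _ = 0 := by rw [h1, h2]; ring

lemma analyticAt_phase (t f : ℝ) : AnalyticAt ℝ (fun f : ℝ => phase t f) f := by
  have h1 : AnalyticAt ℝ (fun f : ℝ => (f : ℂ)) f := Complex.ofRealCLM.analyticAt f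
  have h2 : AnalyticAt ℝ (fun f : ℝ => -(2 * Real.pi * Complex.I * (f : ℂ) * t)) f :=
    ((analyticAt_const.mul h1).mul analyticAt_const).neg
  exact AnalyticAt.fun_comp (g := Complex.exp) analyticAt_cexp.restrictScalars h2

lemma analyticAt_steer (τ : Fin L → ℝ) (β : Fin L → ℂ) (k : ParamIdx L) (f : ℝ) :
    AnalyticAt ℝ (steer τ β k) f := by
  have h1 : AnalyticAt ℝ (fun f : ℝ => (f : ℂ)) f := Complex.ofRealCLM.analyticAt f
  rcases k with l | l | l
  · exact (analyticAt_const.mul (analyticAt_const.mul h1).neg).mul (analyticAt_phase _ _)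
  · exact analyticAt_phase _ _
  · exact analyticAt_const.mul (analyticAt_phase _ _)

/-- Real linear combination of the frequency responses. -/
def response (τ : Fin L → ℝ) (β : Fin L → ℂ) (x : ParamIdx L → ℝ) (f : ℝ) : ℂ :=
  ∑ k, (x k : ℂ) * steer τ β k f

lemma analyticAt_response (τ : Fin L → ℝ) (β : Fin L → ℂ) (x : ParamIdx L → ℝ) (f : ℝ) :
    AnalyticAt ℝ (response τ β x) f :=
  Finset.analyticAt_fun_sum _ fun k _ => analyticAt_const.mul (analyticAt_steer τ β k f)

lemma continuous_steer (τ : Fin L → ℝ) (β : Fin L → ℂ) (k : ParamIdx L) :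
    Continuous (steer τ β k) :=
  continuous_iff_continuousAt.2 fun f => (analyticAt_steer τ β k f).continuousAt

lemma continuous_response (τ : Fin L → ℝ) (β : Fin L → ℂ) (x : ParamIdx L → ℝ) :
    Continuous (response τ β x) :=
  continuous_iff_continuousAt.2 fun f => (analyticAt_response τ β x f).continuousAt

lemma response_eq (τ : Fin L → ℝ) (β : Fin L → ℂ) (x : ParamIdx L → ℝ) (f : ℝ) :
    response τ β x f = ∑ l, ((x (.inl l) * β l * -(2 * Real.pi * Complex.I)) * f +
      (x (.inr (.inl l)) + x (.inr (.inr l)) * Complex.I)) * phase (τ l) f := by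
  simp only [response, Fintype.sum_sum_type, steer, ← Finset.sum_add_distrib]
  exact Finset.sum_congr rfl fun l _ => by ring

/-- Analytic continuation carries the relation from the unit band to the whole line, where it is a
vanishing quasi-polynomial. -/
lemma eq_zero_of_response_eq_zero {τ : Fin L → ℝ} {β : Fin L → ℂ} (hτ : Function.Injective τ)
    (hβ : ∀ l, β l ≠ 0) {x : ParamIdx L → ℝ} (h : ∀ f ∈ Set.Ioo (0 : ℝ) 1, response τ β x f = 0) :
    x = 0 := by
  have hall : response τ β x = fun _ => 0 := by
    refine AnalyticOnNhd.eq_of_eventuallyEq (z₀ := 1 / 2)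
      (fun f _ => analyticAt_response τ β x f) (fun f _ => analyticAt_const) ?_
    filter_upwards [Ioo_mem_nhds (by norm_num : (0 : ℝ) < 1 / 2) (by norm_num : (1 / 2 : ℝ) < 1)]
      with f hf using h f hf
  have h0 := quasiPolynomial_eq_zero hτ _ _ fun f => by
    rw [← response_eq τ β x f, hall]
  funext k
  rcases k with l | l | l
  · have := h0.1 l
    simpa [hβ l, Real.pi_ne_zero] using this
  · simpa using congrArg Complex.re (h0.2 l)
  · simpa using congrArg Complex.im (h0.2 l)

end QuasiPolynomial

/-! ### Riemann sums and the limiting information matrix -/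

section Limit

open Filter Topology

lemma tendsto_riemannSum {F : ℝ → ℝ} (hF : Continuous F) :
    Tendsto (fun N : ℕ => (N : ℝ)⁻¹ * ∑ n : Fin N, F (freq n)) atTop (𝓝 (∫ f in (0 : ℝ)..1, F f)) := by
  rw [Metric.tendsto_atTop]
  intro ε hε
  have huc := isCompact_Icc.uniformContinuousOn_of_continuous (hF.continuousOn (s := Set.Icc 0 1))
  rw [Metric.uniformContinuousOn_iff] at huc
  obtain ⟨δ, hδ, hδF⟩ := huc (ε / 2) (by positivity)
  obtain ⟨N₀, hN₀⟩ := exists_nat_gt (1 / δ)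
  refine ⟨N₀ + 1, fun N hN => ?_⟩
  have hNpos : (0 : ℝ) < N := by
    have : 0 < N := by omega
    exact_mod_cast this
  have hNδ : (N : ℝ)⁻¹ < δ := by
    rw [inv_lt_comm₀ hNpos hδ, ← one_div]
    refine hN₀.trans_le ?_
    exact_mod_cast (by omega : N₀ ≤ N)
  have hint : ∀ a b : ℝ, IntervalIntegrable F volume a b := fun a b => hF.intervalIntegrable a b
  have hsum := intervalIntegral.sum_integral_adjacent_intervals (f := F) (μ := volume)
    (a := fun n : ℕ => (n : ℝ) / N) (n := N) fun k _ => hint _ _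
  simp only [Nat.cast_zero, zero_div, div_self hNpos.ne'] at hsum
  have hfin : ∑ n : Fin N, F (freq n) = ∑ n ∈ Finset.range N, F ((n : ℝ) / N) :=
    Fin.sum_univ_eq_sum_range (fun n : ℕ => F ((n : ℝ) / N)) N
  rw [← hsum, hfin, Finset.mul_sum,
    Real.dist_eq, ← Finset.sum_sub_distrib]
  have hterm : ∀ n ∈ Finset.range N, |(N : ℝ)⁻¹ * F ((n : ℝ) / N) -
      ∫ f in ((n : ℝ) / N)..(((n + 1 : ℕ) : ℝ) / N), F f| ≤ ε / 2 * (N : ℝ)⁻¹ := by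
    intro n hn
    have hlen : (((n + 1 : ℕ) : ℝ) / N) - (n : ℝ) / N = (N : ℝ)⁻¹ := by
      push_cast; field_simp; ring
    have hle : (n : ℝ) / N ≤ ((n + 1 : ℕ) : ℝ) / N := by
      rw [← sub_nonneg, hlen]; positivity
    have hn0 : 0 ≤ (n : ℝ) / N := by positivity
    have hn1 : ((n + 1 : ℕ) : ℝ) / N ≤ 1 := by
      rw [div_le_one hNpos]
      exact_mod_cast Finset.mem_range.1 hn
    have hc : (N : ℝ)⁻¹ * F ((n : ℝ) / N) =
        ∫ f in ((n : ℝ) / N)..(((n + 1 : ℕ) : ℝ) / N), F ((n : ℝ) / N) := by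
      rw [intervalIntegral.integral_const, hlen, smul_eq_mul]
    rw [hc, ← intervalIntegral.integral_sub (by simp) (hint _ _)]
    have := intervalIntegral.norm_integral_le_of_norm_le_const (C := ε / 2)
      (f := fun f => F ((n : ℝ) / N) - F f) (a := (n : ℝ) / N) (b := ((n + 1 : ℕ) : ℝ) / N) ?_
    · rwa [hlen, abs_of_pos (inv_pos.2 hNpos)] at this
    · intro f hf
      rw [Set.uIoc_of_le hle] at hf
      have := hδF ((n : ℝ) / N) ⟨hn0, hle.trans hn1⟩ f ⟨hn0.trans hf.1.le, hf.2.trans hn1⟩ (by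
        rw [Real.dist_eq, abs_sub_comm, abs_of_nonneg (by linarith [hf.1])]
        linarith [hf.2])
      exact this.le
  calc _ ≤ ∑ n ∈ Finset.range N, ε / 2 * (N : ℝ)⁻¹ :=
        (Finset.abs_sum_le_sum_abs _ _).trans (Finset.sum_le_sum hterm)
    _ = ε / 2 := by
        rw [Finset.sum_const, Finset.card_range, nsmul_eq_mul]
        field_simp
    _ < ε := by linarith

variable {L : ℕ}

/-- The normalized expected Fisher information matrix `J̄ / N`. -/
def meanGram (σ : ℝ) (τ : Fin L → ℝ) (β : Fin L → ℂ) (N : ℕ) :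
    Matrix (ParamIdx L) (ParamIdx L) ℝ :=
  Matrix.of fun k l => 2 / σ ^ 2 * ((N : ℝ)⁻¹ * ∑ n : Fin N, gram τ β (freq n) k l)

/-- The limit of `J̄ / N`. -/
def limGram (σ : ℝ) (τ : Fin L → ℝ) (β : Fin L → ℂ) : Matrix (ParamIdx L) (ParamIdx L) ℝ :=
  Matrix.of fun k l => 2 / σ ^ 2 * ∫ f in (0 : ℝ)..1, gram τ β f k l

lemma continuous_gram (τ : Fin L → ℝ) (β : Fin L → ℂ) (k l : ParamIdx L) :
    Continuous fun f => gram τ β f k l := by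
  simp only [gram, Matrix.of_apply]
  exact Complex.continuous_re.comp (((continuous_steer τ β k).star).mul (continuous_steer τ β l))

lemma tendsto_meanGram (σ : ℝ) (τ : Fin L → ℝ) (β : Fin L → ℂ) :
    Tendsto (meanGram σ τ β) atTop (𝓝 (limGram σ τ β)) := by
  refine tendsto_pi_nhds.2 fun k => tendsto_pi_nhds.2 fun l => ?_
  exact (tendsto_riemannSum (continuous_gram τ β k l)).const_mul (2 / σ ^ 2)

lemma gram_mulVec (τ : Fin L → ℝ) (β : Fin L → ℂ) (f : ℝ) (x : ParamIdx L → ℝ) (k : ParamIdx L) :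
    (gram τ β f *ᵥ x) k = (star (steer τ β k f) * response τ β x f).re := by
  simp only [Matrix.mulVec, dotProduct, gram, Matrix.of_apply, response, Finset.mul_sum,
    Complex.re_sum]
  refine Finset.sum_congr rfl fun l _ => ?_
  rw [mul_left_comm, Complex.re_ofReal_mul, mul_comm]

lemma dotProduct_gram_mulVec (τ : Fin L → ℝ) (β : Fin L → ℂ) (f : ℝ) (x : ParamIdx L → ℝ) :
    x ⬝ᵥ (gram τ β f *ᵥ x) = ‖response τ β x f‖ ^ 2 := by
  have h : ((‖response τ β x f‖ ^ 2 : ℝ) : ℂ) = star (response τ β x f) * response τ β x f := by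
    push_cast
    rw [← Complex.conj_mul', Complex.star_def]
  have h2 : ‖response τ β x f‖ ^ 2 = (star (response τ β x f) * response τ β x f).re := by
    rw [← h, Complex.ofReal_re]
  have h3 : star (response τ β x f) = ∑ k, (x k : ℂ) * star (steer τ β k f) := by
    simp only [response, star_sum, star_mul', Complex.star_def, Complex.conj_ofReal]
  rw [h2, h3, Finset.sum_mul, Complex.re_sum]
  simp only [dotProduct, gram_mulVec]
  refine Finset.sum_congr rfl fun k _ => ?_
  rw [mul_assoc, Complex.re_ofReal_mul]

lemma gram_isSymm (τ : Fin L → ℝ) (β : Fin L → ℂ) (f : ℝ) : (gram τ β f).IsSymm := by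
  ext k l
  simp only [gram, Matrix.transpose_apply, Matrix.of_apply, Complex.mul_re, Complex.star_def,
    Complex.conj_re, Complex.conj_im]
  ring

lemma dotProduct_limGram_mulVec (σ : ℝ) (τ : Fin L → ℝ) (β : Fin L → ℂ) (x y : ParamIdx L → ℝ) :
    y ⬝ᵥ (limGram σ τ β *ᵥ x) =
      2 / σ ^ 2 * ∫ f in (0 : ℝ)..1, y ⬝ᵥ (gram τ β f *ᵥ x) := by
  simp only [dotProduct, Matrix.mulVec, limGram, Matrix.of_apply, Finset.mul_sum]
  have hi : ∀ k l, IntervalIntegrable (fun f => y k * (gram τ β f k l * x l)) volume 0 1 :=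
    fun k l => (continuous_const.mul ((continuous_gram τ β k l).mul
      continuous_const)).intervalIntegrable 0 1
  rw [intervalIntegral.integral_finsetSum fun k _ => ?_, Finset.mul_sum]
  · refine Finset.sum_congr rfl fun k _ => ?_
    rw [intervalIntegral.integral_finsetSum fun l _ => hi k l, Finset.mul_sum]
    refine Finset.sum_congr rfl fun l _ => ?_
    rw [intervalIntegral.integral_const_mul, intervalIntegral.integral_mul_const]
    ring
  · have := IntervalIntegrable.sum Finset.univ fun l (_ : l ∈ Finset.univ) => hi k l
    simpa [Finset.sum_fn] using this

/-- The quadratic form is a multiple of ∫ ‖response‖² over the band, so identifiability of the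
parameters gives definiteness. -/
lemma limGram_posDef {σ : ℝ} (hσ : 0 < σ) {τ : Fin L → ℝ} {β : Fin L → ℂ}
    (hτ : Function.Injective τ) (hβ : ∀ l, β l ≠ 0) : (limGram σ τ β).PosDef := by
  refine Matrix.PosDef.of_dotProduct_mulVec_pos ?_ fun x hx => ?_
  · ext k l
    simp only [limGram, Matrix.conjTranspose_apply, Matrix.of_apply, star_trivial]
    congr 2
    funext f
    exact congrFun (congrFun (gram_isSymm τ β f) k) l
  · rw [star_trivial, dotProduct_limGram_mulVec]
    simp only [dotProduct_gram_mulVec]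
    refine mul_pos (by positivity) ?_
    have hc : Continuous fun f => ‖response τ β x f‖ ^ 2 := (continuous_response τ β x).norm.pow 2
    have hne : ∃ f ∈ Set.Ioo (0 : ℝ) 1, response τ β x f ≠ 0 := by
      by_contra! h
      exact hx (eq_zero_of_response_eq_zero hτ hβ h)
    obtain ⟨f, hf, hf0⟩ := hne
    exact intervalIntegral.integral_pos zero_lt_one hc.continuousOn (fun _ _ => by positivity)
      ⟨f, Set.Ioo_subset_Icc_self hf, by positivity⟩

/-! ### Coercivity and inversion along convergent matrices -/

section PosDefLimits

variable {ι : Type} [Fintype ι]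

lemma _root_.Matrix.PosDef.exists_lower_bound {M : Matrix ι ι ℝ} (hM : M.PosDef) :
    ∃ c : ℝ, 0 < c ∧ ∀ x : ι → ℝ, c * (x ⬝ᵥ x) ≤ x ⬝ᵥ (M *ᵥ x) := by
  rcases isEmpty_or_nonempty ι with hι | hι
  · exact ⟨1, one_pos, fun x => by simp [dotProduct]⟩
  have hcont : Continuous fun x : EuclideanSpace ℝ ι => x.ofLp ⬝ᵥ (M *ᵥ x.ofLp) := by
    unfold Matrix.mulVec dotProduct; fun_prop
  obtain ⟨x₀, hx₀, hmin⟩ := (isCompact_sphere (0 : EuclideanSpace ℝ ι) 1).exists_isMinOn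
    (NormedSpace.sphere_nonempty.2 zero_le_one) hcont.continuousOn
  have hx₀' : x₀.ofLp ≠ 0 := by
    intro h
    have h1 : x₀ = 0 := by ext i; simp [h]
    simp [h1] at hx₀
  refine ⟨_, by simpa using hM.dotProduct_mulVec_pos hx₀', fun x => ?_⟩
  by_cases hx : x = 0
  · simp [hx]
  have hxx : 0 < x ⬝ᵥ x := by simpa using Matrix.dotProduct_star_self_pos_iff.2 hx
  set r := Real.sqrt (x ⬝ᵥ x) with hr
  have hr0 : 0 < r := Real.sqrt_pos.2 hxx
  have hr2 : r ^ 2 = x ⬝ᵥ x := Real.sq_sqrt hxx.le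
  have hmem : WithLp.toLp 2 (r⁻¹ • x) ∈ Metric.sphere (0 : EuclideanSpace ℝ ι) 1 := by
    rw [mem_sphere_zero_iff_norm, EuclideanSpace.norm_eq, Real.sqrt_eq_one]
    simp only [Pi.smul_apply, smul_eq_mul, norm_mul, mul_pow, ← Finset.mul_sum, Real.norm_eq_abs,
      sq_abs]
    have : ∑ i, x i ^ 2 = r ^ 2 := by rw [hr2]; simp [dotProduct, sq]
    rw [this]; field_simp
  have := hmin hmem
  simp only [Set.mem_ofPred_eq, Matrix.mulVec_smul, dotProduct_smul, smul_dotProduct,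
    smul_eq_mul] at this
  rw [← hr2]
  calc _ ≤ (r⁻¹ * (r⁻¹ * (x ⬝ᵥ (M *ᵥ x)))) * r ^ 2 := by gcongr
    _ = _ := by field_simp

lemma abs_dotProduct_mulVec_le (M : Matrix ι ι ℝ) (x : ι → ℝ) :
    |x ⬝ᵥ (M *ᵥ x)| ≤ (∑ i, ∑ j, |M i j|) * (x ⬝ᵥ x) := by
  have hle : ∀ i, x i ^ 2 ≤ x ⬝ᵥ x := fun i => by
    rw [dotProduct, sq]
    exact Finset.single_le_sum (f := fun i => x i * x i) (fun i _ => mul_self_nonneg _)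
      (Finset.mem_univ i)
  have hexp : x ⬝ᵥ (M *ᵥ x) = ∑ i, ∑ j, x i * (M i j * x j) := by
    simp only [Matrix.mulVec, dotProduct, Finset.mul_sum]
  rw [hexp, Finset.sum_mul]
  refine (Finset.abs_sum_le_sum_abs _ _).trans (Finset.sum_le_sum fun i _ => ?_)
  rw [Finset.sum_mul]
  refine (Finset.abs_sum_le_sum_abs _ _).trans (Finset.sum_le_sum fun j _ => ?_)
  rw [abs_mul, abs_mul]
  have : |x i| * |x j| ≤ x ⬝ᵥ x := by
    have h1 := hle i
    have h2 := hle j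
    nlinarith [sq_nonneg (|x i| - |x j|), sq_abs (x i), sq_abs (x j)]
  calc _ = |M i j| * (|x i| * |x j|) := by ring
    _ ≤ _ := by gcongr

lemma eventually_lower_bound {M : ℕ → Matrix ι ι ℝ} {A : Matrix ι ι ℝ} (hA : A.PosDef)
    (hM : Tendsto M atTop (𝓝 A)) :
    ∃ c : ℝ, 0 < c ∧ ∀ᶠ N in atTop, ∀ x : ι → ℝ, c * (x ⬝ᵥ x) ≤ x ⬝ᵥ (M N *ᵥ x) := by
  obtain ⟨c, hc, hcA⟩ := hA.exists_lower_bound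
  refine ⟨c / 2, by positivity, ?_⟩
  have hlim : Tendsto (fun N => ∑ i, ∑ j, |(M N - A) i j|) atTop (𝓝 0) := by
    have : Tendsto (fun N => ∑ i, ∑ j, |(M N - A) i j|) atTop (𝓝 (∑ _i : ι, ∑ _j : ι, 0)) := by
      refine tendsto_finsetSum _ fun i _ => tendsto_finsetSum _ fun j _ => ?_
      have h1 := (tendsto_pi_nhds.1 (tendsto_pi_nhds.1 hM i) j).sub_const (A i j)
      rw [sub_self] at h1
      simpa using h1.abs
    simpa using this
  filter_upwards [hlim.eventually_lt_const (by positivity : (0 : ℝ) < c / 2)] with N hN x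
  have h1 := abs_dotProduct_mulVec_le (M N - A) x
  have hxx : 0 ≤ x ⬝ᵥ x := by simpa using dotProduct_star_self_nonneg x
  have h2 : (∑ i, ∑ j, |(M N - A) i j|) * (x ⬝ᵥ x) ≤ c / 2 * (x ⬝ᵥ x) := by gcongr
  have h3 : x ⬝ᵥ ((M N - A) *ᵥ x) = x ⬝ᵥ (M N *ᵥ x) - x ⬝ᵥ (A *ᵥ x) := by
    rw [Matrix.sub_mulVec, dotProduct_sub]
  rw [h3] at h1
  have := hcA x
  have := (abs_le.1 h1).1
  linarith

lemma tendsto_matrix_inv [DecidableEq ι] {M : ℕ → Matrix ι ι ℝ} {A : Matrix ι ι ℝ} (hA : A.PosDef)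
    (hM : Tendsto M atTop (𝓝 A)) : Tendsto (fun N => (M N)⁻¹) atTop (𝓝 A⁻¹) := by
  refine ((continuousAt_matrix_inv A ?_).tendsto).comp hM
  rw [Ring.inverse_eq_inv']
  exact continuousAt_inv₀ hA.det_pos.ne'

end PosDefLimits

end Limit

/-! ### Separation of the frequencies by the information kernel -/

section Separation

open Filter Topology

variable {L : ℕ}

/-- Quadrature component of the response relative to the `j`-th path. -/
def quadrature (τ : Fin L → ℝ) (β : Fin L → ℂ) (j : Fin L) (x : ParamIdx L → ℝ) (f : ℝ) : ℝ :=
  (star (β j * phase (τ j) f) * response τ β x f).im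

variable (τ : Fin L → ℝ) (β : Fin L → ℂ) (j : Fin L)

lemma analyticAt_quadrature (x : ParamIdx L → ℝ) (f : ℝ) :
    AnalyticAt ℝ (quadrature τ β j x) f := by
  have h1 : AnalyticAt ℝ (fun f : ℝ => star (β j * phase (τ j) f)) f :=
    AnalyticAt.fun_comp (g := fun z : ℂ => star z) (Complex.conjCLE.toContinuousLinearMap.analyticAt _)
      (analyticAt_const.mul (analyticAt_phase (τ j) f))
  exact AnalyticAt.fun_comp (g := fun z : ℂ => z.im) (Complex.imCLM.analyticAt _)
    (h1.mul (analyticAt_response τ β x f))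

lemma continuous_quadrature (x : ParamIdx L → ℝ) : Continuous (quadrature τ β j x) :=
  continuous_iff_continuousAt.2 fun f => (analyticAt_quadrature τ β j x f).continuousAt

/-- A delay derivative is the path itself times -2πif. The delay row thus carries f q(f), while the
amplitude rows give q(f) by `quadrature_eq`. -/
lemma gram_mulVec_inl (x : ParamIdx L → ℝ) (f : ℝ) :
    (gram τ β f *ᵥ x) (.inl j) = -(2 * Real.pi) * (f * quadrature τ β j x f) := by
  rw [gram_mulVec, quadrature, steer]
  have : star (β j * -(2 * Real.pi * Complex.I * f) * phase (τ j) f) * response τ β x f =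
      ((2 * Real.pi * f : ℝ) : ℂ) *
        (Complex.I * (star (β j * phase (τ j) f) * response τ β x f)) := by
    simp only [star_mul', star_neg, Complex.star_def, Complex.conj_I, Complex.conj_ofReal]
    have : (starRingEnd ℂ) 2 = 2 := Complex.conj_ofNat 2
    rw [this]
    push_cast
    ring
  rw [this, Complex.re_ofReal_mul, Complex.I_mul_re]
  ring

lemma quadrature_eq (x : ParamIdx L → ℝ) (f : ℝ) :
    quadrature τ β j x f = (β j).re * (gram τ β f *ᵥ x) (.inr (.inr j)) -
      (β j).im * (gram τ β f *ᵥ x) (.inr (.inl j)) := by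
  rw [gram_mulVec, gram_mulVec, quadrature, steer, steer]
  simp only [star_mul', Complex.star_def, Complex.mul_im, Complex.mul_re, Complex.conj_re,
    Complex.conj_im, Complex.I_re, Complex.I_im]
  ring

/-- With p, q the quadratures at f, g, one has (f - g) p = (f p - g q) - g (p - q). The delay row
controls the first bracket, the two amplitude rows the second. -/
lemma quadrature_separation (x : ParamIdx L → ℝ) {f g : ℝ} (hg : |g| ≤ 1) :
    (f - g) ^ 2 * quadrature τ β j x f ^ 2 ≤ 2 * (1 + ‖β j‖ ^ 2) *
      ((gram τ β f *ᵥ x - gram τ β g *ᵥ x) ⬝ᵥ (gram τ β f *ᵥ x - gram τ β g *ᵥ x)) := by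
  set v := gram τ β f *ᵥ x - gram τ β g *ᵥ x with hv
  set p := quadrature τ β j x f with hp
  set q := quadrature τ β j x g with hq
  have h1 : v (.inl j) = -(2 * Real.pi) * (f * p - g * q) := by
    rw [hv, Pi.sub_apply, gram_mulVec_inl, gram_mulVec_inl]; ring
  have h2 : p - q = (β j).re * v (.inr (.inr j)) - (β j).im * v (.inr (.inl j)) := by
    rw [hp, hq, quadrature_eq, quadrature_eq, hv, Pi.sub_apply, Pi.sub_apply]; ring
  have hvv : v (.inl j) ^ 2 + (v (.inr (.inl j)) ^ 2 + v (.inr (.inr j)) ^ 2) ≤ v ⬝ᵥ v := by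
    have hs : ∀ w : Fin L → ℝ, w j ^ 2 ≤ ∑ i, w i ^ 2 := fun w =>
      Finset.single_le_sum (f := fun i => w i ^ 2) (fun _ _ => sq_nonneg _) (Finset.mem_univ j)
    simp only [dotProduct, Fintype.sum_sum_type, ← sq]
    have := hs fun i => v (.inl i)
    have := hs fun i => v (.inr (.inl i))
    have := hs fun i => v (.inr (.inr i))
    linarith
  have hd1 : (f * p - g * q) ^ 2 ≤ v (.inl j) ^ 2 := by
    rw [h1, mul_pow]
    have : (1 : ℝ) ≤ (-(2 * Real.pi)) ^ 2 := by nlinarith [Real.pi_gt_three]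
    exact le_mul_of_one_le_left (sq_nonneg _) this
  have hd2 : (p - q) ^ 2 ≤ ‖β j‖ ^ 2 * (v (.inr (.inl j)) ^ 2 + v (.inr (.inr j)) ^ 2) := by
    rw [h2, Complex.sq_norm, Complex.normSq_apply]
    nlinarith [sq_nonneg ((β j).re * v (.inr (.inl j)) + (β j).im * v (.inr (.inr j)))]
  have hg2 : g ^ 2 ≤ 1 := by
    rw [← sq_abs]; exact pow_le_one₀ (abs_nonneg _) hg
  have hk : (f - g) ^ 2 * p ^ 2 ≤ 2 * (f * p - g * q) ^ 2 + 2 * (g ^ 2 * (p - q) ^ 2) := by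
    nlinarith [sq_nonneg ((f * p - g * q) + g * (p - q))]
  have hk2 : g ^ 2 * (p - q) ^ 2 ≤ (p - q) ^ 2 := mul_le_of_le_one_left (sq_nonneg _) hg2
  have hβ0 : 0 ≤ ‖β j‖ ^ 2 := by positivity
  have hv0 : 0 ≤ v (.inl j) ^ 2 := sq_nonneg _
  have hv1 : 0 ≤ v (.inr (.inl j)) ^ 2 + v (.inr (.inr j)) ^ 2 := by positivity
  nlinarith [mul_nonneg hβ0 hv0, mul_le_mul_of_nonneg_left hvv hβ0]

lemma norm_steer_le (τ : Fin L → ℝ) (β : Fin L → ℂ) (k : ParamIdx L) {f : ℝ} (hf : |f| ≤ 1) :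
    ‖steer τ β k f‖ ≤ 1 + 2 * Real.pi * ∑ l, ‖β l‖ := by
  have hB : ∀ l, ‖β l‖ ≤ ∑ l, ‖β l‖ := fun l =>
    Finset.single_le_sum (f := fun l => ‖β l‖) (fun _ _ => norm_nonneg _) (Finset.mem_univ l)
  have hB0 : 0 ≤ ∑ l, ‖β l‖ := by positivity
  have hpi := Real.pi_pos
  rcases k with l | l | l
  · simp only [steer, norm_mul, norm_neg, norm_phase, Complex.norm_I, Complex.norm_real,
      Real.norm_eq_abs, abs_of_pos hpi, Complex.norm_ofNat]
    have h1 : ‖β l‖ * (2 * Real.pi * 1 * |f|) * 1 ≤ (∑ l, ‖β l‖) * (2 * Real.pi * 1 * 1) * 1 := by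
      gcongr; exact hB l
    linarith
  · simp only [steer, norm_phase]; nlinarith [mul_nonneg hpi.le hB0]
  · simp only [steer, norm_mul, norm_phase, Complex.norm_I]; nlinarith [mul_nonneg hpi.le hB0]

lemma abs_quadrature_sub_le (x y : ParamIdx L → ℝ) {f : ℝ} (hf : |f| ≤ 1) :
    |quadrature τ β j x f - quadrature τ β j y f| ≤
      ‖β j‖ * ∑ k, |x k - y k| * (1 + 2 * Real.pi * ∑ l, ‖β l‖) := by
  have h1 : quadrature τ β j x f - quadrature τ β j y f =
      (star (β j * phase (τ j) f) * ∑ k, ((x k - y k : ℝ) : ℂ) * steer τ β k f).im := by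
    rw [quadrature, quadrature, ← Complex.sub_im, ← mul_sub, response, response,
      ← Finset.sum_sub_distrib]
    simp only [Complex.ofReal_sub, sub_mul]
  rw [h1]
  refine (Complex.abs_im_le_norm _).trans ?_
  rw [norm_mul, norm_star, norm_mul, norm_phase, mul_one]
  gcongr
  refine (norm_sum_le _ _).trans (Finset.sum_le_sum fun k _ => ?_)
  rw [norm_mul, Complex.norm_real, Real.norm_eq_abs]
  gcongr
  exact norm_steer_le τ β k hf

lemma freq_mem {N : ℕ} (n : Fin N) : |freq n| ≤ 1 := by
  have h : (0 : ℝ) < N := by exact_mod_cast n.pos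
  rw [freq, abs_of_nonneg (by positivity), div_le_one h]
  exact_mod_cast n.2.le

/-- Otherwise the delay row of gram(f) x would vanish for all f, and so would its integral; but for
this x the integrated row equals one up to normalization. -/
lemma exists_quadrature_ne_zero {τ : Fin L → ℝ} {β : Fin L → ℂ} {σ : ℝ} (hσ : 0 < σ)
    (hτ : Function.Injective τ) (hβ : ∀ l, β l ≠ 0) (j : Fin L) :
    ∃ f, quadrature τ β j ((limGram σ τ β)⁻¹ *ᵥ Pi.single (.inl j) 1) f ≠ 0 := by
  by_contra! h
  have hdet : IsUnit (limGram σ τ β).det :=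
    (Matrix.isUnit_iff_isUnit_det _).1 (limGram_posDef hσ hτ hβ).isUnit
  have h1 := dotProduct_limGram_mulVec σ τ β ((limGram σ τ β)⁻¹ *ᵥ Pi.single (.inl j) 1)
    (Pi.single (.inl j) 1)
  rw [Matrix.mulVec_mulVec, Matrix.mul_nonsing_inv _ hdet] at h1
  simp only [single_dotProduct, gram_mulVec_inl, h] at h1
  simp at h1

-- The limiting quadrature is analytic and nonzero, hence nonzero almost everywhere, so the
-- proportion of grid frequencies where it is small can be made as small as desired.
open Classical in
lemma eventually_card_quadrature_lt {x : ℕ → ParamIdx L → ℝ} {y : ParamIdx L → ℝ}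
    (hx : Tendsto x atTop (𝓝 y)) (hy : ∃ f, quadrature τ β j y f ≠ 0) {a : ℝ} (ha : 0 < a) :
    ∃ η : ℝ, 0 < η ∧ ∀ᶠ N : ℕ in atTop,
      ((Finset.univ.filter fun n : Fin N => |quadrature τ β j (x N) (freq n)| < η).card : ℝ) ≤
        a * N := by
  set q := quadrature τ β j y with hq
  have hqc : Continuous q := continuous_quadrature τ β j y
  -- A continuous majorant of the indicator of |q| ≤ 1/(2m), to which Riemann sums apply; its
  -- integral tends to zero by dominated convergence.
  let u : ℕ → ℝ → ℝ := fun m f => 2 * max 0 (1 - (m : ℝ) * |q f|)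
  have huc : ∀ m, Continuous (u m) := fun m => by fun_prop
  have hae : ∀ᵐ f ∂(volume : Measure ℝ), q f ≠ 0 := by
    obtain ⟨f₀, hf₀⟩ := hy
    have h1 : q ⁻¹' {0}ᶜ ∈ Filter.codiscrete ℝ :=
      AnalyticOnNhd.preimage_zero_mem_codiscrete
        (fun f _ => analyticAt_quadrature τ β j y f) hf₀
    have h2 := ae_restrict_le_codiscreteWithin (μ := (volume : Measure ℝ)) MeasurableSet.univ h1
    rw [Measure.restrict_univ] at h2
    filter_upwards [h2] with f hf
    simpa using hf
  have hlim : Tendsto (fun m => ∫ f in (0 : ℝ)..1, u m f) atTop (𝓝 (∫ _f in (0 : ℝ)..1, (0 : ℝ))) := by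
    refine intervalIntegral.tendsto_integral_filter_of_dominated_convergence (fun _ => 2) ?_ ?_ ?_ ?_
    · exact Eventually.of_forall fun m => (huc m).aestronglyMeasurable
    · refine Eventually.of_forall fun m => Eventually.of_forall fun f _ => ?_
      have h0 : (0 : ℝ) ≤ m * |q f| := by positivity
      have h1 : (0 : ℝ) ≤ max 0 (1 - (m : ℝ) * |q f|) := le_max_left _ _
      have h2 : max 0 (1 - (m : ℝ) * |q f|) ≤ 1 := max_le zero_le_one (by linarith)
      rw [Real.norm_eq_abs, abs_of_nonneg (by positivity)]
      linarith
    · simp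
    · filter_upwards [hae] with f hf _
      refine tendsto_const_nhds.congr' ?_
      obtain ⟨M, hM⟩ := exists_nat_gt (1 / |q f|)
      filter_upwards [eventually_ge_atTop M] with m hm
      have hm' : (M : ℝ) ≤ m := by exact_mod_cast hm
      have hqp : 0 < |q f| := abs_pos.2 hf
      have : 1 ≤ (m : ℝ) * |q f| := by
        rw [div_lt_iff₀ hqp] at hM
        nlinarith
      change (0 : ℝ) = 2 * max 0 (1 - (m : ℝ) * |q f|)
      rw [max_eq_left (by linarith)]
      ring
  rw [intervalIntegral.integral_zero] at hlim
  obtain ⟨m, hm, hm0⟩ := ((hlim.eventually_lt_const ha).and (eventually_gt_atTop 0)).exists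
  have hmpos : (0 : ℝ) < m := by exact_mod_cast hm0
  -- Half of 1/(2m); the other half pays for replacing `x N` by its limit `y`.
  refine ⟨1 / (4 * m), by positivity, ?_⟩
  have hclose : Tendsto (fun N => ‖β j‖ * ∑ k, |x N k - y k| * (1 + 2 * Real.pi * ∑ l, ‖β l‖))
      atTop (𝓝 0) := by
    have : Tendsto (fun N => ‖β j‖ * ∑ k, |x N k - y k| * (1 + 2 * Real.pi * ∑ l, ‖β l‖))
        atTop (𝓝 (‖β j‖ * ∑ _k : ParamIdx L, 0 * (1 + 2 * Real.pi * ∑ l, ‖β l‖))) := by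
      refine (tendsto_finsetSum _ fun k _ => ?_).const_mul _
      have h1 := ((tendsto_pi_nhds.1 hx k).sub_const (y k)).abs
      rw [sub_self, abs_zero] at h1
      exact h1.mul_const _
    simpa using this
  filter_upwards [hclose.eventually_lt_const (by positivity : (0 : ℝ) < 1 / (4 * m)),
    (tendsto_riemannSum (huc m)).eventually_lt_const hm, eventually_gt_atTop 0] with N hN1 hN2 hN0
  have hNpos : (0 : ℝ) < N := by exact_mod_cast hN0
  have hle : ((Finset.univ.filter fun n : Fin N =>
      |quadrature τ β j (x N) (freq n)| < 1 / (4 * m)).card : ℝ) ≤ ∑ n : Fin N, u m (freq n) := by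
    rw [Finset.card_filter]
    push_cast
    refine Finset.sum_le_sum fun n _ => ?_
    split_ifs with h
    · have h1 := (abs_quadrature_sub_le τ β j (x N) y (freq_mem n)).trans_lt hN1
      have h2 : |q (freq n)| < 1 / (2 * m) := by
        have h3 : |q (freq n)| ≤ |quadrature τ β j (x N) (freq n)| +
            |quadrature τ β j (x N) (freq n) - q (freq n)| := by
          have := abs_sub_abs_le_abs_sub (q (freq n)) (quadrature τ β j (x N) (freq n))
          rw [abs_sub_comm] at this
          linarith
        have h4 : 1 / (2 * (m : ℝ)) = 1 / (4 * m) + 1 / (4 * m) := by field_simp; norm_num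
        linarith
      have h5 : (m : ℝ) * |q (freq n)| ≤ 1 / 2 := by
        rw [lt_div_iff₀ (by positivity)] at h2
        linarith
      have h6 := le_max_right 0 (1 - (m : ℝ) * |q (freq n)|)
      change 1 ≤ 2 * max 0 (1 - (m : ℝ) * |q (freq n)|)
      linarith
    · exact mul_nonneg zero_le_two (le_max_left _ _)
  refine hle.trans ?_
  rw [inv_mul_lt_iff₀ hNpos] at hN2
  linarith

end Separation

/-! ### Weighted variances over the spectra of the columns -/

section Variance

variable {N : ℕ} {W : Fin N → Fin N → ℝ}

/-- Unit row sums turn the left side into the sum of the variances of `g` under the columns; each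
variance is half the mean squared difference of two independent draws. -/
lemma sum_sq_sub_sum_mean_sq (hcol : ∀ k, ∑ n, W n k = 1) (hrow : ∀ n, ∑ k, W n k = 1)
    (g : Fin N → ℝ) :
    ∑ n, g n ^ 2 - ∑ k, (∑ n, W n k * g n) ^ 2 =
      1 / 2 * ∑ k, ∑ n, ∑ m, W n k * W m k * (g n - g m) ^ 2 := by
  have h1 : ∀ k, ∑ n, ∑ m, W n k * W m k * (g n - g m) ^ 2 =
      2 * ∑ n, W n k * g n ^ 2 - 2 * (∑ n, W n k * g n) ^ 2 := by
    intro k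
    have h2 : ∀ n, ∑ m, W n k * W m k * (g n - g m) ^ 2 =
        W n k * g n ^ 2 * 1 - 2 * (W n k * g n) * (∑ m, W m k * g m) +
          W n k * ∑ m, W m k * g m ^ 2 := by
      intro n
      rw [← hcol k, Finset.mul_sum, Finset.mul_sum, Finset.mul_sum, ← Finset.sum_sub_distrib,
        ← Finset.sum_add_distrib]
      exact Finset.sum_congr rfl fun m _ => by ring
    simp only [h2, mul_one, Finset.sum_add_distrib, Finset.sum_sub_distrib, ← Finset.sum_mul,
      ← Finset.mul_sum, hcol]
    ring
  simp only [h1, Finset.sum_sub_distrib, ← Finset.mul_sum]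
  rw [Finset.sum_comm]
  simp only [← Finset.sum_mul, hrow]
  ring_nf

-- Each column contributes at least 2a to the mean squared difference of `f`. Discarding the
-- frequencies with small `q` costs at most the mass put on them, which a single column could
-- concentrate there; summed over all columns, though, this mass is only their number, at most `a *
-- N`. Of `2 * a * N` at least `a * N` survives.
open Classical in
lemma weighted_variance_lower_bound (hW : ∀ n k, 0 ≤ W n k) (hcol : ∀ k, ∑ n, W n k = 1)
    (hrow : ∀ n, ∑ k, W n k = 1) {f q : Fin N → ℝ} (hf : ∀ n m, (f n - f m) ^ 2 ≤ 1) {a η : ℝ}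
    (hη : 0 ≤ η) (hspread : ∀ k, a ≤ ∑ n, (f n - ∑ m, f m * W m k) ^ 2 * W n k)
    (hcard : ((Finset.univ.filter fun n => |q n| < η).card : ℝ) ≤ a * N) :
    η ^ 2 * (a * N) ≤ ∑ k, ∑ n, ∑ m, W n k * W m k * ((f n - f m) ^ 2 * q n ^ 2) := by
  have hpt : ∀ n m, η ^ 2 * ((f n - f m) ^ 2 - if |q n| < η then 1 else 0) ≤
      (f n - f m) ^ 2 * q n ^ 2 := by
    intro n m
    split_ifs with h
    · have : (f n - f m) ^ 2 - 1 ≤ 0 := by linarith [hf n m]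
      exact (mul_nonpos_of_nonneg_of_nonpos (sq_nonneg _) this).trans (by positivity)
    · have : η ^ 2 ≤ q n ^ 2 := by
        rw [← sq_abs (q n)]; exact pow_le_pow_left₀ hη (not_lt.1 h) 2
      rw [sub_zero, mul_comm]; gcongr
  have hk : ∀ k, η ^ 2 * (2 * a - ∑ n, W n k * if |q n| < η then 1 else 0) ≤
      ∑ n, ∑ m, W n k * W m k * ((f n - f m) ^ 2 * q n ^ 2) := by
    intro k
    set μ := ∑ m, f m * W m k with hμ
    have hμ' : ∑ m, W m k * f m = μ := by simp only [hμ, mul_comm]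
    have hvar : ∑ n, ∑ m, W n k * W m k * (f n - f m) ^ 2 =
        2 * ∑ n, (f n - μ) ^ 2 * W n k := by
      have h2 : ∀ n, ∑ m, W n k * W m k * (f n - f m) ^ 2 =
          W n k * ((f n - μ) ^ 2 + ∑ m, (f m - μ) ^ 2 * W m k) := by
        intro n
        have h3 : ∑ m, W m k * (f m - μ) = 0 := by
          simp only [mul_sub, Finset.sum_sub_distrib, hμ', ← Finset.sum_mul, hcol]; ring
        calc _ = W n k * ((∑ m, W m k) * (f n - μ) ^ 2 - 2 * (f n - μ) * (∑ m, W m k * (f m - μ)) +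
              ∑ m, (f m - μ) ^ 2 * W m k) := by
              rw [Finset.sum_mul, Finset.mul_sum, ← Finset.sum_sub_distrib,
                ← Finset.sum_add_distrib, Finset.mul_sum]
              exact Finset.sum_congr rfl fun m _ => by ring
          _ = _ := by rw [h3, hcol]; ring
      simp only [h2, mul_add, Finset.sum_add_distrib, ← Finset.sum_mul, hcol]
      rw [two_mul, one_mul]
      congr 1
      exact Finset.sum_congr rfl fun n _ => by ring
    calc _ ≤ η ^ 2 * (∑ n, ∑ m, W n k * W m k * (f n - f m) ^ 2 -
            ∑ n, W n k * if |q n| < η then 1 else 0) := by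
          rw [hvar]; gcongr; exact hspread k
      _ = ∑ n, ∑ m, W n k * W m k * (η ^ 2 * ((f n - f m) ^ 2 - if |q n| < η then 1 else 0)) := by
          rw [← Finset.sum_sub_distrib, Finset.mul_sum]
          refine Finset.sum_congr rfl fun n _ => ?_
          have : (W n k * if |q n| < η then (1 : ℝ) else 0) =
              ∑ m, W n k * W m k * if |q n| < η then (1 : ℝ) else 0 := by
            rw [← Finset.sum_mul, ← Finset.mul_sum, hcol, mul_one]
          rw [this, ← Finset.sum_sub_distrib, Finset.mul_sum]
          exact Finset.sum_congr rfl fun m _ => by ring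
      _ ≤ _ := by
          refine Finset.sum_le_sum fun n _ => Finset.sum_le_sum fun m _ => ?_
          exact mul_le_mul_of_nonneg_left (hpt n m) (mul_nonneg (hW n k) (hW m k))
  refine le_trans ?_ (Finset.sum_le_sum fun k _ => hk k)
  rw [← Finset.mul_sum, Finset.sum_sub_distrib, Finset.sum_comm]
  simp only [← Finset.sum_mul, hrow, one_mul, Finset.sum_const, Finset.card_univ, Fintype.card_fin,
    nsmul_eq_mul]
  have hc : (∑ n, if |q n| < η then (1 : ℝ) else 0) =
      ((Finset.univ.filter fun n => |q n| < η).card : ℝ) := by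
    rw [Finset.card_filter]; push_cast; rfl
  rw [hc]
  gcongr
  linarith

end Variance

/-! ### The second-order gap -/

section Gap

open Filter Topology

variable {L : ℕ}

/-- Inverse of the expected Fisher information matrix `J̄ = N • meanGram`. -/
def precision (σ : ℝ) (τ : Fin L → ℝ) (β : Fin L → ℂ) (N : ℕ) :
    Matrix (ParamIdx L) (ParamIdx L) ℝ :=
  (N : ℝ)⁻¹ • (meanGram σ τ β N)⁻¹

lemma exists_variance_gap {σ : ℝ} (hσ : 0 < σ) {τ : Fin L → ℝ} {β : Fin L → ℂ}
    (hτ : Function.Injective τ) (hβ : ∀ l, β l ≠ 0) (j : Fin L) {a : ℝ} (ha : 0 < a) :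
    ∃ c : ℝ, 0 < c ∧ ∀ᶠ N : ℕ in atTop, ∀ W : Fin N → Fin N → ℝ, (∀ n k, 0 ≤ W n k) →
      (∀ k, ∑ n, W n k = 1) → (∀ n, ∑ k, W n k = 1) →
      (∀ k, a ≤ ∑ n, (freq n - ∑ m, freq m * W m k) ^ 2 * W n k) →
      c / (N : ℝ) ^ 2 ≤ ∑ k, ∑ n, ∑ m, W n k * W m k *
        ((gram τ β (freq n) *ᵥ (precision σ τ β N *ᵥ Pi.single (.inl j) 1) -
          gram τ β (freq m) *ᵥ (precision σ τ β N *ᵥ Pi.single (.inl j) 1)) ⬝ᵥ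
        (precision σ τ β N *ᵥ
          (gram τ β (freq n) *ᵥ (precision σ τ β N *ᵥ Pi.single (.inl j) 1) -
            gram τ β (freq m) *ᵥ (precision σ τ β N *ᵥ Pi.single (.inl j) 1)))) := by
  have hpd := limGram_posDef hσ hτ hβ
  have hinv := tendsto_matrix_inv hpd (tendsto_meanGram σ τ β)
  obtain ⟨c, hc, hlow⟩ := eventually_lower_bound hpd.inv hinv
  have hx : Tendsto (fun N => (meanGram σ τ β N)⁻¹ *ᵥ (Pi.single (.inl j) 1 : ParamIdx L → ℝ)) atTop
      (𝓝 ((limGram σ τ β)⁻¹ *ᵥ Pi.single (.inl j) 1)) := by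
    have hcont : Continuous fun M : Matrix (ParamIdx L) (ParamIdx L) ℝ =>
      M *ᵥ (Pi.single (.inl j) 1 : ParamIdx L → ℝ) := by fun_prop
    exact (hcont.tendsto _).comp hinv
  obtain ⟨η, hη, hcard⟩ := eventually_card_quadrature_lt τ β j hx
    (exists_quadrature_ne_zero hσ hτ hβ j) ha
  set B : ℝ := 2 * (1 + ‖β j‖ ^ 2) with hB
  have hBpos : 0 < B := by positivity
  refine ⟨c / B * (η ^ 2 * a), by positivity, ?_⟩
  filter_upwards [hlow, hcard, eventually_gt_atTop 0] with N hN1 hN2 hN0 W hW hcol hrow hspread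
  have hNpos : (0 : ℝ) < N := by exact_mod_cast hN0
  set x := (meanGram σ τ β N)⁻¹ *ᵥ (Pi.single (.inl j) 1 : ParamIdx L → ℝ) with hxdef
  have hpx : precision σ τ β N *ᵥ (Pi.single (.inl j) 1 : ParamIdx L → ℝ) = (N : ℝ)⁻¹ • x := by
    rw [precision, Matrix.smul_mulVec]
  have hmain := weighted_variance_lower_bound hW hcol hrow (f := freq)
    (q := fun n => quadrature τ β j x (freq n)) ?_ hη.le hspread hN2
  -- The power N⁻³ comes from the outer precision and from one factor N⁻¹ in each copy of the delay
  -- column.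
  · have hterm : ∀ n m : Fin N, c / B * ((N : ℝ) ^ 3)⁻¹ *
        ((freq n - freq m) ^ 2 * quadrature τ β j x (freq n) ^ 2) ≤
        (gram τ β (freq n) *ᵥ ((N : ℝ)⁻¹ • x) - gram τ β (freq m) *ᵥ ((N : ℝ)⁻¹ • x)) ⬝ᵥ
        (precision σ τ β N *ᵥ (gram τ β (freq n) *ᵥ ((N : ℝ)⁻¹ • x) -
          gram τ β (freq m) *ᵥ ((N : ℝ)⁻¹ • x))) := by
      intro n m
      rw [precision, Matrix.mulVec_smul, Matrix.mulVec_smul, ← smul_sub, Matrix.smul_mulVec,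
        Matrix.mulVec_smul, smul_dotProduct, dotProduct_smul, dotProduct_smul]
      simp only [smul_eq_mul]
      have h1 := quadrature_separation τ β j x (f := freq n) (g := freq m) (freq_mem m)
      have h2 := hN1 (gram τ β (freq n) *ᵥ x - gram τ β (freq m) *ᵥ x)
      rw [← hB] at h1
      have h3 : c / B * ((freq n - freq m) ^ 2 * quadrature τ β j x (freq n) ^ 2) ≤
          (gram τ β (freq n) *ᵥ x - gram τ β (freq m) *ᵥ x) ⬝ᵥ
            ((meanGram σ τ β N)⁻¹ *ᵥ (gram τ β (freq n) *ᵥ x - gram τ β (freq m) *ᵥ x)) := by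
        refine le_trans ?_ h2
        rw [div_mul_eq_mul_div, div_le_iff₀ hBpos]
        nlinarith
      calc _ = ((N : ℝ) ^ 3)⁻¹ *
            (c / B * ((freq n - freq m) ^ 2 * quadrature τ β j x (freq n) ^ 2)) := by ring
        _ ≤ ((N : ℝ) ^ 3)⁻¹ * _ := mul_le_mul_of_nonneg_left h3 (by positivity)
        _ = _ := by ring
    rw [hpx]
    calc _ = c / B * ((N : ℝ) ^ 3)⁻¹ * (η ^ 2 * (a * N)) := by field_simp
      _ ≤ c / B * ((N : ℝ) ^ 3)⁻¹ * _ := mul_le_mul_of_nonneg_left hmain (by positivity)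
      _ ≤ _ := by
        simp only [Finset.mul_sum]
        refine Finset.sum_le_sum fun k _ => Finset.sum_le_sum fun n _ =>
          Finset.sum_le_sum fun m _ => ?_
        rw [mul_left_comm]
        exact mul_le_mul_of_nonneg_left (hterm n m) (mul_nonneg (hW n k) (hW m k))
  · intro n m
    have hn0 : 0 ≤ freq n := div_nonneg (Nat.cast_nonneg _) (Nat.cast_nonneg _)
    have hm0 : 0 ≤ freq m := div_nonneg (Nat.cast_nonneg _) (Nat.cast_nonneg _)
    have hn1 := (abs_le.1 (freq_mem n)).2
    have hm1 := (abs_le.1 (freq_mem m)).2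
    rw [← sq_abs]
    exact pow_le_one₀ (abs_nonneg _) (abs_le.2 ⟨by linarith, by linarith⟩)

end Gap

/-! ### Matrix perturbation estimates in the spectral norm -/

section Perturbation

open scoped Matrix.Norms.L2Operator

variable {ι : Type} [Fintype ι] [DecidableEq ι]

lemma spectralNorm_eq_norm (A : Matrix ι ι ℝ) : spectralNorm A = ‖A‖ := rfl

lemma exists_norm_pow_four_le (ι : Type) [Fintype ι] [DecidableEq ι] :
    ∃ D : ℝ, 0 < D ∧ ∀ A : Matrix ι ι ℝ, ‖A‖ ^ 4 ≤ D * ∑ i, ∑ j, A i j ^ 4 := by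
  set e : ℝ := 1 + ∑ i : ι, ∑ j : ι, ‖(Matrix.single i j 1 : Matrix ι ι ℝ)‖ with he
  have he0 : 0 < e := by positivity
  have hle : ∀ i j, ‖(Matrix.single i j 1 : Matrix ι ι ℝ)‖ ≤ e := by
    intro i j
    have h1 : ‖(Matrix.single i j 1 : Matrix ι ι ℝ)‖ ≤
        ∑ j : ι, ‖(Matrix.single i j 1 : Matrix ι ι ℝ)‖ :=
      Finset.single_le_sum (f := fun j => ‖(Matrix.single i j 1 : Matrix ι ι ℝ)‖)
        (fun _ _ => norm_nonneg _) (Finset.mem_univ j)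
    have h2 : ∑ j : ι, ‖(Matrix.single i j 1 : Matrix ι ι ℝ)‖ ≤
        ∑ i : ι, ∑ j : ι, ‖(Matrix.single i j 1 : Matrix ι ι ℝ)‖ :=
      Finset.single_le_sum (f := fun i => ∑ j : ι, ‖(Matrix.single i j 1 : Matrix ι ι ℝ)‖)
        (fun _ _ => Finset.sum_nonneg fun _ _ => norm_nonneg _) (Finset.mem_univ i)
    linarith
  refine ⟨(1 + (Fintype.card (ι × ι) : ℝ) ^ 3) * e ^ 4, by positivity, fun A => ?_⟩
  have h1 : ‖A‖ ≤ e * ∑ p : ι × ι, |A p.1 p.2| := by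
    conv_lhs => rw [Matrix.matrix_eq_sum_single A]
    rw [Fintype.sum_prod_type, Finset.mul_sum]
    refine (norm_sum_le _ _).trans (Finset.sum_le_sum fun i _ => ?_)
    rw [Finset.mul_sum]
    refine (norm_sum_le _ _).trans (Finset.sum_le_sum fun j _ => ?_)
    have : Matrix.single i j (A i j) = A i j • (Matrix.single i j 1 : Matrix ι ι ℝ) := by
      rw [Matrix.smul_single, smul_eq_mul, mul_one]
    rw [this, norm_smul, Real.norm_eq_abs, mul_comm]
    gcongr
    exact hle i j
  have h2 : (∑ p : ι × ι, |A p.1 p.2|) ^ 4 ≤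
      (Fintype.card (ι × ι) : ℝ) ^ 3 * ∑ p : ι × ι, |A p.1 p.2| ^ 4 := by
    have := pow_sum_le_card_mul_sum_pow (s := (Finset.univ : Finset (ι × ι)))
      (f := fun p => |A p.1 p.2|) (fun _ _ => abs_nonneg _) 3
    simpa using this
  have h3 : ∑ p : ι × ι, |A p.1 p.2| ^ 4 = ∑ i, ∑ j, A i j ^ 4 := by
    rw [Fintype.sum_prod_type]
    simp only [(by decide : Even 4).pow_abs]
  have h4 : 0 ≤ ∑ i, ∑ j, A i j ^ 4 :=
    Finset.sum_nonneg fun i _ => Finset.sum_nonneg fun j _ => by positivity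
  calc ‖A‖ ^ 4 ≤ (e * ∑ p : ι × ι, |A p.1 p.2|) ^ 4 := by gcongr
    _ = e ^ 4 * (∑ p : ι × ι, |A p.1 p.2|) ^ 4 := by ring
    _ ≤ e ^ 4 * ((Fintype.card (ι × ι) : ℝ) ^ 3 * ∑ i, ∑ j, A i j ^ 4) := by rw [← h3]; gcongr
    _ ≤ _ := by nlinarith [mul_nonneg (pow_nonneg he0.le 4) h4]

/-- Coercivity and Cauchy–Schwarz, as in Lax–Milgram; symmetry is not needed. -/
lemma norm_inv_le_of_lower_bound {J : Matrix ι ι ℝ} {c : ℝ} (hc : 0 < c)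
    (h : ∀ x : ι → ℝ, c * (x ⬝ᵥ x) ≤ x ⬝ᵥ (J *ᵥ x)) : IsUnit J ∧ ‖J⁻¹‖ ≤ c⁻¹ := by
  have hinj : Function.Injective (J.mulVec) := by
    intro x y hxy
    have h1 := h (x - y)
    rw [Matrix.mulVec_sub, hxy, sub_self, dotProduct_zero] at h1
    have h2 : 0 ≤ (x - y) ⬝ᵥ (x - y) := by simpa using dotProduct_star_self_nonneg (x - y)
    have h3 : (x - y) ⬝ᵥ (x - y) = 0 := by nlinarith
    exact sub_eq_zero.1 (dotProduct_self_eq_zero.1 h3)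
  have hJ : IsUnit J := Matrix.mulVec_injective_iff_isUnit.1 hinj
  refine ⟨hJ, ?_⟩
  rw [Matrix.cstar_norm_def]
  refine ContinuousLinearMap.opNorm_le_bound _ (by positivity) fun v => ?_
  set y := Matrix.toEuclideanCLM (n := ι) (𝕜 := ℝ) J⁻¹ v with hy
  have hyv : y.ofLp = J⁻¹ *ᵥ v.ofLp := by rw [hy, Matrix.ofLp_toEuclideanCLM]
  have h1 := h y.ofLp
  have hJy : J *ᵥ y.ofLp = v.ofLp := by
    rw [hyv, Matrix.mulVec_mulVec, Matrix.mul_nonsing_inv _ ((Matrix.isUnit_iff_isUnit_det _).1 hJ),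
      Matrix.one_mulVec]
  rw [hJy] at h1
  have hin : ∀ a b : EuclideanSpace ℝ ι, a.ofLp ⬝ᵥ b.ofLp = inner ℝ a b := by
    intro a b
    rw [EuclideanSpace.inner_eq_star_dotProduct, star_trivial, dotProduct_comm]
  rw [hin, hin, real_inner_self_eq_norm_sq] at h1
  have h2 := real_inner_le_norm y v
  rcases eq_or_lt_of_le (norm_nonneg y) with h0 | h0
  · rw [← h0]; positivity
  · rw [inv_mul_eq_div, le_div_iff₀ hc]
    nlinarith

lemma norm_inv_le_of_norm_lt_one {J M P : Matrix ι ι ℝ} (hMP : M * P = 1) {ρ : ℝ} (hρ : ρ < 1)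
    (h : ‖P * (J - M)‖ < ρ) : IsUnit J ∧ ‖J⁻¹‖ ≤ ‖P‖ / (1 - ρ) := by
  have hPM : P * M = 1 := mul_eq_one_comm.1 hMP
  set Z := P * (J - M) with hZ
  have hJ : J = M * (1 - -Z) := by
    rw [sub_neg_eq_add, mul_add, mul_one, hZ, ← mul_assoc, hMP, one_mul]; abel
  have hM : IsUnit M := ⟨⟨M, P, hMP, hPM⟩, rfl⟩
  have hu : IsUnit (1 - -Z) := isUnit_one_sub_of_norm_lt_one (by rw [norm_neg]; linarith)
  have hJu : IsUnit J := hJ ▸ hM.mul hu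
  refine ⟨hJu, ?_⟩
  have hJJ : J * J⁻¹ = 1 := Matrix.mul_nonsing_inv _ ((Matrix.isUnit_iff_isUnit_det _).1 hJu)
  have h1 : J⁻¹ = P - Z * J⁻¹ := by
    rw [hZ, mul_sub, hPM, sub_mul, mul_assoc, hJJ, mul_one, one_mul]; abel
  have h2 : ‖J⁻¹‖ ≤ ‖P‖ + ρ * ‖J⁻¹‖ := by
    calc ‖J⁻¹‖ = ‖P - Z * J⁻¹‖ := by rw [← h1]
      _ ≤ ‖P‖ + ‖Z * J⁻¹‖ := norm_sub_le _ _
      _ ≤ ‖P‖ + ρ * ‖J⁻¹‖ := by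
        have := norm_mul_le Z J⁻¹
        have : ‖Z‖ * ‖J⁻¹‖ ≤ ρ * ‖J⁻¹‖ := by gcongr
        linarith
  rw [le_div_iff₀ (by linarith)]
  linarith

/-- The identity J⁻¹ = P - Z J⁻¹ iterated three times. The remainder is exact, so smallness of Z is
not needed, only invertibility of J. -/
lemma inv_eq_neumann {J M P : Matrix ι ι ℝ} (hMP : M * P = 1) (hJ : IsUnit J) :
    J⁻¹ = P - P * (J - M) * P + P * (J - M) * (P * (J - M)) * P -
      P * (J - M) * (P * (J - M)) * (P * (J - M)) * J⁻¹ := by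
  have hPM : P * M = 1 := mul_eq_one_comm.1 hMP
  have hJJ : J * J⁻¹ = 1 := Matrix.mul_nonsing_inv _ ((Matrix.isUnit_iff_isUnit_det _).1 hJ)
  have hZ : P * (J - M) = P * J - 1 := by rw [mul_sub, hPM]
  have h1 : P * (J - M) * J⁻¹ = P - J⁻¹ := by
    rw [hZ, sub_mul, mul_assoc, hJJ, mul_one, one_mul]
  set Z := P * (J - M)
  rw [mul_assoc (Z * Z), h1, mul_sub, mul_assoc Z Z J⁻¹, h1, mul_sub, h1]
  abel

end Perturbation

/-! ### Expansion of a conditional expectation -/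

section Conditional

variable {S : Finset ℂ} {N : ℕ}

/-- Since `f₁` has mean zero, restricting it to `A` leaves only minus its average over the
complement. That average, its analogue for `f₂`, the cubic remainder and the normalization are all
bounded through the fourth moment of `z` and the probability of the complement. The free `ε` of
Young's inequality replaces half-integer powers of `N`. -/
lemma cond_expansion (hS : S.Nonempty) (hN : 0 < N) (A : Set (Fin N → ℂ))
    {f f₁ f₂ z : (Fin N → ℂ) → ℝ} {f₀ C ε : ℝ} (hC : 0 < C) (hε : 0 < ε) (hz : ∀ s, 0 ≤ z s)
    (hz4 : vecAvg S N (fun s => z s ^ 4) ≤ C / (N : ℝ) ^ 2)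
    (hA : vecAvg S N (Aᶜ.indicator fun _ => (1 : ℝ)) ≤ C / (N : ℝ) ^ 2)
    (hCN : C / (N : ℝ) ^ 2 ≤ 1 / 2)
    (hf : ∀ s, (∀ i, s i ∈ S) → s ∈ A → |f s - (f₀ - f₁ s + f₂ s)| ≤ C / N * z s ^ 3)
    (hf1 : ∀ s, |f₁ s| ≤ C / N * z s) (hf2 : ∀ s, |f₂ s| ≤ C / N * z s ^ 2)
    (hf1m : vecAvg S N f₁ = 0) :
    |(vecAvg S N (A.indicator fun _ => (1 : ℝ)))⁻¹ * vecAvg S N (A.indicator f) - f₀ -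
      vecAvg S N f₂| ≤
      2 * (C * (C + 1) / (N : ℝ) ^ 2 * (2 * ε + 2 / (ε * N) + (C + 1) / N)) := by
  have hNpos : (0 : ℝ) < N := by exact_mod_cast hN
  have hN1 : (1 : ℝ) ≤ N := by exact_mod_cast hN
  set a : (Fin N → ℂ) → ℝ := A.indicator fun _ => (1 : ℝ) with ha
  set b : (Fin N → ℂ) → ℝ := Aᶜ.indicator fun _ => (1 : ℝ) with hb
  have hab : ∀ s, a s + b s = 1 := by
    intro s; by_cases h : s ∈ A <;> simp [ha, hb, h]
  have hb01 : ∀ s, b s = 0 ∨ b s = 1 := by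
    intro s; by_cases h : s ∈ A <;> simp [hb, h]
  have hpab : vecAvg S N a + vecAvg S N b = 1 := by
    rw [← vecAvg_add]; simp only [hab]; exact vecAvg_const _ hS _
  set p := vecAvg S N a with hp
  have hp2 : 1 / 2 ≤ p := by linarith
  have hb0 : 0 ≤ vecAvg S N b := vecAvg_nonneg S fun s => by rcases hb01 s with h | h <;> simp [h]
  have hz2 : vecAvg S N (fun s => z s ^ 2) ≤ (C + 1) / N := by
    have h1 : vecAvg S N (fun s => z s ^ 2) ≤
        -- The weight N balances the two terms, both then being of order 1/N.
        vecAvg S N (fun s => N * z s ^ 4 + (N : ℝ)⁻¹) := by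
      refine vecAvg_mono S fun s _ => ?_
      have : 0 ≤ (N : ℝ) * (z s ^ 2 - (N : ℝ)⁻¹) ^ 2 := by positivity
      have e : (N : ℝ) * (z s ^ 2 - (N : ℝ)⁻¹) ^ 2 = N * z s ^ 4 - 2 * z s ^ 2 + (N : ℝ)⁻¹ := by
        field_simp
        ring
      nlinarith [sq_nonneg (z s)]
    rw [vecAvg_add, vecAvg_mul_left, vecAvg_const _ hS] at h1
    refine h1.trans ?_
    have : (N : ℝ) * vecAvg S N (fun s => z s ^ 4) ≤ N * (C / (N : ℝ) ^ 2) := by gcongr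
    have e : (N : ℝ) * (C / (N : ℝ) ^ 2) + (N : ℝ)⁻¹ = (C + 1) / N := by field_simp
    linarith
  have hz3 : vecAvg S N (fun s => z s ^ 3) ≤ ε * ((C + 1) / N) + (C / (N : ℝ) ^ 2) / ε := by
    have h1 : vecAvg S N (fun s => z s ^ 3) ≤
        vecAvg S N (fun s => ε * z s ^ 2 + ε⁻¹ * z s ^ 4) := by
      refine vecAvg_mono S fun s _ => ?_
      have : 0 ≤ ε⁻¹ * (ε * z s - z s ^ 2) ^ 2 := by positivity
      have e : ε⁻¹ * (ε * z s - z s ^ 2) ^ 2 = ε * z s ^ 2 - 2 * z s ^ 3 + ε⁻¹ * z s ^ 4 := by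
        field_simp
        ring
      nlinarith [pow_nonneg (hz s) 3]
    rw [vecAvg_add, vecAvg_mul_left, vecAvg_mul_left] at h1
    refine h1.trans ?_
    rw [div_eq_inv_mul _ ε]
    gcongr
  have hbz : vecAvg S N (fun s => b s * z s) ≤ ε * ((C + 1) / N) + (C / (N : ℝ) ^ 2) / ε := by
    have h1 : vecAvg S N (fun s => b s * z s) ≤
        vecAvg S N (fun s => ε * z s ^ 2 + ε⁻¹ * b s) := by
      refine vecAvg_mono S fun s _ => ?_
      have : 0 ≤ ε⁻¹ * (ε * z s - b s) ^ 2 := by positivity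
      have e : ε⁻¹ * (ε * z s - b s) ^ 2 = ε * z s ^ 2 - 2 * (b s * z s) + ε⁻¹ * b s ^ 2 := by
        field_simp
        ring
      have hbb : b s ^ 2 = b s := by rcases hb01 s with h | h <;> simp [h]
      have : 0 ≤ b s * z s := mul_nonneg (by rcases hb01 s with h | h <;> simp [h]) (hz s)
      rw [hbb] at e
      nlinarith
    rw [vecAvg_add, vecAvg_mul_left, vecAvg_mul_left] at h1
    refine h1.trans ?_
    rw [div_eq_inv_mul _ ε]
    gcongr
  have hbz2 : vecAvg S N (fun s => b s * z s ^ 2) ≤ C / (N : ℝ) ^ 2 := by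
    have h1 : vecAvg S N (fun s => b s * z s ^ 2) ≤
        vecAvg S N (fun s => (1 / 2) * z s ^ 4 + (1 / 2) * b s) := by
      refine vecAvg_mono S fun s _ => ?_
      have hbb : b s ^ 2 = b s := by rcases hb01 s with h | h <;> simp [h]
      nlinarith [sq_nonneg (b s - z s ^ 2)]
    rw [vecAvg_add, vecAvg_mul_left, vecAvg_mul_left] at h1
    linarith
  set Rf : (Fin N → ℂ) → ℝ := fun s => a s * (f s - (f₀ - f₁ s + f₂ s)) with hRf
  have hdecomp : vecAvg S N (A.indicator f) =
      f₀ * p + vecAvg S N (fun s => b s * f₁ s) + (vecAvg S N f₂ - vecAvg S N (fun s => b s * f₂ s))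
        + vecAvg S N Rf := by
    have h1 : ∀ s, A.indicator f s =
        f₀ * a s + (b s * f₁ s - f₁ s) + (f₂ s - b s * f₂ s) + Rf s := by
      intro s
      have h2 : A.indicator f s = a s * f s := by by_cases h : s ∈ A <;> simp [ha, h]
      have h3 : b s = 1 - a s := by linarith [hab s]
      rw [h2, hRf, h3]; ring
    rw [show A.indicator f = fun s => f₀ * a s + (b s * f₁ s - f₁ s) + (f₂ s - b s * f₂ s) + Rf s
      from funext h1, vecAvg_add, vecAvg_add, vecAvg_add, vecAvg_sub, vecAvg_sub, vecAvg_mul_left,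
      hf1m, sub_zero]
  set D := vecAvg S N f₂ with hD
  have hCN0 : 0 ≤ C / N := by positivity
  have t1 : |vecAvg S N (fun s => b s * f₁ s)| ≤
      C / N * (ε * ((C + 1) / N) + (C / (N : ℝ) ^ 2) / ε) := by
    refine (abs_vecAvg_le S _).trans ?_
    refine (vecAvg_mono S (g := fun s => C / N * (b s * z s)) fun s _ => ?_).trans ?_
    · rcases hb01 s with h | h
      · simp [h]
      · simpa [h] using hf1 s
    · rw [vecAvg_mul_left]; gcongr
  have t2 : |vecAvg S N (fun s => b s * f₂ s)| ≤ C / N * (C / (N : ℝ) ^ 2) := by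
    refine (abs_vecAvg_le S _).trans ?_
    refine (vecAvg_mono S (g := fun s => C / N * (b s * z s ^ 2)) fun s _ => ?_).trans ?_
    · rcases hb01 s with h | h
      · simp [h]
      · simpa [h] using hf2 s
    · rw [vecAvg_mul_left]; gcongr
  have t3 : |vecAvg S N Rf| ≤ C / N * (ε * ((C + 1) / N) + (C / (N : ℝ) ^ 2) / ε) := by
    refine (abs_vecAvg_le S _).trans ?_
    refine (vecAvg_mono S (g := fun s => C / N * z s ^ 3) fun s hs => ?_).trans ?_
    · by_cases h : s ∈ A
      · simpa [hRf, ha, h] using hf s hs h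
      · have := pow_nonneg (hz s) 3
        simp only [hRf, ha, h, Set.indicator_of_notMem, not_false_eq_true, zero_mul, abs_zero]
        positivity
    · rw [vecAvg_mul_left]; gcongr
  have t4 : |D| ≤ C / N * ((C + 1) / N) := by
    refine (abs_vecAvg_le S _).trans ?_
    refine (vecAvg_mono S (g := fun s => C / N * z s ^ 2) fun s _ => hf2 s).trans ?_
    rw [vecAvg_mul_left]; gcongr
  have t5 : |vecAvg S N b * D| ≤ C / (N : ℝ) ^ 2 * (C / N * ((C + 1) / N)) := by
    rw [abs_mul, abs_of_nonneg hb0]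
    gcongr
  have hpb : p = 1 - vecAvg S N b := by linarith
  have hid : p⁻¹ * vecAvg S N (A.indicator f) - f₀ - D =
      p⁻¹ * (vecAvg S N (fun s => b s * f₁ s) - vecAvg S N (fun s => b s * f₂ s) + vecAvg S N Rf +
        vecAvg S N b * D) := by
    rw [hdecomp]
    have : p ≠ 0 := by linarith
    field_simp
    rw [hpb]; ring
  rw [hid, abs_mul, abs_inv, abs_of_pos (by linarith : 0 < p)]
  have hsum : |vecAvg S N (fun s => b s * f₁ s) - vecAvg S N (fun s => b s * f₂ s) + vecAvg S N Rf +
        vecAvg S N b * D| ≤ C * (C + 1) / (N : ℝ) ^ 2 * (2 * ε + 2 / (ε * N) + (C + 1) / N) := by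
    have h1 : |vecAvg S N (fun s => b s * f₁ s) - vecAvg S N (fun s => b s * f₂ s) + vecAvg S N Rf +
        vecAvg S N b * D| ≤ |vecAvg S N (fun s => b s * f₁ s)| + |vecAvg S N (fun s => b s * f₂ s)| +
          |vecAvg S N Rf| + |vecAvg S N b * D| :=
      (abs_add_le _ _).trans (add_le_add_left ((abs_add_le _ _).trans
        (add_le_add_left (abs_sub _ _) _)) _)
    have h2 : C / N * (ε * ((C + 1) / N) + (C / (N : ℝ) ^ 2) / ε) ≤
        C * (C + 1) / (N : ℝ) ^ 2 * (ε + 1 / (ε * N)) := by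
      have : C / N * (ε * ((C + 1) / N) + (C / (N : ℝ) ^ 2) / ε) =
        C / (N : ℝ) ^ 2 * ((C + 1) * ε + C * (1 / (ε * N))) := by field_simp
      rw [this]
      have e : C * (C + 1) / (N : ℝ) ^ 2 * (ε + 1 / (ε * N)) =
        C / (N : ℝ) ^ 2 * ((C + 1) * ε + (C + 1) * (1 / (ε * N))) := by ring
      rw [e]
      gcongr
      linarith
    have h3 : C / N * (C / (N : ℝ) ^ 2) ≤ C * (C + 1) / (N : ℝ) ^ 2 * (1 / N) := by
      have : C / N * (C / (N : ℝ) ^ 2) = C * C / (N : ℝ) ^ 2 * (1 / N) := by field_simp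
      rw [this]
      gcongr
      linarith
    have h4 : C / (N : ℝ) ^ 2 * (C / N * ((C + 1) / N)) ≤ C * (C + 1) / (N : ℝ) ^ 2 * (C / N) := by
      have : C / (N : ℝ) ^ 2 * (C / N * ((C + 1) / N)) =
        C * (C + 1) / (N : ℝ) ^ 2 * (C / N ^ 2) := by field_simp
      rw [this]
      gcongr
      nlinarith
    calc _ ≤ _ := h1
      _ ≤ C * (C + 1) / (N : ℝ) ^ 2 * (ε + 1 / (ε * N)) + C * (C + 1) / (N : ℝ) ^ 2 * (1 / N) +
          C * (C + 1) / (N : ℝ) ^ 2 * (ε + 1 / (ε * N)) + C * (C + 1) / (N : ℝ) ^ 2 * (C / N) := by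
          linarith
      _ = _ := by ring
  have hpinv : p⁻¹ ≤ 2 := by
    rw [inv_le_comm₀ (by linarith) (by norm_num)]; linarith
  exact mul_le_mul hpinv hsum (abs_nonneg _) (by norm_num)

end Conditional

/-! ### Statistics of the Fisher information matrix -/

section Statistics

open Filter Topology
open scoped Matrix.Norms.L2Operator

variable {S : Finset ℂ} {κ K : ℝ} {N L : ℕ} {σ : ℝ} {τ : Fin L → ℝ} {β : Fin L → ℂ}
  {U : Matrix (Fin N) (Fin N) ℂ}

lemma dft_mul_mem_unitaryGroup (hN : N ≠ 0) (hU : U ∈ Matrix.unitaryGroup (Fin N) ℂ) :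
    dft N * U ∈ Matrix.unitaryGroup (Fin N) ℂ :=
  mul_mem (dft_mem_unitaryGroup hN) hU

lemma ofdm_mem_unitaryGroup (hN : N ≠ 0) : ofdm N ∈ Matrix.unitaryGroup (Fin N) ℂ :=
  Unitary.star_mem (dft_mem_unitaryGroup hN)

lemma dft_mul_ofdm (hN : N ≠ 0) : dft N * ofdm N = 1 :=
  Matrix.mem_unitaryGroup_iff.1 (dft_mem_unitaryGroup hN)

/-- Unit mean energy at each frequency makes the expected information independent of the waveform,
so different waveforms are expanded about the same point. -/
lemma IsNormalized.meanFim_eq (h : IsNormalized S κ K) (hN : N ≠ 0)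
    (hU : U ∈ Matrix.unitaryGroup (Fin N) ℂ) :
    meanFim S σ (params τ β) U = (N : ℝ) • meanGram σ τ β N := by
  have hNr : (N : ℝ) ≠ 0 := by exact_mod_cast hN
  ext k l
  rw [meanFim, Matrix.of_apply, integral_vectorLaw h.nonempty]
  simp only [fim_apply hN]
  rw [vecAvg_mul_left, vecAvg_sum, Matrix.smul_apply, meanGram, Matrix.of_apply, smul_eq_mul]
  simp only [vecAvg_mul_left, h.vecAvg_energy (dft_mul_mem_unitaryGroup hN hU), mul_one]
  field_simp

lemma fim_sub_eq_sum (hN : N ≠ 0) (s : Fin N → ℂ) :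
    fim σ (params τ β) U s - (N : ℝ) • meanGram σ τ β N =
      ∑ n, (2 / σ ^ 2 * (‖((dft N * U) *ᵥ s) n‖ ^ 2 - 1)) • gram τ β (freq n) := by
  have hNr : (N : ℝ) ≠ 0 := by exact_mod_cast hN
  ext k l
  rw [Matrix.sub_apply, fim_apply hN, Matrix.smul_apply, meanGram, Matrix.of_apply, smul_eq_mul,
    Matrix.sum_apply]
  simp only [Matrix.smul_apply, smul_eq_mul]
  have : (N : ℝ) * (2 / σ ^ 2 * ((N : ℝ)⁻¹ * ∑ n : Fin N, gram τ β (freq n) k l)) =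
      2 / σ ^ 2 * ∑ n : Fin N, gram τ β (freq n) k l := by field_simp
  rw [this, ← mul_sub, ← Finset.sum_sub_distrib, Finset.mul_sum]
  exact Finset.sum_congr rfl fun n _ => by ring

lemma fim_sub_apply (hN : N ≠ 0) (s : Fin N → ℂ) (k l : ParamIdx L) :
    (fim σ (params τ β) U s - (N : ℝ) • meanGram σ τ β N) k l =
      specForm (dft N * U) (fun n => 2 / σ ^ 2 * gram τ β (freq n) k l) s := by
  rw [fim_sub_eq_sum hN, Matrix.sum_apply, specForm]
  exact Finset.sum_congr rfl fun n _ => by rw [Matrix.smul_apply, smul_eq_mul]; ring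

lemma fim_sub_mulVec (hN : N ≠ 0) (s : Fin N → ℂ) (R : Matrix (ParamIdx L) (ParamIdx L) ℝ)
    (a : ParamIdx L → ℝ) (i : ParamIdx L) :
    (R *ᵥ ((fim σ (params τ β) U s - (N : ℝ) • meanGram σ τ β N) *ᵥ a)) i =
      specForm (dft N * U) (fun n => 2 / σ ^ 2 * (R *ᵥ (gram τ β (freq n) *ᵥ a)) i) s := by
  rw [fim_sub_eq_sum hN, Matrix.sum_mulVec, Matrix.mulVec_sum, Finset.sum_apply, specForm]
  refine Finset.sum_congr rfl fun n _ => ?_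
  rw [Matrix.smul_mulVec, Matrix.mulVec_smul, Pi.smul_apply, smul_eq_mul]
  ring

lemma fim_sub_isSymm (hN : N ≠ 0) (s : Fin N → ℂ) :
    (fim σ (params τ β) U s - (N : ℝ) • meanGram σ τ β N).IsSymm := by
  rw [fim_sub_eq_sum hN, Matrix.IsSymm, Matrix.transpose_sum]
  exact Finset.sum_congr rfl fun n _ => by rw [Matrix.transpose_smul, gram_isSymm]

/-- Each entry is a `specForm` with uniformly bounded weights, so its fourth moment is of order N²,
uniformly over unitary waveforms. -/
lemma IsNormalized.exists_fourth_moment (h : IsNormalized S κ K) (σ : ℝ) (τ : Fin L → ℝ)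
    (β : Fin L → ℂ) :
    ∃ C : ℝ, 0 < C ∧ ∀ N : ℕ, N ≠ 0 → ∀ U ∈ Matrix.unitaryGroup (Fin N) ℂ,
      vecAvg S N (fun s => ‖fim σ (params τ β) U s - (N : ℝ) • meanGram σ τ β N‖ ^ 4) ≤
        C * (N : ℝ) ^ 2 := by
  obtain ⟨D, hD, hDle⟩ := exists_norm_pow_four_le (ParamIdx L)
  set B : ℝ := 1 + 2 * Real.pi * ∑ l, ‖β l‖ with hB
  have hB0 : 0 ≤ B := by have := Real.pi_pos; positivity
  set G : ℝ := (2 / σ ^ 2 * B ^ 2) ^ 2 with hG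
  refine ⟨D * (∑ _i : ParamIdx L, ∑ _j : ParamIdx L, (40 * K ^ 4) ^ 2 * G ^ 2) + 1,
    by positivity, fun N hN U hU => ?_⟩
  have hg : ∀ (n : Fin N) k l, (2 / σ ^ 2 * gram τ β (freq n) k l) ^ 2 ≤ G := by
    intro n k l
    rw [hG, ← sq_abs, abs_mul, abs_of_nonneg (by positivity : 0 ≤ 2 / σ ^ 2)]
    have : |gram τ β (freq n) k l| ≤ B ^ 2 := by
      rw [gram, Matrix.of_apply]
      refine (Complex.abs_re_le_norm _).trans ?_
      rw [norm_mul, norm_star, sq]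
      exact mul_le_mul (norm_steer_le τ β k (freq_mem n)) (norm_steer_le τ β l (freq_mem n))
        (norm_nonneg _) hB0
    gcongr
  refine (vecAvg_mono S fun s _ => hDle _).trans ?_
  rw [vecAvg_mul_left, vecAvg_sum]
  have hN2 : (0 : ℝ) ≤ (N : ℝ) ^ 2 := by positivity
  have hterm : ∀ i j : ParamIdx L, vecAvg S N (fun s =>
      (fim σ (params τ β) U s - (N : ℝ) • meanGram σ τ β N) i j ^ 4) ≤
      (40 * K ^ 4) ^ 2 * G ^ 2 * (N : ℝ) ^ 2 := by
    intro i j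
    simp only [fim_sub_apply hN]
    refine (h.vecAvg_specForm_four (dft_mul_mem_unitaryGroup hN hU) _).trans ?_
    have h1 : ∑ n : Fin N, (2 / σ ^ 2 * gram τ β (freq n) i j) ^ 2 ≤ N * G := by
      refine (Finset.sum_le_sum fun n _ => hg n i j).trans (le_of_eq ?_)
      simp
    have h0 : 0 ≤ ∑ n : Fin N, (2 / σ ^ 2 * gram τ β (freq n) i j) ^ 2 :=
      Finset.sum_nonneg fun _ _ => sq_nonneg _
    calc _ ≤ (40 * K ^ 4) ^ 2 * (N * G) ^ 2 := by gcongr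
      _ = _ := by ring
  have hsum : ∑ i : ParamIdx L, vecAvg S N (fun s => ∑ j,
      (fim σ (params τ β) U s - (N : ℝ) • meanGram σ τ β N) i j ^ 4) ≤
      (∑ _i : ParamIdx L, ∑ _j : ParamIdx L, (40 * K ^ 4) ^ 2 * G ^ 2) * (N : ℝ) ^ 2 := by
    rw [Finset.sum_mul]
    refine Finset.sum_le_sum fun i _ => ?_
    rw [vecAvg_sum, Finset.sum_mul]
    exact Finset.sum_le_sum fun j _ => hterm i j
  calc _ ≤ D * ((∑ _i : ParamIdx L, ∑ _j : ParamIdx L, (40 * K ^ 4) ^ 2 * G ^ 2) * (N : ℝ) ^ 2) := by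
        gcongr
    _ ≤ _ := by nlinarith

/-- Trace of the delay block. -/
def delayTrace (L : ℕ) : Matrix (ParamIdx L) (ParamIdx L) ℝ →ₗ[ℝ] ℝ where
  toFun M := ∑ l : Fin L, M (.inl l) (.inl l)
  map_add' A B := by simp [Finset.sum_add_distrib]
  map_smul' c A := by simp [Finset.mul_sum]

lemma rangingCRB_eq (s : Fin N → ℂ) :
    rangingCRB σ (params τ β) U s = delayTrace L (fim σ (params τ β) U s)⁻¹ := rfl

lemma delayTrace_apply (M : Matrix (ParamIdx L) (ParamIdx L) ℝ) :
    delayTrace L M = ∑ l : Fin L, M (.inl l) (.inl l) := rfl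

lemma exists_delayTrace_bound (L : ℕ) :
    ∃ C : ℝ, 0 < C ∧ ∀ M : Matrix (ParamIdx L) (ParamIdx L) ℝ, |delayTrace L M| ≤ C * ‖M‖ := by
  refine ⟨‖LinearMap.toContinuousLinearMap (delayTrace L)‖ + 1, by positivity, fun M => ?_⟩
  have := (LinearMap.toContinuousLinearMap (delayTrace L)).le_opNorm M
  rw [Real.norm_eq_abs] at this
  refine le_trans this ?_
  gcongr
  linarith

/-- Expected second-order term of the Neumann expansion of the ranging CRB. -/
def secondOrder (S : Finset ℂ) (σ : ℝ) (τ : Fin L → ℝ) (β : Fin L → ℂ)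
    (U : Matrix (Fin N) (Fin N) ℂ) : ℝ :=
  vecAvg S N fun s => delayTrace L
    (precision σ τ β N * (fim σ (params τ β) U s - (N : ℝ) • meanGram σ τ β N) *
      (precision σ τ β N * (fim σ (params τ β) U s - (N : ℝ) • meanGram σ τ β N)) *
      precision σ τ β N)

/-- P X P X P = (R X P)ᵀ (R X P), which makes the second-order term a sum of squares of linear
functions of the energies. -/
lemma apply_eq_dotProduct {ι : Type} [Fintype ι] [DecidableEq ι] {P X R : Matrix ι ι ℝ}
    (hP : P = Rᵀ * R) (hX : X.IsSymm) (l : ι) :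
    (P * X * (P * X) * P) l l =
      ∑ i, (R *ᵥ (X *ᵥ (P *ᵥ Pi.single l 1))) i ^ 2 := by
  have hPs : Pᵀ = P := by rw [hP, Matrix.transpose_mul, Matrix.transpose_transpose]
  have h1 : (P * X * (P * X) * P) l l =
      Pi.single l 1 ⬝ᵥ ((P * X * (P * X) * P) *ᵥ Pi.single l 1) := by simp
  have h2 : P * X * (P * X) * P = (R * X * P)ᵀ * (R * X * P) := by
    rw [Matrix.transpose_mul, Matrix.transpose_mul, hX.eq, hPs]
    calc _ = P * X * P * X * P := by simp only [mul_assoc]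
      _ = P * X * (Rᵀ * R) * X * P := by rw [← hP]
      _ = _ := by simp only [mul_assoc]
  rw [h1, h2, ← Matrix.mulVec_mulVec, Matrix.dotProduct_mulVec, Matrix.vecMul_transpose,
    dotProduct]
  simp only [Matrix.mulVec_mulVec, sq, mul_assoc]

lemma IsNormalized.secondOrder_eq (h : IsNormalized S κ K) (hN : N ≠ 0)
    (hU : U ∈ Matrix.unitaryGroup (Fin N) ℂ) {R : Matrix (ParamIdx L) (ParamIdx L) ℝ}
    (hR : precision σ τ β N = Rᵀ * R) :
    secondOrder S σ τ β U = ∑ l : Fin L, ∑ i : ParamIdx L,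
      (∑ n : Fin N, (2 / σ ^ 2 *
          (R *ᵥ (gram τ β (freq n) *ᵥ (precision σ τ β N *ᵥ Pi.single (.inl l) 1))) i) ^ 2 -
        (2 - κ) * ∑ k, (∑ n, ‖(dft N * U) n k‖ ^ 2 * (2 / σ ^ 2 *
          (R *ᵥ (gram τ β (freq n) *ᵥ (precision σ τ β N *ᵥ Pi.single (.inl l) 1))) i)) ^ 2) := by
  have h1 : ∀ s : Fin N → ℂ, delayTrace L
      (precision σ τ β N * (fim σ (params τ β) U s - (N : ℝ) • meanGram σ τ β N) *
        (precision σ τ β N * (fim σ (params τ β) U s - (N : ℝ) • meanGram σ τ β N)) *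
        precision σ τ β N) = ∑ l : Fin L, ∑ i : ParamIdx L,
        specForm (dft N * U) (fun n => 2 / σ ^ 2 *
          (R *ᵥ (gram τ β (freq n) *ᵥ (precision σ τ β N *ᵥ Pi.single (.inl l) 1))) i) s ^ 2 := by
    intro s
    rw [delayTrace_apply]
    refine Finset.sum_congr rfl fun l _ => ?_
    rw [apply_eq_dotProduct hR (fim_sub_isSymm hN s)]
    exact Finset.sum_congr rfl fun i _ => by rw [fim_sub_mulVec hN]
  rw [secondOrder]
  simp only [h1]
  rw [vecAvg_sum]
  refine Finset.sum_congr rfl fun l _ => ?_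
  rw [vecAvg_sum]
  refine Finset.sum_congr rfl fun i _ => ?_
  exact h.vecAvg_specForm_sq (dft_mul_mem_unitaryGroup hN hU) _

lemma meanGram_isSymm (σ : ℝ) (τ : Fin L → ℝ) (β : Fin L → ℂ) (N : ℕ) :
    (meanGram σ τ β N).IsSymm := by
  ext k l
  simp only [meanGram, Matrix.transpose_apply, Matrix.of_apply]
  congr 2
  exact Finset.sum_congr rfl fun n _ => congrFun (congrFun (gram_isSymm τ β (freq n)) k) l

lemma exists_sqrt_precision {c : ℝ} (hc : 0 < c)
    (hlow : ∀ x, c * (x ⬝ᵥ x) ≤ x ⬝ᵥ (meanGram σ τ β N *ᵥ x)) :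
    ∃ R : Matrix (ParamIdx L) (ParamIdx L) ℝ, precision σ τ β N = Rᵀ * R := by
  have hpd : (meanGram σ τ β N).PosDef := by
    refine Matrix.PosDef.of_dotProduct_mulVec_pos ?_ fun x hx => ?_
    · rw [Matrix.IsHermitian, Matrix.conjTranspose_eq_transpose_of_trivial]
      exact meanGram_isSymm σ τ β N
    · have h1 : 0 < x ⬝ᵥ x := by simpa using Matrix.dotProduct_star_self_pos_iff.2 hx
      rw [star_trivial]
      exact (mul_pos hc h1).trans_le (hlow x)
  have hps : (precision σ τ β N).PosSemidef := hpd.inv.posSemidef.smul (by positivity)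
  open scoped MatrixOrder in
  obtain ⟨R, hR⟩ := CStarAlgebra.nonneg_iff_eq_star_mul_self.mp hps.nonneg
  exact ⟨R, by rw [hR, Matrix.star_eq_conjTranspose, Matrix.conjTranspose_eq_transpose_of_trivial]⟩

lemma eventually_meanGram_lower_bound (hσ : 0 < σ) (hτ : Function.Injective τ)
    (hβ : ∀ l, β l ≠ 0) :
    ∃ c : ℝ, 0 < c ∧ ∀ᶠ N : ℕ in atTop,
      ∀ x, c * (x ⬝ᵥ x) ≤ x ⬝ᵥ (meanGram σ τ β N *ᵥ x) :=
  eventually_lower_bound (limGram_posDef hσ hτ hβ) (tendsto_meanGram σ τ β)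

lemma smul_meanGram_mul_precision (hN : N ≠ 0) (h : IsUnit (meanGram σ τ β N)) :
    ((N : ℝ) • meanGram σ τ β N) * precision σ τ β N = 1 := by
  have hNr : (N : ℝ) ≠ 0 := by exact_mod_cast hN
  rw [precision, smul_mul_smul_comm, mul_inv_cancel₀ hNr,
    Matrix.mul_nonsing_inv _ ((Matrix.isUnit_iff_isUnit_det _).1 h), one_smul]

/-- The common ∑ gₙ² cancels. The columns of OFDM have point-mass spectra and zero variance, so the
difference is (2 - κ) times the column variances of the other waveform. -/
lemma IsNormalized.exists_secondOrder_gap (h : IsNormalized S κ K) (hκ : κ < 2) (hσ : 0 < σ)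
    (hτ : Function.Injective τ) (hβ : ∀ l, β l ≠ 0) (j : Fin L) {α : ℝ} (hα : 0 < α) :
    ∃ c : ℝ, 0 < c ∧ ∀ᶠ N : ℕ in atTop, ∀ U ∈ Matrix.unitaryGroup (Fin N) ℂ,
      IsFrequencySpread α U →
        c / (N : ℝ) ^ 2 ≤ secondOrder S σ τ β U - secondOrder S σ τ β (ofdm N) := by
  obtain ⟨c, hc, hgap⟩ := exists_variance_gap hσ hτ hβ j (a := α ^ 2) (by positivity)
  obtain ⟨c₀, hc₀, hlow⟩ := eventually_meanGram_lower_bound (L := L) hσ hτ hβ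
  have hκ' : 0 < 2 - κ := by linarith
  refine ⟨(2 - κ) * (1 / 2 * ((2 / σ ^ 2) ^ 2 * c)), by positivity, ?_⟩
  filter_upwards [hgap, hlow, eventually_ne_atTop 0] with N hN1 hN2 hN U hU hsp
  obtain ⟨R, hR⟩ := exists_sqrt_precision hc₀ hN2
  have hV := dft_mul_mem_unitaryGroup hN hU
  set g : Fin L → ParamIdx L → Fin N → ℝ := fun l i n => 2 / σ ^ 2 *
    (R *ᵥ (gram τ β (freq n) *ᵥ (precision σ τ β N *ᵥ Pi.single (.inl l) 1))) i with hg
  set W : Fin N → Fin N → ℝ := fun n k => ‖(dft N * U) n k‖ ^ 2 with hW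
  have hW0 : ∀ n k, 0 ≤ W n k := fun n k => sq_nonneg _
  have hcol : ∀ k, ∑ n, W n k = 1 := sum_norm_sq_col hV
  have hrow : ∀ n, ∑ k, W n k = 1 := sum_norm_sq_row hV
  have hspread : ∀ k, α ^ 2 ≤ ∑ n, (freq n - ∑ m, freq m * W m k) ^ 2 * W n k := by
    intro k
    have h1 := hsp k
    rw [rmsBandwidth] at h1
    have h2 := Real.le_sqrt' hα |>.1 h1
    -- The power spectrum of the `k`-th column of `U` is definitionally `W · k`.
    exact h2
  have hdiff : secondOrder S σ τ β U - secondOrder S σ τ β (ofdm N) =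
      (2 - κ) * ∑ l : Fin L, ∑ i : ParamIdx L,
        (1 / 2 * ∑ k, ∑ n, ∑ m, W n k * W m k * (g l i n - g l i m) ^ 2) := by
    rw [h.secondOrder_eq hN hU hR, h.secondOrder_eq hN (ofdm_mem_unitaryGroup hN) hR,
      dft_mul_ofdm hN, ← Finset.sum_sub_distrib, Finset.mul_sum]
    refine Finset.sum_congr rfl fun l _ => ?_
    rw [← Finset.sum_sub_distrib, Finset.mul_sum]
    refine Finset.sum_congr rfl fun i _ => ?_
    rw [← sum_sq_sub_sum_mean_sq hcol hrow (g l i)]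
    have h1 : ∀ k : Fin N, ∑ n, ‖(1 : Matrix (Fin N) (Fin N) ℂ) n k‖ ^ 2 * g l i n = g l i k := by
      intro k
      rw [Finset.sum_eq_single k]
      · simp
      · intro b _ hb; simp [Matrix.one_apply_ne hb]
      · simp
    have h2 : ∑ k : Fin N, (∑ n, ‖(1 : Matrix (Fin N) (Fin N) ℂ) n k‖ ^ 2 * g l i n) ^ 2 =
        ∑ k, g l i k ^ 2 := Finset.sum_congr rfl fun k _ => by rw [h1]
    change (∑ n, g l i n ^ 2 - (2 - κ) * ∑ k, (∑ n, W n k * g l i n) ^ 2) -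
      (∑ n, g l i n ^ 2 - (2 - κ) * ∑ k : Fin N,
        (∑ n, ‖(1 : Matrix (Fin N) (Fin N) ℂ) n k‖ ^ 2 * g l i n) ^ 2) = _
    rw [h2]; ring
  have hnn : ∀ l i, 0 ≤ 1 / 2 * ∑ k, ∑ n, ∑ m, W n k * W m k * (g l i n - g l i m) ^ 2 := by
    intro l i
    refine mul_nonneg (by norm_num) (Finset.sum_nonneg fun k _ => Finset.sum_nonneg fun n _ =>
      Finset.sum_nonneg fun m _ => ?_)
    exact mul_nonneg (mul_nonneg (hW0 n k) (hW0 m k)) (sq_nonneg _)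
  -- All delays contribute nonnegatively, so a single path suffices for the lower bound.
  have hj : ∑ i : ParamIdx L, (1 / 2 * ∑ k, ∑ n, ∑ m, W n k * W m k * (g j i n - g j i m) ^ 2) ≤
      ∑ l : Fin L, ∑ i : ParamIdx L,
        (1 / 2 * ∑ k, ∑ n, ∑ m, W n k * W m k * (g l i n - g l i m) ^ 2) :=
    Finset.single_le_sum (f := fun l => ∑ i : ParamIdx L,
        (1 / 2 * ∑ k, ∑ n, ∑ m, W n k * W m k * (g l i n - g l i m) ^ 2))
      (fun l _ => Finset.sum_nonneg fun i _ => hnn l i) (Finset.mem_univ j)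
  have hquad : ∀ v : ParamIdx L → ℝ, ∑ i, (R *ᵥ v) i ^ 2 = v ⬝ᵥ (precision σ τ β N *ᵥ v) := by
    intro v
    rw [hR, ← Matrix.mulVec_mulVec, Matrix.dotProduct_mulVec, Matrix.vecMul_transpose, dotProduct]
    simp only [sq]
  have hjeq : ∑ i : ParamIdx L,
      (1 / 2 * ∑ k, ∑ n, ∑ m, W n k * W m k * (g j i n - g j i m) ^ 2) =
      1 / 2 * ((2 / σ ^ 2) ^ 2 * ∑ k, ∑ n, ∑ m, W n k * W m k *
        ((gram τ β (freq n) *ᵥ (precision σ τ β N *ᵥ Pi.single (.inl j) 1) -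
          gram τ β (freq m) *ᵥ (precision σ τ β N *ᵥ Pi.single (.inl j) 1)) ⬝ᵥ
        (precision σ τ β N *ᵥ
          (gram τ β (freq n) *ᵥ (precision σ τ β N *ᵥ Pi.single (.inl j) 1) -
            gram τ β (freq m) *ᵥ (precision σ τ β N *ᵥ Pi.single (.inl j) 1))))) := by
    rw [← Finset.mul_sum]
    congr 1
    rw [Finset.sum_comm, Finset.mul_sum]
    refine Finset.sum_congr rfl fun k _ => ?_
    rw [Finset.sum_comm, Finset.mul_sum]
    refine Finset.sum_congr rfl fun n _ => ?_
    rw [Finset.sum_comm, Finset.mul_sum]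
    refine Finset.sum_congr rfl fun m _ => ?_
    rw [← hquad, Finset.mul_sum, Finset.mul_sum]
    refine Finset.sum_congr rfl fun i _ => ?_
    rw [hg, Matrix.mulVec_sub, Pi.sub_apply]
    ring
  rw [hdiff]
  have hfin := hN1 W hW0 hcol hrow hspread
  calc _ = (2 - κ) * (1 / 2 * ((2 / σ ^ 2) ^ 2 * (c / (N : ℝ) ^ 2))) := by ring
    _ ≤ (2 - κ) * _ := by
      refine mul_le_mul_of_nonneg_left ?_ hκ'.le
      refine le_trans ?_ hj
      rw [hjeq]
      gcongr

end Statistics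

/-! ### Uniform expansion of the conditional ranging CRB -/

section Expansion

open Filter Topology
open scoped Matrix.Norms.L2Operator

variable {S : Finset ℂ} {κ K : ℝ} {L : ℕ} {σ : ℝ} {τ : Fin L → ℝ} {β : Fin L → ℂ}

/-- The spectral energies of OFDM are the symbol powers, so J ≥ m J̄ in the Loewner order for every
symbol vector. This keeps J invertible when OFDM is conditioned on an event of another waveform. -/
lemma fim_ofdm_lower_bound {N : ℕ} (hN : N ≠ 0) {m : ℝ} {s : Fin N → ℂ}
    (hs : ∀ n, m ≤ ‖s n‖ ^ 2) (x : ParamIdx L → ℝ) :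
    m * (N * (x ⬝ᵥ (meanGram σ τ β N *ᵥ x))) ≤ x ⬝ᵥ (fim σ (params τ β) (ofdm N) s *ᵥ x) := by
  have hNr : (N : ℝ) ≠ 0 := by exact_mod_cast hN
  have h1 : fim σ (params τ β) (ofdm N) s - m • ((N : ℝ) • meanGram σ τ β N) =
      ∑ n, (2 / σ ^ 2 * (‖s n‖ ^ 2 - m)) • gram τ β (freq n) := by
    ext k l
    rw [Matrix.sub_apply, fim_apply hN, dft_mul_ofdm hN, Matrix.one_mulVec, Matrix.smul_apply,
      Matrix.smul_apply, meanGram, Matrix.of_apply, Matrix.sum_apply]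
    simp only [Matrix.smul_apply, smul_eq_mul]
    have : m * ((N : ℝ) * (2 / σ ^ 2 * ((N : ℝ)⁻¹ * ∑ n : Fin N, gram τ β (freq n) k l))) =
        2 / σ ^ 2 * (m * ∑ n : Fin N, gram τ β (freq n) k l) := by field_simp
    rw [this, ← mul_sub, Finset.mul_sum _ _ m, ← Finset.sum_sub_distrib, Finset.mul_sum]
    exact Finset.sum_congr rfl fun n _ => by ring
  have h2 : x ⬝ᵥ ((fim σ (params τ β) (ofdm N) s - m • ((N : ℝ) • meanGram σ τ β N)) *ᵥ x) =
      x ⬝ᵥ (fim σ (params τ β) (ofdm N) s *ᵥ x) - m * (N * (x ⬝ᵥ (meanGram σ τ β N *ᵥ x))) := by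
    rw [Matrix.sub_mulVec, dotProduct_sub, Matrix.smul_mulVec, Matrix.smul_mulVec,
      dotProduct_smul, dotProduct_smul, smul_eq_mul, smul_eq_mul]
  rw [← sub_nonneg, ← h2, h1, Matrix.sum_mulVec, dotProduct_sum]
  refine Finset.sum_nonneg fun n _ => ?_
  rw [Matrix.smul_mulVec, dotProduct_smul, dotProduct_gram_mulVec, smul_eq_mul]
  have : 0 ≤ ‖s n‖ ^ 2 - m := sub_nonneg.2 (hs n)
  positivity

lemma vecAvg_indicator_le_of_four {N : ℕ} {A : Set (Fin N → ℂ)} {z : (Fin N → ℂ) → ℝ} {ρ : ℝ}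
    (hρ : 0 < ρ) (hA : ∀ s ∈ A, ρ ≤ z s) :
    vecAvg S N (A.indicator fun _ => (1 : ℝ)) ≤ (ρ ^ 4)⁻¹ * vecAvg S N (fun s => z s ^ 4) := by
  rw [← vecAvg_mul_left]
  refine vecAvg_mono S fun s _ => ?_
  by_cases h : s ∈ A
  · rw [Set.indicator_of_mem h, inv_mul_eq_div, one_le_div (by positivity)]
    exact pow_le_pow_left₀ hρ.le (hA s h) 4
  · rw [Set.indicator_of_notMem h]
    have : 0 ≤ z s ^ 4 := by positivity
    positivity

/-- `V` is an auxiliary waveform whose event may define `A`; thus one estimate covers all three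
conditionings. The inclusion from below makes the complement of `A` rare; the alternative in the
last hypothesis bounds J⁻¹ on `A`, by the Neumann series or, for OFDM, by the minimal symbol power.
-/
lemma IsNormalized.exists_expansion (h : IsNormalized S κ K) (hσ : 0 < σ)
    (hτ : Function.Injective τ) (hβ : ∀ l, β l ≠ 0) {ρ : ℝ} (hρ : 0 < ρ) (hρ1 : ρ < 1) {m : ℝ}
    (hm : 0 < m) (hSm : ∀ z ∈ S, m ≤ ‖z‖ ^ 2) {δ : ℝ} (hδ : 0 < δ) :
    ∀ᶠ N : ℕ in atTop, ∀ U ∈ Matrix.unitaryGroup (Fin N) ℂ,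
      ∀ V ∈ Matrix.unitaryGroup (Fin N) ℂ, ∀ A : Set (Fin N → ℂ),
      goodEvent S σ (params τ β) ρ V ∩ goodEvent S σ (params τ β) ρ (ofdm N) ⊆ A →
      (A ⊆ goodEvent S σ (params τ β) ρ U ∨ U = ofdm N) →
      CondCRBWellDefined S σ (params τ β) U A ∧
        |condCRB S σ (params τ β) U A - delayTrace L (precision σ τ β N) -
          secondOrder S σ τ β U| ≤ δ / (N : ℝ) ^ 2 := by
  obtain ⟨c, hc, hlow⟩ := eventually_meanGram_lower_bound (L := L) hσ hτ hβ
  obtain ⟨C₄, hC₄, hfour⟩ := h.exists_fourth_moment (L := L) σ τ β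
  obtain ⟨T, hT, htr⟩ := exists_delayTrace_bound L
  have hρ' : 0 < 1 - ρ := by linarith
  set E : ℝ := c⁻¹ ^ 4 * C₄ with hE
  have hE0 : 0 < E := by positivity
  -- A sum of all constants needed: fourth moment of Z, the two excluded events, the norm of P, and
  -- the norm of J⁻¹ in either case.
  set C : ℝ := E + 2 * ((ρ ^ 4)⁻¹ * E) + T * c⁻¹ + T * (c⁻¹ / (1 - ρ)) + T * (m * c)⁻¹ with hC
  have hp1 : 0 < 2 * ((ρ ^ 4)⁻¹ * E) := by positivity
  have hp2 : 0 < T * c⁻¹ := by positivity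
  have hp3 : 0 < T * (c⁻¹ / (1 - ρ)) := by positivity
  have hp4 : 0 < T * (m * c)⁻¹ := by positivity
  have hC0 : 0 < C := by positivity
  -- Makes the non-decaying part 4 C (C + 1) ε of the error equal to δ/2.
  set ε : ℝ := δ / (8 * (C * (C + 1))) with hε
  have hε0 : 0 < ε := by positivity
  have hlim1 : Tendsto (fun N : ℕ => 2 * (C * (C + 1)) * (2 / (ε * N) + (C + 1) / N)) atTop (𝓝 0) := by
    have h1 : Tendsto (fun N : ℕ => (2 * (C * (C + 1)) * (2 / ε + (C + 1))) * ((N : ℝ))⁻¹)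
        atTop (𝓝 ((2 * (C * (C + 1)) * (2 / ε + (C + 1))) * 0)) :=
      tendsto_inv_atTop_nhds_zero_nat.const_mul _
    rw [mul_zero] at h1
    refine h1.congr fun N => ?_
    rw [← div_div, div_eq_mul_inv (2 / ε), div_eq_mul_inv (C + 1)]
    ring
  have hlim2 : Tendsto (fun N : ℕ => C / (N : ℝ) ^ 2) atTop (𝓝 0) := by
    have h1 := (tendsto_inv_atTop_nhds_zero_nat (𝕜 := ℝ)).pow 2 |>.const_mul C
    rw [zero_pow two_ne_zero, mul_zero] at h1
    refine h1.congr fun N => ?_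
    rw [inv_pow, div_eq_mul_inv]
  filter_upwards [hlow, eventually_gt_atTop 0, hlim1.eventually_lt_const (half_pos hδ),
    hlim2.eventually_lt_const (by norm_num : (0 : ℝ) < 1 / 2)] with N hN1 hN0 hN2 hN3 U hU V hV A hA1 hA2
  have hN : N ≠ 0 := hN0.ne'
  have hNpos : (0 : ℝ) < N := by exact_mod_cast hN0
  obtain ⟨hMu, hMn⟩ := norm_inv_le_of_lower_bound hc hN1
  have hMP := smul_meanGram_mul_precision (σ := σ) (τ := τ) (β := β) hN hMu
  set P := precision σ τ β N with hP
  set M := (N : ℝ) • meanGram σ τ β N with hM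
  have hMinv : M⁻¹ = P := Matrix.inv_eq_right_inv hMP
  have hPn : ‖P‖ ≤ c⁻¹ / N := by
    rw [hP, precision, norm_smul, norm_inv, Real.norm_of_nonneg hNpos.le, inv_mul_eq_div]
    gcongr
  have hgood : ∀ V ∈ Matrix.unitaryGroup (Fin N) ℂ, ∀ s,
      s ∈ goodEvent S σ (params τ β) ρ V ↔ ‖P * (fim σ (params τ β) V s - M)‖ < ρ := by
    intro V hV s
    rw [goodEvent, Set.mem_ofPred_eq, spectralNorm_eq_norm, fluctuation, h.meanFim_eq hN hV, ← hM,
      hMinv]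
  have hz4 : ∀ V ∈ Matrix.unitaryGroup (Fin N) ℂ,
      vecAvg S N (fun s => ‖P * (fim σ (params τ β) V s - M)‖ ^ 4) ≤ E / (N : ℝ) ^ 2 := by
    intro V hV
    have h1 : vecAvg S N (fun s => ‖P * (fim σ (params τ β) V s - M)‖ ^ 4) ≤
        vecAvg S N (fun s => (c⁻¹ / N) ^ 4 * ‖fim σ (params τ β) V s - M‖ ^ 4) := by
      refine vecAvg_mono S fun s _ => ?_
      rw [← mul_pow]
      refine pow_le_pow_left₀ (norm_nonneg _) ((norm_mul_le _ _).trans ?_) 4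
      gcongr
    refine h1.trans ?_
    rw [vecAvg_mul_left]
    calc _ ≤ (c⁻¹ / N) ^ 4 * (C₄ * (N : ℝ) ^ 2) := by gcongr; exact hfour N hN V hV
      _ = _ := by rw [hE]; field_simp
  have hOU := ofdm_mem_unitaryGroup hN
  have hAc : vecAvg S N (Aᶜ.indicator fun _ => (1 : ℝ)) ≤ C / (N : ℝ) ^ 2 := by
    have h1 : vecAvg S N (Aᶜ.indicator fun _ => (1 : ℝ)) ≤
        vecAvg S N ((goodEvent S σ (params τ β) ρ V)ᶜ.indicator fun _ => (1 : ℝ)) +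
          vecAvg S N ((goodEvent S σ (params τ β) ρ (ofdm N))ᶜ.indicator fun _ => (1 : ℝ)) := by
      rw [← vecAvg_add]
      refine vecAvg_mono S fun s _ => ?_
      have hi : ∀ B : Set (Fin N → ℂ), 0 ≤ B.indicator (fun _ => (1 : ℝ)) s := fun B =>
        Set.indicator_nonneg (fun _ _ => zero_le_one) s
      by_cases hsA : s ∈ A
      · rw [Set.indicator_of_notMem (by simpa using hsA)]
        exact add_nonneg (hi _) (hi _)
      · rw [Set.indicator_of_mem (by simpa using hsA)]
        by_cases hsV : s ∈ goodEvent S σ (params τ β) ρ V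
        · have : s ∉ goodEvent S σ (params τ β) ρ (ofdm N) := fun h' => hsA (hA1 ⟨hsV, h'⟩)
          rw [Set.indicator_of_mem (s := (goodEvent S σ (params τ β) ρ (ofdm N))ᶜ) this]
          linarith [hi (goodEvent S σ (params τ β) ρ V)ᶜ]
        · rw [Set.indicator_of_mem (s := (goodEvent S σ (params τ β) ρ V)ᶜ) hsV]
          linarith [hi (goodEvent S σ (params τ β) ρ (ofdm N))ᶜ]
    have h2 : ∀ Q ∈ Matrix.unitaryGroup (Fin N) ℂ,
        vecAvg S N ((goodEvent S σ (params τ β) ρ Q)ᶜ.indicator fun _ => (1 : ℝ)) ≤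
          (ρ ^ 4)⁻¹ * (E / (N : ℝ) ^ 2) := by
      intro Q hQ
      refine (vecAvg_indicator_le_of_four (S := S) hρ
        (z := fun s => ‖P * (fim σ (params τ β) Q s - M)‖) ?_).trans ?_
      · intro s hs
        exact not_lt.1 fun h' => hs ((hgood Q hQ s).2 h')
      · gcongr
        exact hz4 Q hQ
    have h3 : C / (N : ℝ) ^ 2 = (C - 2 * ((ρ ^ 4)⁻¹ * E)) / (N : ℝ) ^ 2 +
        ((ρ ^ 4)⁻¹ * (E / (N : ℝ) ^ 2) + (ρ ^ 4)⁻¹ * (E / (N : ℝ) ^ 2)) := by ring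
    have h4 : 0 ≤ (C - 2 * ((ρ ^ 4)⁻¹ * E)) / (N : ℝ) ^ 2 := by
      have : 0 ≤ C - 2 * ((ρ ^ 4)⁻¹ * E) := by rw [hC]; linarith
      positivity
    linarith [h2 V hV, h2 _ hOU]
  have hinv : ∀ s, (∀ i, s i ∈ S) → s ∈ A → IsUnit (fim σ (params τ β) U s) ∧
      T * ‖(fim σ (params τ β) U s)⁻¹‖ ≤ C / N := by
    intro s hs hsA
    rcases hA2 with hsub | rfl
    · have h1 := (hgood U hU s).1 (hsub hsA)
      obtain ⟨h2, h3⟩ := norm_inv_le_of_norm_lt_one hMP hρ1 h1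
      refine ⟨h2, ?_⟩
      calc _ ≤ T * ((c⁻¹ / N) / (1 - ρ)) := by
            gcongr
            exact h3.trans (by gcongr)
        _ = T * (c⁻¹ / (1 - ρ)) / N := by field_simp
        _ ≤ C / N := by gcongr; rw [hC]; linarith
    · have h1 : ∀ x : ParamIdx L → ℝ, (m * N * c) * (x ⬝ᵥ x) ≤
          x ⬝ᵥ (fim σ (params τ β) (ofdm N) s *ᵥ x) := by
        intro x
        refine le_trans ?_ (fim_ofdm_lower_bound hN (fun n => hSm _ (hs n)) x)
        calc _ = m * (N * (c * (x ⬝ᵥ x))) := by ring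
          _ ≤ _ := by gcongr; exact hN1 x
      obtain ⟨h2, h3⟩ := norm_inv_le_of_lower_bound (by positivity) h1
      refine ⟨h2, ?_⟩
      calc _ ≤ T * (m * N * c)⁻¹ := by gcongr
        _ = T * (m * c)⁻¹ / N := by field_simp
        _ ≤ C / N := by gcongr; rw [hC]; linarith
  have hTP : T * ‖P‖ ≤ C / N := by
    calc _ ≤ T * (c⁻¹ / N) := by gcongr
      _ = T * c⁻¹ / N := by ring
      _ ≤ C / N := by gcongr; rw [hC]; linarith
  have hApos : 0 < vecAvg S N (A.indicator fun _ => (1 : ℝ)) := by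
    have h1 : vecAvg S N (A.indicator fun _ => (1 : ℝ)) +
        vecAvg S N (Aᶜ.indicator fun _ => (1 : ℝ)) = 1 := by
      rw [← vecAvg_add]
      have : ∀ s : Fin N → ℂ, A.indicator (fun _ => (1 : ℝ)) s +
          Aᶜ.indicator (fun _ => (1 : ℝ)) s = 1 := fun s =>
        Set.indicator_self_add_compl_apply A (fun _ => (1 : ℝ)) s
      simp only [this]
      exact vecAvg_const _ h.nonempty _
    linarith
  refine ⟨⟨?_, ?_⟩, ?_⟩
  · rw [← vectorLaw_real h.nonempty, measureReal_def] at hApos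
    exact (ENNReal.toReal_pos_iff.1 hApos).1
  · exact ae_cond_vectorLaw h.nonempty A fun s hs hsA => (hinv s hs hsA).1
  · have hexp := cond_expansion h.nonempty hN0 A (C := C) (ε := ε)
      (f := rangingCRB σ (params τ β) U)
      (f₀ := delayTrace L P)
      (f₁ := fun s => delayTrace L (P * (fim σ (params τ β) U s - M) * P))
      (f₂ := fun s => delayTrace L (P * (fim σ (params τ β) U s - M) *
        (P * (fim σ (params τ β) U s - M)) * P))
      (z := fun s => ‖P * (fim σ (params τ β) U s - M)‖) hC0 hε0 (fun s => norm_nonneg _)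
      ((hz4 U hU).trans (by gcongr; rw [hC]; linarith)) hAc hN3.le ?_ ?_ ?_ ?_
    · rw [condCRB, integral_cond_vectorLaw h.nonempty]
      refine hexp.trans ?_
      have e : 2 * (C * (C + 1) / (N : ℝ) ^ 2 * (2 * ε + 2 / (ε * N) + (C + 1) / N)) =
          (2 * (C * (C + 1)) * (2 * ε) + 2 * (C * (C + 1)) * (2 / (ε * N) + (C + 1) / N)) /
            (N : ℝ) ^ 2 := by ring
      rw [e]
      have e2 : 2 * (C * (C + 1)) * (2 * ε) = δ / 2 := by rw [hε]; field_simp; norm_num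
      rw [e2]
      gcongr
      linarith
    · intro s hs hsA
      obtain ⟨hJ, hJn⟩ := hinv s hs hsA
      set Z := P * (fim σ (params τ β) U s - M) with hZ
      have h1 : rangingCRB σ (params τ β) U s -
          (delayTrace L P - delayTrace L (Z * P) + delayTrace L (Z * Z * P)) =
          -delayTrace L (Z * Z * Z * (fim σ (params τ β) U s)⁻¹) := by
        have h2 := congrArg (delayTrace L) (inv_eq_neumann hMP hJ)
        rw [← hZ, map_sub, map_add, map_sub] at h2
        rw [rangingCRB_eq]
        linarith
      rw [h1, abs_neg]
      refine (htr _).trans ?_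
      have h3 : ‖Z * Z * Z * (fim σ (params τ β) U s)⁻¹‖ ≤
          ‖Z‖ ^ 3 * ‖(fim σ (params τ β) U s)⁻¹‖ := by
        refine (norm_mul_le _ _).trans ?_
        gcongr
        calc ‖Z * Z * Z‖ ≤ ‖Z * Z‖ * ‖Z‖ := norm_mul_le _ _
          _ ≤ ‖Z‖ * ‖Z‖ * ‖Z‖ := by gcongr; exact norm_mul_le _ _
          _ = ‖Z‖ ^ 3 := by ring
      calc _ ≤ T * (‖Z‖ ^ 3 * ‖(fim σ (params τ β) U s)⁻¹‖) := by gcongr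
        _ = (T * ‖(fim σ (params τ β) U s)⁻¹‖) * ‖Z‖ ^ 3 := by ring
        _ ≤ _ := by gcongr
    · intro s
      refine (htr _).trans ?_
      calc _ ≤ T * (‖P * (fim σ (params τ β) U s - M)‖ * ‖P‖) := by
            gcongr; exact norm_mul_le _ _
        _ = (T * ‖P‖) * ‖P * (fim σ (params τ β) U s - M)‖ := by ring
        _ ≤ _ := by gcongr
    · intro s
      refine (htr _).trans ?_
      set Z := P * (fim σ (params τ β) U s - M)
      calc _ ≤ T * (‖Z‖ * ‖Z‖ * ‖P‖) := by
            gcongr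
            refine (norm_mul_le _ _).trans ?_
            gcongr
            exact norm_mul_le _ _
        _ = (T * ‖P‖) * ‖Z‖ ^ 2 := by ring
        _ ≤ _ := by gcongr
    · have h1 := vecAvg_linear S (delayTrace L ∘ₗ LinearMap.mulRight ℝ P ∘ₗ LinearMap.mulLeft ℝ P)
        (fun s => fim σ (params τ β) U s - M)
      have h2 : vecAvg S N (fun s => fim σ (params τ β) U s - M) = 0 := by
        ext k l
        have h3 := vecAvg_linear S
          (LinearMap.proj l ∘ₗ LinearMap.proj k : (ParamIdx L → ParamIdx L → ℝ) →ₗ[ℝ] ℝ)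
          (fun s => fim σ (params τ β) U s - M)
        refine h3.symm.trans ?_
        have h4 := h.vecAvg_specForm (dft_mul_mem_unitaryGroup hN hU)
          (fun n => 2 / σ ^ 2 * gram τ β (freq n) k l)
        rw [Matrix.zero_apply, ← h4]
        refine vecAvg_congr S fun s _ => ?_
        exact fim_sub_apply hN s k l
      rw [h2, map_zero] at h1
      exact h1

end Expansion

/-! ### Moments of the constellation -/

section Constellation

variable {S : Finset ℂ}

lemma nonempty_of_unitPower (h : UnitPower S) : S.Nonempty := by
  by_contra hS
  rw [Finset.not_nonempty_iff_eq_empty] at hS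
  simp [UnitPower, symbolLaw, hS] at h

/-- The summand is odd and the alphabet is symmetric. -/
lemma symAvg_third_eq_zero (h : CentrallySymmetric S) :
    symAvg S (fun z => ((‖z‖ ^ 2 : ℝ) : ℂ) * z) = 0 := by
  have hneg : ∀ z ∈ S, -z ∈ S := fun z hz => (h _ z hz rfl).1
  have h1 : ∑ z ∈ S, ((‖z‖ ^ 2 : ℝ) : ℂ) * z = ∑ z ∈ S, -(((‖z‖ ^ 2 : ℝ) : ℂ) * z) :=
    Finset.sum_nbij' (fun z => -z) (fun z => -z) hneg hneg (fun z _ => neg_neg z)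
      (fun z _ => neg_neg z) (fun z _ => by simp)
  rw [Finset.sum_neg_distrib] at h1
  rw [symAvg, self_eq_neg.1 h1, smul_zero]

lemma isNormalized_of_constellation (hpow : UnitPower S) (hsec : SecondOrderSymmetric S)
    (hcen : CentrallySymmetric S) : IsNormalized S (kurtosis S) (1 + ∑ z ∈ S, ‖z‖) := by
  have hS := nonempty_of_unitPower hpow
  have hint : ∀ g : ℂ → ℝ, ∫ z, g z ∂symbolLaw S = symAvg S g := integral_symbolLaw hS
  refine ⟨hS, ?_, ?_, ?_, symAvg_third_eq_zero hcen, ?_, ?_, ?_⟩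
  · rw [← hint]; exact hpow
  · rw [← integral_symbolLaw hS]; exact hsec.1
  · rw [← integral_symbolLaw hS]; exact hsec.2
  · have h2 : ∫ z, ‖z‖ ^ 2 ∂symbolLaw S = 1 := hpow
    rw [kurtosis, hsec.1]
    simp only [sub_zero]
    rw [h2, ← hint]
    norm_num
  · intro z hz
    have := Finset.single_le_sum (f := fun z : ℂ => ‖z‖) (fun _ _ => norm_nonneg _) hz
    linarith
  · have : 0 ≤ ∑ z ∈ S, ‖z‖ := Finset.sum_nonneg fun _ _ => norm_nonneg _
    linarith

lemma exists_power_lower_bound (hS : S.Nonempty) (h0 : (0 : ℂ) ∉ S) :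
    ∃ m : ℝ, 0 < m ∧ ∀ z ∈ S, m ≤ ‖z‖ ^ 2 := by
  obtain ⟨z₀, hz₀, hmin⟩ := S.exists_min_image (fun z => ‖z‖ ^ 2) hS
  have : z₀ ≠ 0 := fun h => h0 (h ▸ hz₀)
  exact ⟨‖z₀‖ ^ 2, by positivity, hmin⟩

end Constellation

end RangingCRB

end

open RangingCRB
theorem theorem1
    (S : Finset ℂ) (hS_zero : (0 : ℂ) ∉ S) (hS_power : UnitPower S)
    (hS_second : SecondOrderSymmetric S) (hS_central : CentrallySymmetric S)
    (hS_kurt : kurtosis S < 2)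
    (L : ℕ) (hL : 1 ≤ L) (τ : Fin L → ℝ) (β : Fin L → ℂ)
    (hτ : ∀ k l, k ≠ l → τ k ≠ τ l) (hβ : ∀ l, β l ≠ 0)
    (σ : ℝ) (hσ : 0 < σ) (ρ : ℝ) (hρ_pos : 0 < ρ) (hρ_lt : ρ < 1)
    (α : ℝ) (hα : 0 < α)
    (lengths : Set ℕ) (U : (N : ℕ) → Matrix (Fin N) (Fin N) ℂ)
    (hU_unitary : ∀ N ∈ lengths, U N ∈ Matrix.unitaryGroup (Fin N) ℂ)
    (hU_spread : ∀ N ∈ lengths, IsFrequencySpread α (U N)) :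
    ∃ c : ℝ, 0 < c ∧ ∃ N₀ : ℕ, ∀ N ∈ lengths, N₀ ≤ N →
      ∀ A B : Set (Fin N → ℂ),
        ((A = goodEvent S σ (params τ β) ρ (U N) ∧
            B = goodEvent S σ (params τ β) ρ (ofdm N)) ∨
          (A = goodEvent S σ (params τ β) ρ (U N) ∧
            B = goodEvent S σ (params τ β) ρ (U N)) ∨
          (A = goodEvent S σ (params τ β) ρ (U N) ∩ goodEvent S σ (params τ β) ρ (ofdm N) ∧
            B = goodEvent S σ (params τ β) ρ (U N) ∩
              goodEvent S σ (params τ β) ρ (ofdm N))) →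
        CondCRBWellDefined S σ (params τ β) (U N) A ∧
          CondCRBWellDefined S σ (params τ β) (ofdm N) B ∧
          c / (N : ℝ) ^ 2 ≤
            condCRB S σ (params τ β) (U N) A - condCRB S σ (params τ β) (ofdm N) B ∧
          condCRB S σ (params τ β) (ofdm N) B < condCRB S σ (params τ β) (U N) A := by
  have hnorm := isNormalized_of_constellation hS_power hS_second hS_central
  obtain ⟨m, hm, hSm⟩ := exists_power_lower_bound hnorm.nonempty hS_zero
  have hinj : Function.Injective τ := fun k l hkl => by
    by_contra hne
    exact hτ k l hne hkl
  obtain ⟨c, hc, hgap⟩ := hnorm.exists_secondOrder_gap hS_kurt hσ hinj hβ ⟨0, hL⟩ hα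
  -- An error of `c / 4` for each of the two waveforms leaves half of the second-order gap.
  have hexp := hnorm.exists_expansion hσ hinj hβ hρ_pos hρ_lt hm hSm
    (by positivity : (0 : ℝ) < c / 4)
  obtain ⟨N₀, hN₀⟩ := Filter.eventually_atTop.1
    ((hgap.and hexp).and (Filter.eventually_gt_atTop 0))
  refine ⟨c / 2, by positivity, N₀, fun N hN hle A B hAB => ?_⟩
  obtain ⟨⟨h1, h2⟩, h3⟩ := hN₀ N hle
  have hNpos : (0 : ℝ) < N := by exact_mod_cast h3
  have hUN := hU_unitary N hN
  have hg := h1 (U N) hUN (hU_spread N hN)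
  have hsub : ∀ D : Set (Fin N → ℂ), D = A ∨ D = B → goodEvent S σ (params τ β) ρ (U N) ∩
      goodEvent S σ (params τ β) ρ (ofdm N) ⊆ D := by
    rintro D (rfl | rfl) <;> rcases hAB with ⟨rfl, rfl⟩ | ⟨rfl, rfl⟩ | ⟨rfl, rfl⟩
    exacts [Set.inter_subset_left, Set.inter_subset_left, subset_rfl, Set.inter_subset_right,
      Set.inter_subset_left, subset_rfl]
  have hAU : A ⊆ goodEvent S σ (params τ β) ρ (U N) := by
    rcases hAB with ⟨rfl, -⟩ | ⟨rfl, -⟩ | ⟨rfl, -⟩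
    exacts [subset_rfl, subset_rfl, Set.inter_subset_left]
  obtain ⟨hA, hA'⟩ := h2 (U N) hUN (U N) hUN A (hsub A (Or.inl rfl)) (Or.inl hAU)
  -- OFDM always uses the second alternative, since `B` need not lie in its own event.
  obtain ⟨hB, hB'⟩ := h2 (ofdm N) (ofdm_mem_unitaryGroup h3.ne') (U N) hUN B
    (hsub B (Or.inr rfl)) (Or.inr rfl)
  have hdiff : c / 2 / (N : ℝ) ^ 2 ≤
      condCRB S σ (params τ β) (U N) A - condCRB S σ (params τ β) (ofdm N) B := by
    have e : c / 2 / (N : ℝ) ^ 2 =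
        c / (N : ℝ) ^ 2 - c / 4 / (N : ℝ) ^ 2 - c / 4 / (N : ℝ) ^ 2 := by ring
    rw [e]
    linarith [(abs_le.1 hA').1, (abs_le.1 hB').2]
  have hpos : 0 < c / 2 / (N : ℝ) ^ 2 := by positivity
  exact ⟨hA, hB, hdiff, by linarith⟩
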